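/- Let $\mathbb{S}\subset\mathbb{C}$ be the unit circle, $\mathbb{D}$ the open unit disk and $\sigma_2(z)=z^2$ on $\mathbb{S}$. For $A\subset\mathbb S$ let $\mathrm{CH}(A)$ be its convex hull. A chord $\overline{ab}$ ($a,b\in\mathbb S$) is degenerate if $a=b$; put $\sigma_2(\overline{ab})=\overline{\sigma_2(a)\sigma_2(b)}$, and for $X=\mathrm{CH}(X\cap\mathbb S)$ put $\sigma_2(X)=\mathrm{CH}(\sigma_2(X\cap\mathbb S))$. A geodesic lamination is a set $\mathcal L$ of (possibly degenerate) chords, called leaves, such that any two distinct leaves meet at most in a common endpoint, all points of $\mathbb S$ are leaves, and the union $\mathcal L^+$ of all leaves is closed. Its gaps are the closures of the components of $\mathbb D\setminus\mathcal L^+$. It is ($\sigma_2$-)invariant (in the sibling sense) if: (1) $\sigma_2(\ell)\in\mathcal L$ for every $\ell\in\mathcal L$; (2) every $\ell\in\mathcal L$ equals $\sigma_2(\ell')$ for some $\ell'\in\mathcal L$; (3) for every $\ell\in\mathcal L$ with $\sigma_2(\ell)$ non-degenerate there is $\ell_2\in\mathcal L$ disjoint from $\ell$ with $\sigma_2(\ell_2)=\sigma_2(\ell)$.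 A $\sigma_2$-invariant laminational equivalence relation is an equivalence relation $\sim$ on $\mathbb S$ with closed graph and finite classes such that distinct classes have disjoint convex hulls, the $\sigma_2$-image of every class is a class, and for every class $\mathbf g$ the map $\sigma_2|_{\mathbf g}$ extends to an orientation preserving covering map of $\mathbb S$ under which $\mathbf g$ is the full preimage of $\sigma_2(\mathbf g)$. A $\sigma_2$-invariant q-lamination is the set of all points of $\mathbb S$ and all edges of convex hulls of classes of such a relation $\sim$, where an edge of $\mathrm{CH}(A)$ is a chord contained in the boundary of $\mathrm{CH}(A)$. A critical leaf is a non-degenerate leaf whose endpoints have the same $\sigma_2$-image. A critical set of $\mathcal L$ is a critical leaf of $\mathcal L$ or a gap $G$ of $\mathcal L$ on which $\sigma_2$ has degree two, that is, every point of $\sigma_2(G\cap\mathbb S)$ has two preimages in $G\cap\mathbb S$. A generalized critical quadrilateral is either the convex hull of four distinct points of $\mathbb S$ whose $\sigma_2$-image is a chord, or a non-degenerate chord whose endpoints have the same $\sigma_2$-image. **Lemma.** Let $\mathcal L$ be a $\sigma_2$-invariant q-lamination with a critical set $Q$ that is a generalized critical quadrilateral. Then $\mathcal L$ is a $\sigma_2$-invariant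 geodesic lamination, and it is the only $\sigma_2$-invariant geodesic lamination with critical set $Q$. -/

import Mathlib

noncomputable section

namespace GeoLam

/-- The map `σ_d` on the unit circle `𝕊 ⊂ ℂ` (that is, `t ↦ d t` on `ℝ / ℤ`). -/
def sigma (d : ℕ) (z : Circle) : Circle := z ^ d

/-- The convex hull `CH(A)` in the plane of a set of points of the unit circle. -/
def hull (A : Set Circle) : Set ℂ := convexHull ℝ ((fun x : Circle => (x : ℂ)) '' A)

/-- The basis `X' = X ∩ 𝕊` of a subset of the closed disk. -/
def basis (X : Set ℂ) : Set Circle := {x | (x : ℂ) ∈ X}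

/-- `σ_d(X) = CH(σ_d(X ∩ 𝕊))`, for sets `X` with `X = CH(X ∩ 𝕊)`. -/
def sigmaSet (d : ℕ) (X : Set ℂ) : Set ℂ := hull (sigma d '' basis X)

/-! ### Chords -/

/-- A (possibly degenerate) chord of the closed unit disk, given by its unordered pair of
endpoints; it is degenerate iff the two endpoints coincide. -/
abbrev Chord := Sym2 Circle

/-- The closed straight segment that a chord is. -/
def Chord.seg (l : Chord) : Set ℂ := hull {x | x ∈ l}

/-- The image chord: `σ_d` of the chord with endpoints `a, b` has endpoints `σ_d a, σ_d b`. -/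
def sigmaChord (d : ℕ) (l : Chord) : Chord := Sym2.map (sigma d) l

/-- A critical chord: a non-degenerate chord whose endpoints have the same image. -/
def IsCriticalChord (d : ℕ) (l : Chord) : Prop := ¬ l.IsDiag ∧ (sigmaChord d l).IsDiag

/-- Two chords are unlinked if they meet at most in a common endpoint. -/
def Unlinked (l m : Chord) : Prop :=
  ∀ z ∈ Chord.seg l ∩ Chord.seg m, ∃ x : Circle, (x : ℂ) = z ∧ x ∈ l ∧ x ∈ m

/-! ### Geodesic laminations -/

/-- The solid `𝓛⁺`: the union of all leaves. -/
def solid (L : Set Chord) : Set ℂ := ⋃ l ∈ L, Chord.seg l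

structure IsGeodesicLamination (L : Set Chord) : Prop where
  unlinked : ∀ l ∈ L, ∀ m ∈ L, l ≠ m → Unlinked l m
  points_mem : ∀ x : Circle, s(x, x) ∈ L
  isClosed_solid : IsClosed (solid L)

/-- A gap: the closure of a component of the open disk minus the solid. -/
def IsGap (L : Set Chord) (G : Set ℂ) : Prop :=
  ∃ z ∈ Metric.ball (0 : ℂ) 1 \ solid L,
    G = closure (connectedComponentIn (Metric.ball (0 : ℂ) 1 \ solid L) z)

/-- Sibling `σ_d`-invariant geodesic laminations. -/
structure IsSiblingInvariant (d : ℕ) (L : Set Chord) : Prop where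
  isGeodesicLamination : IsGeodesicLamination L
  forward : ∀ l ∈ L, sigmaChord d l ∈ L
  backward : ∀ l ∈ L, ∃ m ∈ L, sigmaChord d m = l
  siblings : ∀ l ∈ L, ¬ (sigmaChord d l).IsDiag →
    ∃ S : Finset Chord, S.card = d ∧ l ∈ S ∧ (∀ m ∈ S, m ∈ L) ∧
      (∀ m ∈ S, sigmaChord d m = sigmaChord d l) ∧
      (∀ m ∈ S, ∀ n ∈ S, m ≠ n → Disjoint (Chord.seg m) (Chord.seg n))

/-! ### Laminational equivalence relations and q-laminations -/

structure IsLaminational (r : Setoid Circle) : Prop where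
  isClosed_graph : IsClosed {p : Circle × Circle | r p.1 p.2}
  disjoint_hulls : ∀ g ∈ r.classes, ∀ h ∈ r.classes, g ≠ h → Disjoint (hull g) (hull h)
  finite_classes : ∀ g ∈ r.classes, g.Finite

/-- Orientation preserving covering maps of the circle: covering maps that have a strictly
increasing continuous lift to the line. -/
def IsOrientationPreservingCovering (f : Circle → Circle) : Prop :=
  IsCoveringMap f ∧
    ∃ F : ℝ → ℝ, Continuous F ∧ StrictMono F ∧ ∀ t, f (Circle.exp t) = Circle.exp (F t)

/-- `σ_d`-invariance of an equivalence relation: the image of a class is a class, and `σ_d` on a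
class `g` extends to an orientation preserving covering map of the circle under which `g` is the
full preimage of `σ_d(g)`. -/
structure IsInvariantRel (d : ℕ) (r : Setoid Circle) : Prop where
  forward : ∀ g ∈ r.classes, sigma d '' g ∈ r.classes
  covering : ∀ g ∈ r.classes, ∃ f : Circle → Circle, IsOrientationPreservingCovering f ∧
    (∀ x ∈ g, f x = sigma d x) ∧ f ⁻¹' (sigma d '' g) = g

/-- The set of leaves of `∼`: all points of the circle and all edges of convex hulls of
classes, an edge being a chord contained in the boundary of the hull. -/
def leavesOf (r : Setoid Circle) : Set Chord :=
  {l | l.IsDiag ∨ ∃ g ∈ r.classes, Chord.seg l ⊆ frontier (hull g)}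

/-- `σ_d`-invariant q-laminations: those generated by a `σ_d`-invariant laminational
equivalence relation. -/
def IsInvariantQLamination (d : ℕ) (L : Set Chord) : Prop :=
  ∃ r : Setoid Circle, IsLaminational r ∧ IsInvariantRel d r ∧ L = leavesOf r

/-! ### Critical sets in degree two -/

/-- Critical gaps: every point of `σ_d(G')` has at least two preimages in `G'`.  For `d = 2` this
says that `σ_2` is exactly two-to-one on the basis of `G`, i.e. has degree two on `G`. -/
def IsCriticalGap (d : ℕ) (L : Set Chord) (G : Set ℂ) : Prop :=
  IsGap L G ∧ ∀ y ∈ sigma d '' basis G, 2 ≤ (sigma d ⁻¹' {y} ∩ basis G).encard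

/-- `C` is a critical set of the geodesic lamination `L` (for `σ_2`): a critical leaf or a gap on
which `σ_2` has degree two. -/
def IsCriticalSet (L : Set Chord) (C : Set ℂ) : Prop :=
  (∃ l ∈ L, IsCriticalChord 2 l ∧ C = Chord.seg l) ∨ IsCriticalGap 2 L C

/-- Collapsing quadrilaterals: 4-gons inscribed in the circle whose `σ_2`-image is a chord. -/
def IsCollapsingQuadrilateral (Q : Set ℂ) : Prop :=
  (∃ A : Set Circle, A.ncard = 4 ∧ Q = hull A) ∧ ∃ l : Chord, sigmaSet 2 Q = Chord.seg l

/-- Generalized critical quadrilaterals. -/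
def IsGeneralizedCriticalQuadrilateral (Q : Set ℂ) : Prop :=
  IsCollapsingQuadrilateral Q ∨ ∃ l : Chord, IsCriticalChord 2 l ∧ Q = Chord.seg l

end GeoLam

end

noncomputable section

namespace GeoLam

open Real Filter Topology

/-! ### Arcs of the circle, measured in turns -/

/-! Existence. In terms of points of the circle, a leaf of `leavesOf r` is a pair of equivalent
points that no chord of their class crosses (`mem_leavesOf_iff`). On each class `σ_2` is the
restriction of a monotone covering for which the class is a full preimage. Hence holes of classes
map to holes or to whole turns, and holes lift to holes, so leaves have images and preimages that
are leaves. The antipodal map permutes the classes, which provides the siblings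
(`isSiblingInvariant_leavesOf`).

Uniqueness. The set `Q` is the hull of a finite set `g = -g`, and `g` is a class of `r`
(`mem_classes_of_edges`). A lamination with critical set `Q` is remembered only as a relation on
pairs of points, `IsPulledBack g`; it is enough that one such relation always contains another
(`IsPulledBack.mono`). The complementary arcs of `g` have length at most `1/2`, so `σ_2` preserves
order on each of them and leaves over them pull back in one way only. Therefore the edges of all
classes eventually mapped to `g` are forced to be leaves (`IsPulledBack.of_adjacent`), and no leaf
crosses such a precritical class (`IsPulledBack.unseparated`).

Any other leaf joins two points of a cell, a maximal set that no precritical class separates. If one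
side of the leaf contains no further point of the cell, the leaf is a limit of precritical edges,
hence forced by closedness (`IsPulledBack.of_innerCell_eq_empty`). Diagonals of cells have to be
excluded. Given a diagonal, cell points on both sides can be chosen so that the crossing survives
all iterates (`Regular.exists_isDiagonal`). Such a cell does not wander: this is Thurston's strip
argument on the shortest sides of a triangle (`IsDiagonal.exists_cell_eq`). If the diagonal is a
leaf, it is long infinitely often, so it returns nested in itself, and expansion makes the return
map fix the whole cell (`IsDiagonal.exists_periodic`). The cell is then a periodic class of `r` on
which `σ_2` acts transitively (`IsCriticalClass.exists_iterate_eq`); some iterate rotates it by one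
step, and the diagonal crosses its own image (`IsDiagonal.not_leaf`). -/

/-- The point of the circle at angle `2πt`. -/
def turn (t : ℝ) : Circle := Circle.exp (2 * π * t)

lemma turn_add (s t : ℝ) : turn (s + t) = turn s * turn t := by
  simp [turn, mul_add, Circle.exp_add]

lemma turn_zero : turn 0 = 1 := by simp [turn]

lemma turn_eq_turn {s t : ℝ} : turn s = turn t ↔ ∃ n : ℤ, s = t + n := by
  have : 2 * π ≠ 0 := by positivity
  rw [turn, turn, Circle.exp_eq_exp]
  refine exists_congr fun n => ⟨fun h => ?_, fun h => by rw [h]; ring⟩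
  apply mul_left_cancel₀ this
  rw [h]; ring

lemma continuous_turn : Continuous turn :=
  Circle.exp.continuous.comp (continuous_const.mul continuous_id)

lemma turn_one : turn 1 = 1 := by
  rw [← turn_zero, turn_eq_turn]; exact ⟨1, by simp⟩

lemma turn_half : turn (1 / 2) = -1 := by
  ext
  simp only [turn, Circle.coe_exp, Circle.coe_neg, Circle.coe_one]
  rw [show ((2 * π * (1 / 2) : ℝ) : ℂ) = π by push_cast; ring, Complex.exp_pi_mul_I]

lemma turn_surjective : Function.Surjective turn := by
  intro z
  refine ⟨(z : ℂ).arg / (2 * π), ?_⟩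
  rw [turn, mul_div_cancel₀ _ (by positivity), Circle.exp_arg]

/-- The length, in turns, of the counterclockwise arc from `p` to `z`. -/
def arc (p z : Circle) : ℝ := Int.fract (((z / p : Circle) : ℂ).arg / (2 * π))

lemma arc_nonneg (p z : Circle) : 0 ≤ arc p z := Int.fract_nonneg _

lemma arc_lt_one (p z : Circle) : arc p z < 1 := Int.fract_lt_one _

lemma mul_turn_arc (p z : Circle) : p * turn (arc p z) = z := by
  have h : turn (arc p z) = z / p := by
    conv_rhs => rw [← Circle.exp_arg (z / p)]
    have : Circle.exp (((z / p : Circle) : ℂ).arg)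
        = turn (((z / p : Circle) : ℂ).arg / (2 * π)) := by
      rw [turn, mul_div_cancel₀ _ (by positivity)]
    rw [this, turn_eq_turn]
    refine ⟨-⌊((z / p : Circle) : ℂ).arg / (2 * π)⌋, ?_⟩
    rw [arc, Int.fract]; push_cast; ring
  rw [h, mul_div_cancel]

/-- Two representatives in `[0, 1)` of the same turn differ by an integer, hence agree. The formulas
for arcs below are obtained through this uniqueness. -/
lemma arc_eq_of_mul_turn {p z : Circle} {t : ℝ} (h0 : 0 ≤ t) (h1 : t < 1) (h : p * turn t = z) :
    arc p z = t := by
  have h2 := mul_turn_arc p z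
  rw [← h] at h2
  obtain ⟨n, hn⟩ := turn_eq_turn.1 (mul_left_cancel h2)
  rw [h] at hn
  have h3 := arc_nonneg p z
  have h4 := arc_lt_one p z
  have h5 : (n : ℝ) < 1 := by linarith
  have h6 : (-1 : ℝ) < n := by linarith
  have : n = 0 := by
    have : n < 1 := by exact_mod_cast h5
    have : -1 < n := by exact_mod_cast h6
    omega
  simpa [this] using hn

lemma arc_self (p : Circle) : arc p p = 0 :=
  arc_eq_of_mul_turn le_rfl one_pos (by simp [turn_zero])

lemma arc_inj {p z w : Circle} : arc p z = arc p w ↔ z = w :=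
  ⟨fun h => by rw [← mul_turn_arc p z, h, mul_turn_arc], fun h => by rw [h]⟩

lemma arc_eq_zero {p z : Circle} : arc p z = 0 ↔ z = p := by
  rw [← arc_self p, arc_inj]

lemma arc_pos {p z : Circle} : 0 < arc p z ↔ z ≠ p := by
  rw [(arc_nonneg p z).lt_iff_ne, ne_comm, Ne, arc_eq_zero]

/-- Change of base point: lengths measured from `p` are subtracted, with a full turn added (next
lemma) when `w` comes before `z`. -/
lemma arc_base_of_le {p z w : Circle} (h : arc p z ≤ arc p w) :
    arc z w = arc p w - arc p z := by
  have := arc_lt_one p w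
  have := arc_nonneg p z
  refine arc_eq_of_mul_turn (by linarith) (by linarith) ?_
  calc z * turn (arc p w - arc p z) = p * turn (arc p z) * turn (arc p w - arc p z) := by
        rw [mul_turn_arc]
    _ = w := by rw [mul_assoc, ← turn_add, add_sub_cancel, mul_turn_arc]

lemma arc_base_of_lt {p z w : Circle} (h : arc p w < arc p z) :
    arc z w = arc p w - arc p z + 1 := by
  have := arc_lt_one p z
  have := arc_nonneg p w
  refine arc_eq_of_mul_turn (by linarith) (by linarith) ?_
  calc z * turn (arc p w - arc p z + 1) = p * turn (arc p z) * turn (arc p w - arc p z + 1) := by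
        rw [mul_turn_arc]
    _ = w := by
      rw [mul_assoc, ← turn_add, ← add_assoc, add_sub_cancel, turn_add, turn_one, mul_one,
        mul_turn_arc]

lemma arc_swap {z w : Circle} (h : z ≠ w) : arc w z = 1 - arc z w := by
  have h1 : arc z z < arc z w := by rw [arc_self]; exact arc_pos.2 h.symm
  rw [arc_base_of_lt h1, arc_self]; ring

lemma sigma_mul_turn (p : Circle) (t : ℝ) :
    sigma 2 (p * turn t) = sigma 2 p * turn (2 * t) := by
  simp only [sigma, mul_pow, two_mul, turn_add]
  rw [sq (turn t)]

lemma sigma_mul_turn_arc (p z : Circle) : sigma 2 p * turn (2 * arc p z) = sigma 2 z := by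
  rw [← sigma_mul_turn, mul_turn_arc]

lemma arc_sigma_of_lt {p z : Circle} (h : arc p z < 1 / 2) :
    arc (sigma 2 p) (sigma 2 z) = 2 * arc p z :=
  arc_eq_of_mul_turn (by linarith [arc_nonneg p z]) (by linarith) (sigma_mul_turn_arc p z)

lemma arc_sigma_of_le {p z : Circle} (h : 1 / 2 ≤ arc p z) :
    arc (sigma 2 p) (sigma 2 z) = 2 * arc p z - 1 := by
  refine arc_eq_of_mul_turn (by linarith) (by linarith [arc_lt_one p z]) ?_
  have : turn (2 * arc p z) = turn (2 * arc p z - 1) := turn_eq_turn.2 ⟨1, by push_cast; ring⟩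
  rw [← this, sigma_mul_turn_arc]

lemma arc_neg_of_lt {p z : Circle} (h : arc p z < 1 / 2) : arc p (-z) = arc p z + 1 / 2 := by
  refine arc_eq_of_mul_turn (by linarith [arc_nonneg p z]) (by linarith) ?_
  rw [turn_add, turn_half, ← mul_assoc, mul_turn_arc]; simp

lemma arc_neg_self (p : Circle) : arc p (-p) = 1 / 2 := by
  rw [arc_neg_of_lt (by rw [arc_self]; norm_num), arc_self]; ring

lemma arc_neg_neg (p z : Circle) : arc (-p) (-z) = arc p z := by
  refine arc_eq_of_mul_turn (arc_nonneg p z) (arc_lt_one p z) ?_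
  rw [neg_mul, mul_turn_arc]

lemma sigma_neg (z : Circle) : sigma 2 (-z) = sigma 2 z := by simp [sigma]

lemma sigma_eq_sigma {z w : Circle} : sigma 2 z = sigma 2 w ↔ w = z ∨ w = -z := by
  constructor
  · intro h
    have h' : (z : ℂ) ^ 2 = (w : ℂ) ^ 2 := by exact_mod_cast congrArg (Subtype.val) h
    rcases sq_eq_sq_iff_eq_or_eq_neg.1 h' with h | h
    · left; ext; exact h.symm
    · right; ext; simp [h]
  · rintro (rfl | rfl)
    · rfl
    · rw [sigma_neg]

lemma neg_ne (z : Circle) : -z ≠ z := Circle.neg_ne_self z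

lemma sigma_surjective : Function.Surjective (sigma 2) := by
  intro z
  obtain ⟨t, rfl⟩ := turn_surjective z
  refine ⟨turn (t / 2), ?_⟩
  rw [sigma, sq, ← turn_add]; congr 1; ring

/-! ### Crossing chords -/

/-- The orientation determinant of three points of the plane. -/
def orient (a b c : ℂ) : ℝ := (b - a).re * (c - a).im - (b - a).im * (c - a).re

/-- The chords `ab` and `cd` cross inside the disk. -/
def Cross (a b c d : Circle) : Prop := orient a b c * orient a b d < 0

/-- The pairs `α, β` and `γ, δ` of reals alternate. -/
def Alternate (α β γ δ : ℝ) : Prop := (γ - α) * (γ - β) * ((δ - α) * (δ - β)) < 0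

/-- The determinant is twice the signed area of an inscribed triangle, a product of sines of half
central angles. Crossing becomes a matter of signs of sines. -/
lemma orient_turn (x : Circle) (α β γ : ℝ) :
    orient (x * turn α : Circle) (x * turn β : Circle) (x * turn γ : Circle)
      = 4 * (sin (π * (β - α)) * sin (π * (γ - β)) * sin (π * (γ - α))) := by
  obtain ⟨ξ, rfl⟩ := turn_surjective x
  have key : ∀ u v : ℝ, sin (2 * u) + sin (2 * v) - sin (2 * (u + v))
      = 4 * (sin u * sin v * sin (u + v)) := by
    intro u v
    rw [sin_two_mul, sin_two_mul, sin_two_mul, sin_add, cos_add]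
    have h1 := sin_sq_add_cos_sq u
    have h2 := sin_sq_add_cos_sq v
    linear_combination (-2 * sin v * cos v) * h1 + (-2 * sin u * cos u) * h2
  have h := key (π * (β - α)) (π * (γ - β))
  rw [show π * (β - α) + π * (γ - β) = π * (γ - α) by ring] at h
  rw [← h]
  rw [← turn_add, ← turn_add, ← turn_add]
  simp only [turn, Circle.coe_exp, orient, Complex.sub_re, Complex.sub_im,
    Complex.exp_ofReal_mul_I_re, Complex.exp_ofReal_mul_I_im]
  rw [show 2 * (π * (β - α)) = 2 * π * (ξ + β) - 2 * π * (ξ + α) by ring,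
    show 2 * (π * (γ - β)) = 2 * π * (ξ + γ) - 2 * π * (ξ + β) by ring,
    show 2 * (π * (γ - α)) = 2 * π * (ξ + γ) - 2 * π * (ξ + α) by ring, sin_sub, sin_sub, sin_sub]
  ring

lemma cross_turn (x : Circle) (α β γ δ : ℝ) :
    Cross (x * turn α) (x * turn β) (x * turn γ) (x * turn δ) ↔
      sin (π * (γ - α)) * sin (π * (γ - β)) * (sin (π * (δ - α)) * sin (π * (δ - β))) < 0 := by
  rw [Cross, orient_turn, orient_turn]
  have : 4 * (sin (π * (β - α)) * sin (π * (γ - β)) * sin (π * (γ - α))) *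
      (4 * (sin (π * (β - α)) * sin (π * (δ - β)) * sin (π * (δ - α)))) =
      (16 * sin (π * (β - α)) ^ 2) * (sin (π * (γ - α)) * sin (π * (γ - β)) *
        (sin (π * (δ - α)) * sin (π * (δ - β)))) := by ring
  rw [this]
  -- If the sine vanishes, the two endpoints coincide up to whole turns; the right-hand product is
  -- then a square, so both sides of the equivalence fail. Otherwise its square is a positive common
  -- factor.
  by_cases h : sin (π * (β - α)) = 0
  · rw [h]
    have e : ∀ ε : ℝ, sin (π * (ε - α)) = sin (π * (ε - β)) * cos (π * (β - α)) := by
      intro ε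
      rw [show π * (ε - α) = π * (ε - β) + π * (β - α) by ring, sin_add, h]; ring
    rw [e γ, e δ]
    refine ⟨fun h => by simp at h, fun h' => ?_⟩
    nlinarith [mul_self_nonneg (sin (π * (γ - β)) * sin (π * (δ - β)) * cos (π * (β - α)))]
  · have : 0 < 16 * sin (π * (β - α)) ^ 2 := by positivity
    exact ⟨fun h' => by by_contra! hc; nlinarith [mul_nonneg this.le hc],
      fun hlt => mul_neg_of_pos_of_neg this hlt⟩

/-- A positive ratio between `sin (π t)` and `t` on the open interval `(-1, 1)`. -/
lemma exists_sin_pi_mul {t : ℝ} (h : |t| < 1) : ∃ r > 0, sin (π * t) = r * t := by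
  rcases lt_trichotomy t 0 with h0 | rfl | h0
  · rw [abs_of_neg h0] at h
    have := sin_pos_of_pos_of_lt_pi (x := π * (-t)) (by nlinarith [pi_pos]) (by nlinarith [pi_pos])
    rw [mul_neg, sin_neg] at this
    exact ⟨sin (π * t) / t, div_pos_of_neg_of_neg (by linarith) h0, (div_mul_cancel₀ _ h0.ne).symm⟩
  · exact ⟨1, one_pos, by simp⟩
  · rw [abs_of_pos h0] at h
    have := sin_pos_of_pos_of_lt_pi (x := π * t) (by nlinarith [pi_pos]) (by nlinarith [pi_pos])
    exact ⟨sin (π * t) / t, div_pos this h0, (div_mul_cancel₀ _ h0.ne').symm⟩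

lemma exists_sin_pi_mul_of_le {t : ℝ} (h : |t| ≤ 1) : ∃ r ≥ 0, sin (π * t) = r * t := by
  rcases h.lt_or_eq with h | h
  · obtain ⟨r, hr, h⟩ := exists_sin_pi_mul h
    exact ⟨r, hr.le, h⟩
  · refine ⟨0, le_rfl, ?_⟩
    rcases eq_or_eq_neg_of_abs_eq h with rfl | rfl <;> simp

/-- Since `sin (π t)` has the sign of `t` for `|t| < 1`, crossing can be read off from any lifts
this close to each other, not only from lifts in `[0, 1)`. This freedom is needed after doubling. -/
lemma cross_lift_iff (x : Circle) {α β γ δ : ℝ} (h1 : |γ - α| < 1) (h2 : |γ - β| < 1)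
    (h3 : |δ - α| < 1) (h4 : |δ - β| < 1) :
    Cross (x * turn α) (x * turn β) (x * turn γ) (x * turn δ) ↔ Alternate α β γ δ := by
  rw [cross_turn, Alternate]
  obtain ⟨r1, p1, e1⟩ := exists_sin_pi_mul h1
  obtain ⟨r2, p2, e2⟩ := exists_sin_pi_mul h2
  obtain ⟨r3, p3, e3⟩ := exists_sin_pi_mul h3
  obtain ⟨r4, p4, e4⟩ := exists_sin_pi_mul h4
  rw [e1, e2, e3, e4]
  have hp : 0 < r1 * r2 * (r3 * r4) := by positivity
  rw [show r1 * (γ - α) * (r2 * (γ - β)) * (r3 * (δ - α) * (r4 * (δ - β)))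
    = (r1 * r2 * (r3 * r4)) * ((γ - α) * (γ - β) * ((δ - α) * (δ - β))) by ring]
  exact ⟨fun h' => by by_contra! hc; nlinarith [mul_nonneg hp.le hc],
      fun h' => mul_neg_of_pos_of_neg hp h'⟩

/-- At distance exactly `1` the sine vanishes, so only this implication survives with weak bounds.
-/
lemma alternate_of_cross_lift (x : Circle) {α β γ δ : ℝ} (h1 : |γ - α| ≤ 1) (h2 : |γ - β| ≤ 1)
    (h3 : |δ - α| ≤ 1) (h4 : |δ - β| ≤ 1)
    (h : Cross (x * turn α) (x * turn β) (x * turn γ) (x * turn δ)) : Alternate α β γ δ := by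
  rw [cross_turn] at h
  rw [Alternate]
  obtain ⟨r1, p1, e1⟩ := exists_sin_pi_mul_of_le h1
  obtain ⟨r2, p2, e2⟩ := exists_sin_pi_mul_of_le h2
  obtain ⟨r3, p3, e3⟩ := exists_sin_pi_mul_of_le h3
  obtain ⟨r4, p4, e4⟩ := exists_sin_pi_mul_of_le h4
  rw [e1, e2, e3, e4, show r1 * (γ - α) * (r2 * (γ - β)) * (r3 * (δ - α) * (r4 * (δ - β)))
    = (r1 * r2 * (r3 * r4)) * ((γ - α) * (γ - β) * ((δ - α) * (δ - β))) by ring] at h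
  have hp : 0 ≤ r1 * r2 * (r3 * r4) := by positivity
  by_contra! hc
  nlinarith [mul_nonneg hp hc]

lemma cross_iff (p a b c d : Circle) :
    Cross a b c d ↔ Alternate (arc p a) (arc p b) (arc p c) (arc p d) := by
  have e : ∀ u v, |arc p u - arc p v| < 1 := fun u v => by
    rw [abs_lt]
    constructor <;> linarith [arc_nonneg p u, arc_nonneg p v, arc_lt_one p u, arc_lt_one p v]
  have := cross_lift_iff p (e c a) (e c b) (e d a) (e d b)
  simpa only [mul_turn_arc] using this

lemma alternate_iff {α β γ δ : ℝ} : Alternate α β γ δ ↔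
    (α < γ ∧ γ < β ∧ β < δ) ∨ (δ < α ∧ α < γ ∧ γ < β) ∨
    (β < γ ∧ γ < α ∧ α < δ) ∨ (δ < β ∧ β < γ ∧ γ < α) ∨
    (α < δ ∧ δ < β ∧ β < γ) ∨ (γ < α ∧ α < δ ∧ δ < β) ∨
    (β < δ ∧ δ < α ∧ α < γ) ∨ (γ < β ∧ β < δ ∧ δ < α) := by
  rw [Alternate, mul_neg_iff, mul_neg_iff, mul_neg_iff, mul_pos_iff, mul_pos_iff]
  simp only [sub_pos, sub_neg]
  grind

lemma Alternate.symm {α β γ δ : ℝ} (h : Alternate α β γ δ) : Alternate γ δ α β := by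
  rw [Alternate] at *; linarith

lemma Alternate.swap_left {α β γ δ : ℝ} (h : Alternate α β γ δ) : Alternate β α γ δ := by
  rw [Alternate] at *; linarith

lemma Alternate.swap_right {α β γ δ : ℝ} (h : Alternate α β γ δ) : Alternate α β δ γ := by
  rw [Alternate] at *; linarith

lemma Cross.symm {a b c d : Circle} (h : Cross a b c d) : Cross c d a b := by
  rw [cross_iff 1] at *; exact h.symm

lemma Cross.swap_left {a b c d : Circle} (h : Cross a b c d) : Cross b a c d := by
  rw [cross_iff 1] at *; exact h.swap_left

lemma Cross.swap_right {a b c d : Circle} (h : Cross a b c d) : Cross a b d c := by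
  rw [cross_iff 1] at *; exact h.swap_right

lemma Cross.neg {a b c d : Circle} (h : Cross a b c d) : Cross (-a) (-b) (-c) (-d) := by
  rw [cross_iff (-1)]; simp only [arc_neg_neg]; rwa [← cross_iff]

lemma not_cross_self (a c d : Circle) : ¬ Cross a a c d := by simp [Cross, orient]

lemma not_cross_left (a b d : Circle) : ¬ Cross a b a d := by simp [Cross, orient]

/-- A chord with an endpoint inside the arc from `p` to `q` that does not cross the chord `pq`
has both endpoints in the closed arc. -/
lemma arc_le_of_not_cross {p q z w : Circle} (h0 : 0 < arc p z) (h1 : arc p z < arc p q)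
    (h : ¬ Cross p q z w) : arc p w ≤ arc p q := by
  by_contra! hc
  apply h
  rw [cross_iff p, alternate_iff, arc_self]
  exact Or.inl ⟨h0, h1, hc⟩

lemma continuous_orient_coe : Continuous fun x : (Circle × Circle) × Circle =>
    orient x.1.1 x.1.2 x.2 := by
  unfold orient
  fun_prop

lemma isOpen_cross (c d : Circle) : IsOpen {x : Circle × Circle | Cross x.1 x.2 c d} := by
  unfold Cross
  refine isOpen_lt ?_ continuous_const
  have h1 : Continuous fun x : Circle × Circle => orient x.1 x.2 c :=
    continuous_orient_coe.comp (continuous_id.prodMk continuous_const)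
  have h2 : Continuous fun x : Circle × Circle => orient x.1 x.2 d :=
    continuous_orient_coe.comp (continuous_id.prodMk continuous_const)
  exact h1.mul h2

/-! ### Chords as segments -/

lemma seg_mk (a b : Circle) : Chord.seg s(a, b) = segment ℝ (a : ℂ) b := by
  have : (fun x : Circle => (x : ℂ)) '' {x | x ∈ s(a, b)} = {(a : ℂ), (b : ℂ)} := by
    ext z; simp [Sym2.mem_iff, eq_comm, or_and_right, exists_or]
  rw [Chord.seg, hull, this, convexHull_pair]

lemma norm_coe_le (x : Circle) : ‖(x : ℂ)‖ ≤ 1 := (Circle.norm_coe x).le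

lemma hull_subset_closedBall (A : Set Circle) : hull A ⊆ Metric.closedBall 0 1 := by
  refine convexHull_min ?_ (convex_closedBall _ _)
  rintro _ ⟨x, -, rfl⟩
  simpa using norm_coe_le x

lemma coe_mem_hull {A : Set Circle} {x : Circle} (h : x ∈ A) : (x : ℂ) ∈ hull A :=
  subset_convexHull _ _ ⟨x, h, rfl⟩

lemma convex_hull (A : Set Circle) : Convex ℝ (hull A) := convex_convexHull _ _

lemma segment_subset_hull {A : Set Circle} {a b : Circle} (ha : a ∈ A) (hb : b ∈ A) :
    segment ℝ (a : ℂ) b ⊆ hull A :=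
  (convex_hull A).segment_subset (coe_mem_hull ha) (coe_mem_hull hb)

lemma norm_lt_one_of_mem_openSegment {x y z : ℂ} (hx : ‖x‖ ≤ 1) (hy : ‖y‖ ≤ 1) (hxy : x ≠ y)
    (hz : z ∈ openSegment ℝ x y) : ‖z‖ < 1 := by
  have := (strictConvex_closedBall ℝ (0 : ℂ) 1).openSegment_subset
    (by simpa using hx) (by simpa using hy) hxy hz
  rw [interior_closedBall _ one_ne_zero] at this
  simpa using this

/-- The disk is strictly convex, so points of the circle are extreme points of any hull that
contains them, and extreme points of a hull belong to the generating set. -/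
lemma coe_mem_hull_iff {A : Set Circle} {x : Circle} : (x : ℂ) ∈ hull A ↔ x ∈ A := by
  refine ⟨fun h => ?_, coe_mem_hull⟩
  have hext : (x : ℂ) ∈ (hull A).extremePoints ℝ := by
    refine ⟨h, fun y hy z hz hm => ?_⟩
    by_contra hc
    have hy' := hull_subset_closedBall A hy
    have hz' := hull_subset_closedBall A hz
    by_cases hyz : y = z
    · subst hyz
      rw [openSegment_same] at hm
      exact hc hm.symm
    · have := norm_lt_one_of_mem_openSegment (by simpa using hy') (by simpa using hz') hyz hm
      exact absurd (Circle.norm_coe x) this.ne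
  obtain ⟨y, hy, hyx⟩ := extremePoints_convexHull_subset hext
  rwa [← Circle.coe_injective hyx]

lemma basis_hull (A : Set Circle) : basis (hull A) = A := by
  ext x; exact coe_mem_hull_iff

lemma coe_mem_segment {a b x : Circle} (h : (x : ℂ) ∈ segment ℝ (a : ℂ) b) : x = a ∨ x = b := by
  rw [← seg_mk, Chord.seg, coe_mem_hull_iff] at h
  simpa using h

lemma orient_convexComb (a b x y : ℂ) {s t : ℝ} (h : s + t = 1) :
    orient a b (s • x + t • y) = s * orient a b x + t * orient a b y := by
  have ht : t = 1 - s := by linarith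
  subst ht
  simp only [orient, Complex.sub_re, Complex.sub_im, Complex.add_re, Complex.add_im,
    Complex.smul_re, Complex.smul_im, smul_eq_mul]
  ring

lemma orient_left (a b : ℂ) : orient a b a = 0 := by simp [orient]

lemma orient_right (a b : ℂ) : orient a b b = 0 := by simp [orient]; ring

lemma orient_eq_zero_of_mem_segment {a b z : ℂ} (h : z ∈ segment ℝ a b) : orient a b z = 0 := by
  obtain ⟨s, t, -, -, hst, rfl⟩ := h
  rw [orient_convexComb _ _ _ _ hst, orient_left, orient_right]; ring

/-- The line through two points of the circle meets the closed disk in the chord. -/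
lemma mem_segment_of_orient_eq_zero {a b : Circle} (hab : a ≠ b) {z : ℂ} (hz : ‖z‖ ≤ 1)
    (h : orient a b z = 0) : z ∈ segment ℝ (a : ℂ) b := by
  set u : ℂ := b - a with hu
  have hu0 : u ≠ 0 := sub_ne_zero.2 fun h => hab (Circle.coe_injective h.symm)
  have hN : 0 < Complex.normSq u := Complex.normSq_pos.2 hu0
  set τ : ℝ := (u.re * (z - a).re + u.im * (z - a).im) / Complex.normSq u with hτ
  have hz' : z = a + τ • u := by
    have h1 : u.re * (z - a).im - u.im * (z - a).re = 0 := h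
    have h2 : τ * Complex.normSq u = u.re * (z - a).re + u.im * (z - a).im :=
      div_mul_cancel₀ _ hN.ne'
    rw [Complex.normSq_apply] at h2 hN
    have h3 : (z - a).re = τ * u.re := by
      apply mul_left_cancel₀ hN.ne'
      linear_combination (-u.re) * h2 - u.im * h1
    have h4 : (z - a).im = τ * u.im := by
      apply mul_left_cancel₀ hN.ne'
      linear_combination (-u.im) * h2 + u.re * h1
    rw [Complex.sub_re] at h3
    rw [Complex.sub_im] at h4
    apply Complex.ext
    · simp; linarith
    · simp; linarith
  have hn : Complex.normSq z ≤ 1 := by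
    rw [Complex.normSq_eq_norm_sq]; nlinarith [norm_nonneg z]
  have ha : (a : ℂ).re * (a : ℂ).re + (a : ℂ).im * (a : ℂ).im = 1 := by
    rw [← Complex.normSq_apply]; simp
  have hb : (b : ℂ).re * (b : ℂ).re + (b : ℂ).im * (b : ℂ).im = 1 := by
    rw [← Complex.normSq_apply]; simp
  -- Along the line through `a` and `b` the squared norm is `1 - τ (1 - τ) |b - a|²`, so lying in
  -- the disk forces `0 ≤ τ ≤ 1`.
  have key : Complex.normSq z = 1 - τ * (1 - τ) * Complex.normSq u := by
    rw [hz', hu]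
    simp only [Complex.normSq_apply, Complex.add_re, Complex.add_im, Complex.smul_re,
      Complex.smul_im, Complex.sub_re, Complex.sub_im, smul_eq_mul]
    linear_combination (1 - τ) * ha + τ * hb
  have hττ : 0 ≤ τ * (1 - τ) := by
    by_contra! hc
    nlinarith [mul_pos_of_neg_of_neg hc (neg_neg_of_pos hN)]
  have h0 : 0 ≤ τ := by nlinarith
  have h1 : τ ≤ 1 := by nlinarith
  refine ⟨1 - τ, τ, by linarith, h0, by ring, ?_⟩
  rw [hz', hu]
  simp only [Complex.real_smul]; push_cast; ring

lemma orient_ne_zero {a b c : Circle} (hab : a ≠ b) (hca : c ≠ a) (hcb : c ≠ b) :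
    orient a b c ≠ 0 := fun h => by
  have := mem_segment_of_orient_eq_zero hab (z := c) (norm_coe_le c) h
  rcases coe_mem_segment this with h | h <;> contradiction

/-- Crossing chords meet in a point of the open disk. -/
lemma Cross.exists_mem_openSegment {a b c d : Circle} (h : Cross a b c d) :
    ∃ z : ℂ, z ∈ openSegment ℝ (a : ℂ) b ∧ z ∈ openSegment ℝ (c : ℂ) d := by
  have hcd : c ≠ d := by rintro rfl; exact not_cross_self _ _ _ h.symm
  have hab : a ≠ b := by rintro rfl; exact not_cross_self _ _ _ h
  have hlt : orient a b c * orient a b d < 0 := h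
  obtain ⟨s, t, hs, ht, hst, h0⟩ : ∃ s t : ℝ, 0 < s ∧ 0 < t ∧ s + t = 1 ∧
      s * orient a b c + t * orient a b d = 0 := by
    rcases mul_neg_iff.1 hlt with ⟨h1, h2⟩ | ⟨h1, h2⟩
    · have h3 : 0 < orient a b c - orient a b d := by linarith
      exact ⟨-orient a b d / (orient a b c - orient a b d),
        orient a b c / (orient a b c - orient a b d), div_pos (by linarith) h3,
        div_pos h1 h3, by field_simp; ring, by field_simp; ring⟩
    · have h3 : 0 < orient a b d - orient a b c := by linarith
      exact ⟨orient a b d / (orient a b d - orient a b c),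
        -orient a b c / (orient a b d - orient a b c), div_pos h2 h3,
        div_pos (by linarith) h3, by field_simp; ring, by field_simp; ring⟩
  have hz : s • (c : ℂ) + t • (d : ℂ) ∈ openSegment ℝ (c : ℂ) d := ⟨s, t, hs, ht, hst, rfl⟩
  refine ⟨s • (c : ℂ) + t • (d : ℂ), ?_, hz⟩
  have hn := norm_lt_one_of_mem_openSegment (norm_coe_le _) (norm_coe_le _)
    (fun h => hcd (Circle.coe_injective h)) hz
  have hseg := mem_segment_of_orient_eq_zero hab hn.le
    ((orient_convexComb _ _ _ _ hst).trans h0)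
  refine mem_openSegment_of_ne_left_right ?_ ?_ hseg
  · intro h; rw [← h] at hn; exact absurd (Circle.norm_coe _) hn.ne
  · intro h; rw [← h] at hn; exact absurd (Circle.norm_coe _) hn.ne

lemma Cross.not_unlinked {a b c d : Circle} (h : Cross a b c d) : ¬ Unlinked s(a, b) s(c, d) := by
  intro hu
  obtain ⟨z, h1, h2⟩ := h.exists_mem_openSegment
  have hab : a ≠ b := by rintro rfl; exact not_cross_self _ _ _ h
  have hn := norm_lt_one_of_mem_openSegment (norm_coe_le _) (norm_coe_le _)
    (fun h => hab (Circle.coe_injective h)) h1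
  obtain ⟨x, rfl, -⟩ := hu z ⟨by rw [seg_mk]; exact openSegment_subset_segment _ _ _ h1,
    by rw [seg_mk]; exact openSegment_subset_segment _ _ _ h2⟩
  exact absurd (Circle.norm_coe _) hn.ne

lemma Cross.not_disjoint_hull {a b c d : Circle} (h : Cross a b c d) {A B : Set Circle}
    (ha : a ∈ A) (hb : b ∈ A) (hc : c ∈ B) (hd : d ∈ B) : ¬ Disjoint (hull A) (hull B) := by
  obtain ⟨z, h1, h2⟩ := h.exists_mem_openSegment
  exact Set.not_disjoint_iff.2 ⟨z, segment_subset_hull ha hb (openSegment_subset_segment _ _ _ h1),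
    segment_subset_hull hc hd (openSegment_subset_segment _ _ _ h2)⟩

/-- The determinant of `a`, `b` is affine along `cd` and has weakly equal signs at `c` and `d`. It
can vanish on the segment only at an endpoint that is also `a` or `b`, unless the chords coincide.
-/
lemma unlinked_of_not_cross {a b c d : Circle} (hne : s(a, b) ≠ s(c, d)) (h : ¬ Cross a b c d) :
    Unlinked s(a, b) s(c, d) := by
  rintro z ⟨h1, h2⟩
  rw [seg_mk] at h1 h2
  by_cases hab : a = b
  · subst hab
    rw [segment_same] at h1
    obtain rfl := h1
    exact ⟨a, rfl, by simp, by simpa using coe_mem_segment h2⟩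
  by_cases hcd : c = d
  · subst hcd
    rw [segment_same] at h2
    obtain rfl := h2
    exact ⟨c, rfl, by simpa using coe_mem_segment h1, by simp⟩
  have h0 := orient_eq_zero_of_mem_segment h1
  obtain ⟨s, t, hs, ht, hst, rfl⟩ := h2
  rw [orient_convexComb _ _ _ _ hst] at h0
  have hge : 0 ≤ orient a b c * orient a b d := not_lt.1 h
  by_cases hc : c = a ∨ c = b
  · have hd : d ≠ a ∧ d ≠ b := by
      constructor <;> rintro rfl <;> rcases hc with rfl | rfl <;> simp_all [Sym2.eq_swap]
    have hd' := orient_ne_zero hab hd.1 hd.2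
    have hc' : orient a b c = 0 := by
      rcases hc with rfl | rfl
      · exact orient_left _ _
      · exact orient_right _ _
    rw [hc', mul_zero, zero_add] at h0
    have ht0 : t = 0 := by simpa [hd'] using h0
    have hs1 : s = 1 := by linarith
    refine ⟨c, by simp [ht0, hs1], by simpa using hc, by simp⟩
  · push Not at hc
    have hc' := orient_ne_zero hab hc.1 hc.2
    have hs0 : s = 0 := by
      by_contra hs0
      have : 0 < s := lt_of_le_of_ne hs (Ne.symm hs0)
      have h3 : s * orient a b c * orient a b c + t * (orient a b c * orient a b d) = 0 := by
        linear_combination orient a b c * h0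
      have h4 : 0 < s * orient a b c * orient a b c := by
        rw [mul_assoc]; exact mul_pos this (mul_self_pos.2 hc')
      nlinarith [mul_nonneg ht hge]
    have ht1 : t = 1 := by linarith
    have hd0 : orient a b d = 0 := by simpa [hs0, ht1] using h0
    have hd : d = a ∨ d = b := by
      by_contra! hd
      exact orient_ne_zero hab hd.1 hd.2 hd0
    exact ⟨d, by simp [hs0, ht1], by simpa using hd, by simp⟩

/-- The crossing point of two chords of a set is interior to its hull. -/
lemma Cross.mem_interior_hull {a b c d : Circle} (h : Cross a b c d) {A : Set Circle}
    (ha : a ∈ A) (hb : b ∈ A) (hc : c ∈ A) (hd : d ∈ A) {z : ℂ}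
    (h1 : z ∈ openSegment ℝ (a : ℂ) b) (h2 : z ∈ openSegment ℝ (c : ℂ) d) :
    z ∈ interior (hull A) := by
  obtain ⟨α, τ, hα, hτ, hατ, hz1⟩ := h1
  obtain ⟨γ, κ, hγ, hκ, hγκ, hz2⟩ := h2
  set u : ℂ := b - a with hu
  set v : ℂ := d - c with hv
  have hdet : u.re * v.im - u.im * v.re ≠ 0 := by
    have e : u.re * v.im - u.im * v.re = orient a b d - orient a b c := by
      simp only [orient, hu, hv, Complex.sub_re, Complex.sub_im]; ring
    have hlt : orient a b c * orient a b d < 0 := h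
    rw [e]
    intro h0
    have : orient a b d = orient a b c := by linarith
    rw [this] at hlt
    nlinarith [mul_self_nonneg (orient a b c)]
  set Δ := u.re * v.im - u.im * v.re with hΔ
  -- By Cramer's rule, `f w` and `k w` are the coordinates of `w - z` in the basis `u`, `v`.
  let f : ℂ → ℝ := fun w => ((w - z).re * v.im - (w - z).im * v.re) / Δ
  let k : ℂ → ℝ := fun w => (u.re * (w - z).im - u.im * (w - z).re) / Δ
  have hf : Continuous f := by fun_prop
  have hk : Continuous k := by fun_prop
  refine mem_interior.2 ⟨{w | 0 < τ + 2 * f w ∧ τ + 2 * f w < 1 ∧ 0 < κ + 2 * k w ∧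
    κ + 2 * k w < 1}, ?_, ?_, ?_⟩
  -- The point `w` is the midpoint of a point of `ab` and a point of `cd`; the factor `2` in the
  -- parameters makes up for the halving.
  · rintro w ⟨w1, w2, w3, w4⟩
    have hm1 : (a : ℂ) + (τ + 2 * f w) • u ∈ hull A := by
      refine segment_subset_hull ha hb ⟨1 - (τ + 2 * f w), τ + 2 * f w, by linarith, w1.le,
        by ring, ?_⟩
      simp only [Complex.real_smul, hu]; push_cast; ring
    have hm2 : (c : ℂ) + (κ + 2 * k w) • v ∈ hull A := by
      refine segment_subset_hull hc hd ⟨1 - (κ + 2 * k w), κ + 2 * k w, by linarith, w3.le,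
        by ring, ?_⟩
      simp only [Complex.real_smul, hv]; push_cast; ring
    have hmid := (convex_hull A) hm1 hm2 (a := 1 / 2) (b := 1 / 2) (by norm_num) (by norm_num)
      (by norm_num)
    convert hmid using 1
    have e1 : f w * Δ = (w - z).re * v.im - (w - z).im * v.re := div_mul_cancel₀ _ hdet
    have e2 : k w * Δ = u.re * (w - z).im - u.im * (w - z).re := div_mul_cancel₀ _ hdet
    have e3 : w - z = f w • u + k w • v := by
      apply Complex.ext
      · apply mul_right_cancel₀ hdet
        simp only [Complex.add_re, Complex.smul_re, smul_eq_mul]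
        linear_combination (-u.re) * e1 - v.re * e2 + (w - z).re * hΔ
      · apply mul_right_cancel₀ hdet
        simp only [Complex.add_im, Complex.smul_im, smul_eq_mul]
        linear_combination (-u.im) * e1 - v.im * e2 + (w - z).im * hΔ
    have hα' : α = 1 - τ := by linarith
    have hγ' : γ = 1 - κ := by linarith
    rw [hα'] at hz1
    rw [hγ'] at hz2
    simp only [Complex.real_smul, hu, hv] at e3 hz1 hz2 ⊢
    push_cast at e3 hz1 hz2 ⊢
    linear_combination e3 - (1 / 2 : ℂ) * hz1 - (1 / 2 : ℂ) * hz2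
  · have c1 : Continuous fun w => τ + 2 * f w := by fun_prop
    have c2 : Continuous fun w => κ + 2 * k w := by fun_prop
    exact (isOpen_lt continuous_const c1).inter ((isOpen_lt c1 continuous_const).inter
      ((isOpen_lt continuous_const c2).inter (isOpen_lt c2 continuous_const)))
  · have e1 : f z = 0 := by simp [f]
    have e2 : k z = 0 := by simp [k]
    refine ⟨?_, ?_, ?_, ?_⟩ <;> simp only [e1, e2] <;> linarith

/-! ### The leaves of a laminational equivalence relation -/

/-- The pairs joined by a (possibly degenerate) leaf of `r`: equivalent points that are not
separated in their class. -/
def Adjacent (r : Setoid Circle) (a b : Circle) : Prop :=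
  r a b ∧ ∀ c d, r a c → r a d → ¬ Cross a b c d

lemma mem_class_iff {r : Setoid Circle} {h : Set Circle} (hh : h ∈ r.classes) {a b : Circle}
    (ha : a ∈ h) : b ∈ h ↔ r a b := by
  refine ⟨fun hb => r.rel_iff_exists_classes.2 ⟨h, hh, ha, hb⟩, fun hab => ?_⟩
  obtain ⟨h', hh', ha', hb'⟩ := r.rel_iff_exists_classes.1 hab
  rwa [Setoid.eq_of_mem_classes hh ha hh' ha']

lemma exists_class (r : Setoid Circle) (a : Circle) : ∃ h ∈ r.classes, a ∈ h :=
  ⟨_, r.mem_classes a, r.refl a⟩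

/-- A set with an interior point on a chord has points on either side of that chord. -/
lemma exists_orient_neg {a b : Circle} (hab : a ≠ b) {B : Set ℂ} {z : ℂ} (hint : z ∈ interior B)
    (hz0 : orient a b z = 0) {ε : ℝ} (hε : ε ≠ 0) : ∃ w ∈ B, ε * orient a b w < 0 := by
  have hu : ((b : ℂ) - a) ≠ 0 := sub_ne_zero.2 fun h => hab (Circle.coe_injective h.symm)
  set u : ℂ := (b : ℂ) - a
  have hN : 0 < u.re * u.re + u.im * u.im := by
    rw [← Complex.normSq_apply]; exact Complex.normSq_pos.2 hu
  -- The direction `-ε i u` is normal to the chord, and moving along it lowers `ε * orient a b` at a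
  -- constant rate.
  have hcont : Continuous fun t : ℝ => z + (t : ℂ) * (-(ε : ℂ) * (Complex.I * u)) := by fun_prop
  have hev : ∀ᶠ t : ℝ in nhds 0, z + (t : ℂ) * (-(ε : ℂ) * (Complex.I * u)) ∈ interior B :=
    hcont.continuousAt.eventually_mem (isOpen_interior.mem_nhds (by simpa using hint))
  obtain ⟨δ, hδ, hball⟩ := Metric.eventually_nhds_iff.1 hev
  have hin := interior_subset (hball (y := δ / 2) (by
    rw [Real.dist_eq, sub_zero, abs_of_pos (by linarith)]; linarith))
  refine ⟨_, hin, ?_⟩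
  have e : orient a b (z + ((δ / 2 : ℝ) : ℂ) * (-(ε : ℂ) * (Complex.I * u)))
      = orient a b z - δ / 2 * ε * (u.re * u.re + u.im * u.im) := by
    simp [orient, u]; ring
  rw [e, hz0]
  have hε2 : 0 < ε * ε := mul_self_pos.2 hε
  nlinarith [mul_pos (mul_pos hδ hε2) hN]

/-- If no chord of `A` crosses `ab`, then `A`, and with it the hull, lies in a closed half plane
bounded by the line `ab`; the segment lies on that boundary. -/
lemma segment_subset_frontier {A : Set Circle} {a b : Circle} (ha : a ∈ A) (hb : b ∈ A)
    (hab : a ≠ b) (h : ∀ c ∈ A, ∀ d ∈ A, ¬ Cross a b c d) :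
    segment ℝ (a : ℂ) b ⊆ frontier (hull A) := by
  intro z hz
  refine ⟨subset_closure (segment_subset_hull ha hb hz), fun hint => ?_⟩
  have hz0 : orient a b z = 0 := orient_eq_zero_of_mem_segment hz
  obtain ⟨ε, hε, hε'⟩ : ∃ ε : ℝ, ε ≠ 0 ∧ ∀ c ∈ A, 0 ≤ ε * orient a b c := by
    by_cases h' : ∃ c ∈ A, orient a b c < 0
    · obtain ⟨c, hc, hc'⟩ := h'
      refine ⟨-1, by norm_num, fun d hd => ?_⟩
      have := not_lt.1 (h c hc d hd)
      by_contra! hcon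
      nlinarith
    · push Not at h'
      exact ⟨1, one_ne_zero, fun c hc => by simpa using h' c hc⟩
  have hull0 : ∀ w ∈ hull A, 0 ≤ ε * orient a b w := by
    have : Convex ℝ {w : ℂ | 0 ≤ ε * orient a b w} := by
      intro x hx y hy s t hs ht hst
      simp only [Set.mem_ofPred_eq] at *
      rw [orient_convexComb _ _ _ _ hst]
      nlinarith [mul_nonneg hs hx, mul_nonneg ht hy]
    refine convexHull_min ?_ this
    rintro _ ⟨c, hc, rfl⟩
    exact hε' c hc
  obtain ⟨w, hw, hlt⟩ := exists_orient_neg hab hint hz0 hε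
  exact (hull0 w hw).not_gt hlt

/-- A crossing chord of the class would put an interior point of the hull on the edge. Conversely an
uncrossed chord supports the hull. Finiteness of classes makes hulls closed, so that a boundary
chord has its endpoints in the class. -/
lemma mem_leavesOf_iff {r : Setoid Circle} (hr : IsLaminational r) {a b : Circle} :
    s(a, b) ∈ leavesOf r ↔ Adjacent r a b := by
  constructor
  · intro h
    by_cases hab : a = b
    · subst hab
      exact ⟨r.refl a, fun c d _ _ => not_cross_self _ _ _⟩
    rcases h with h | ⟨g, hg, hseg⟩
    · exact absurd (by simpa using h) hab
    have hcl : IsClosed (hull g) := ((hr.finite_classes g hg).image _).isClosed_convexHull ℝ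
    have hsub : segment ℝ (a : ℂ) b ⊆ hull g := by
      rw [← seg_mk]
      exact hseg.trans hcl.frontier_subset
    have ha : a ∈ g := coe_mem_hull_iff.1 (hsub (left_mem_segment _ _ _))
    have hb : b ∈ g := coe_mem_hull_iff.1 (hsub (right_mem_segment _ _ _))
    refine ⟨(mem_class_iff hg ha).1 hb, fun c d hc hd hx => ?_⟩
    obtain ⟨z, h1, h2⟩ := hx.exists_mem_openSegment
    have := hx.mem_interior_hull ha hb ((mem_class_iff hg ha).2 hc) ((mem_class_iff hg ha).2 hd)
      h1 h2
    rw [seg_mk] at hseg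
    exact (hseg (openSegment_subset_segment _ _ _ h1)).2 this
  · rintro ⟨hab, h⟩
    by_cases hne : a = b
    · left; simpa using hne
    obtain ⟨g, hg, ha⟩ := exists_class r a
    refine Or.inr ⟨g, hg, ?_⟩
    rw [seg_mk]
    exact segment_subset_frontier ha ((mem_class_iff hg ha).2 hab) hne fun c hc d hd =>
      h c d ((mem_class_iff hg ha).1 hc) ((mem_class_iff hg ha).1 hd)

/-- Chords with endpoints in distinct classes do not cross. -/
lemma IsLaminational.not_cross {r : Setoid Circle} (hr : IsLaminational r) {a b c d : Circle}
    (hab : r a b) (hcd : r c d) (hac : ¬ r a c) : ¬ Cross a b c d := by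
  intro h
  obtain ⟨g, hg, ha⟩ := exists_class r a
  obtain ⟨k, hk, hc⟩ := exists_class r c
  refine h.not_disjoint_hull ha ((mem_class_iff hg ha).2 hab) hc ((mem_class_iff hk hc).2 hcd)
    (hr.disjoint_hulls g hg k hk ?_)
  rintro rfl
  exact hac ((mem_class_iff hg ha).1 hc)

lemma Adjacent.not_cross {r : Setoid Circle} (hr : IsLaminational r) {a b c d : Circle}
    (hab : Adjacent r a b) (hcd : r c d) : ¬ Cross a b c d := by
  by_cases hac : r a c
  · exact hab.2 c d hac (r.trans hac hcd)
  · exact hr.not_cross hab.1 hcd hac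

/-- Crossing a fixed chord is an open condition, and a leaf crosses no chord between equivalent
points of any class. Adjacency is thus the closed graph cut down by closed conditions that do not
depend on the pair. -/
lemma isClosed_adjacent {r : Setoid Circle} (hr : IsLaminational r) :
    IsClosed {p : Circle × Circle | Adjacent r p.1 p.2} := by
  have : {p : Circle × Circle | Adjacent r p.1 p.2} = {p | r p.1 p.2} ∩
      ⋂ (c) (d) (_ : r c d), {p | ¬ Cross p.1 p.2 c d} := by
    ext ⟨a, b⟩
    simp only [Set.mem_ofPred_eq, Set.mem_inter_iff, Set.mem_iInter]
    refine ⟨fun h => ⟨h.1, fun c d hcd => h.not_cross hr hcd⟩, fun h => ⟨h.1, fun c d hc hd => ?_⟩⟩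
    exact h.2 c d (r.trans (r.symm hc) hd)
  rw [this]
  refine hr.isClosed_graph.inter (isClosed_iInter fun c => isClosed_iInter fun d =>
    isClosed_iInter fun _ => ?_)
  exact (isOpen_cross c d).isClosed_compl

/-- If the leaves form a closed set of pairs, their union is closed. -/
lemma isClosed_solid_of_isClosed {L : Set Chord}
    (h : IsClosed {p : Circle × Circle | s(p.1, p.2) ∈ L}) : IsClosed (solid L) := by
  have : solid L = (fun q : (Circle × Circle) × ℝ => (1 - q.2 : ℂ) * q.1.1 + q.2 * q.1.2) ''
      ({p : Circle × Circle | s(p.1, p.2) ∈ L} ×ˢ Set.Icc (0 : ℝ) 1) := by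
    ext z
    simp only [solid, Set.mem_iUnion, Set.mem_image, Set.mem_prod]
    constructor
    · rintro ⟨l, hl, hz⟩
      induction l using Sym2.ind with
      | _ a b =>
        rw [seg_mk] at hz
        obtain ⟨s, t, hs, ht, hst, rfl⟩ := hz
        refine ⟨((a, b), t), ⟨hl, ht, by linarith⟩, ?_⟩
        obtain rfl : s = 1 - t := by linarith
        simp
    · rintro ⟨⟨⟨a, b⟩, t⟩, ⟨hl, ht0, ht1⟩, rfl⟩
      refine ⟨s(a, b), hl, ?_⟩
      rw [seg_mk]
      exact ⟨1 - t, t, by linarith, ht0, by ring, by simp⟩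
  rw [this]
  refine ((h.isCompact.prod isCompact_Icc).image ?_).isClosed
  fun_prop

lemma isGeodesicLamination_leavesOf {r : Setoid Circle} (hr : IsLaminational r) :
    IsGeodesicLamination (leavesOf r) where
  unlinked := by
    intro l hl m hm hlm
    induction l using Sym2.ind with
    | _ a b =>
      induction m using Sym2.ind with
      | _ c d =>
        rw [mem_leavesOf_iff hr] at hl hm
        exact unlinked_of_not_cross hlm (hl.not_cross hr hm.1)
  points_mem := fun x => Or.inl (by simp)
  isClosed_solid := by
    apply isClosed_solid_of_isClosed
    simp only [mem_leavesOf_iff hr]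
    exact isClosed_adjacent hr

/-! ### Classes of an invariant relation -/

/-- A lift, in turns, of an orientation preserving covering map. -/
lemma IsOrientationPreservingCovering.exists_lift {f : Circle → Circle}
    (hf : IsOrientationPreservingCovering f) :
    ∃ F : ℝ → ℝ, Continuous F ∧ StrictMono F ∧ ∀ t, f (turn t) = turn (F t) := by
  obtain ⟨-, F, hF, hmono, hlift⟩ := hf
  have hpi : 0 < 2 * π := by positivity
  refine ⟨fun t => F (2 * π * t) / (2 * π), by fun_prop, fun s t hst => ?_, fun t => ?_⟩
  · exact div_lt_div_of_pos_right (hmono (by nlinarith)) hpi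
  · rw [turn, hlift, turn, mul_div_cancel₀ _ hpi.ne']

lemma lift_add_one_sub {f : Circle → Circle} {F : ℝ → ℝ} (hmono : StrictMono F)
    (hlift : ∀ t, f (turn t) = turn (F t)) {s t : ℝ} (hst : s < t) (h : f (turn s) = f (turn t)) :
    F s + 1 ≤ F t := by
  rw [hlift, hlift, turn_eq_turn] at h
  obtain ⟨n, hn⟩ := h
  have := hmono hst
  have h1 : (n : ℝ) < 0 := by linarith
  have h2 : n ≤ -1 := by
    have : n < 0 := by exact_mod_cast h1
    omega
  have h3 : (n : ℝ) ≤ -1 := by exact_mod_cast h2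
  linarith

lemma turn_add_one (t : ℝ) : turn (t + 1) = turn t := by rw [turn_add, turn_one, mul_one]

lemma turn_add_half (t : ℝ) : turn (t + 1 / 2) = -turn t := by rw [turn_add, turn_half]; simp

lemma exists_turn_lift (z : Circle) (t : ℝ) : ∃ s, t ≤ s ∧ s < t + 1 ∧ turn s = z := by
  refine ⟨t + arc (turn t) z, by linarith [arc_nonneg (turn t) z],
    by linarith [arc_lt_one (turn t) z], ?_⟩
  rw [turn_add, mul_turn_arc]

/-- A class that contains two antipodal points is symmetric. -/
lemma IsInvariantRel.neg_mem {r : Setoid Circle} (hi : IsInvariantRel 2 r) {g : Set Circle}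
    (hg : g ∈ r.classes) {x y : Circle} (hx : x ∈ g) (hx' : -x ∈ g) (hy : y ∈ g) : -y ∈ g := by
  obtain ⟨f, hf, hfs, hpre⟩ := hi.covering g hg
  obtain ⟨F, hF, hmono, hlift⟩ := hf.exists_lift
  obtain ⟨t, rfl⟩ := turn_surjective x
  have hfx : f (turn t) = f (turn (t + 1 / 2)) := by
    rw [turn_add_half, hfs _ hx, hfs _ hx', sigma_neg]
  have hfx' : f (turn (t + 1 / 2)) = f (turn (t + 1)) := by rw [turn_add_one, hfx]
  have h1 := lift_add_one_sub hmono hlift (by linarith) hfx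
  have h2 := lift_add_one_sub hmono hlift (by linarith) hfx'
  -- Each of the two half turns cut off by the antipodal pair is stretched by `F` over at least a
  -- full turn. The half that does not contain `y` therefore has a second point `w` with the same
  -- `f`-image; it lies in the full preimage `g`, so it can only be `-y`.
  suffices h : ∃ w, w ≠ y ∧ f w = f y by
    obtain ⟨w, hwy, hw⟩ := h
    have hwg : w ∈ g := by
      rw [← hpre, Set.mem_preimage, hw, hfs y hy]
      exact ⟨y, hy, rfl⟩
    rw [hfs y hy, hfs w hwg, eq_comm, sigma_eq_sigma] at hw
    rcases hw with hw | hw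
    · exact absurd hw hwy
    · rwa [← hw]
  obtain ⟨s, hs0, hs1, rfl⟩ := exists_turn_lift y t
  have main : ∀ a b : ℝ, F a + 1 ≤ F b → b = a + 1 / 2 → (¬ ∃ k : ℤ, a ≤ s + k ∧ s + k < b) →
      ∃ w, w ≠ turn s ∧ f w = f (turn s) := by
    intro a b hab hb hk
    set c := F s - ⌊F s - F a⌋ with hc
    have hc0 : F a ≤ c := by linarith [Int.floor_le (F s - F a)]
    have hc1 : c < F b := by linarith [Int.lt_floor_add_one (F s - F a)]
    obtain ⟨u, hu, huc⟩ := intermediate_value_Icc (by linarith : a ≤ b) hF.continuousOn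
      ⟨hc0, hc1.le⟩
    have hub : u < b := hmono.lt_iff_lt.1 (by rw [huc]; exact hc1)
    refine ⟨turn u, fun h => hk ?_, ?_⟩
    · obtain ⟨n, hn⟩ := turn_eq_turn.1 h
      exact ⟨n, by linarith [hu.1], by linarith⟩
    · rw [hlift, hlift, turn_eq_turn, huc]
      exact ⟨-⌊F s - F a⌋, by push_cast; linarith⟩
  rcases lt_or_ge s (t + 1 / 2) with hs | hs
  · refine main (t + 1 / 2) (t + 1) h2 (by ring) ?_
    rintro ⟨k, hk0, hk1⟩
    have e1 : (0 : ℝ) < k := by linarith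
    have e2 : (k : ℝ) < 1 := by linarith
    have e1' : 0 < k := by exact_mod_cast e1
    have e2' : k < 1 := by exact_mod_cast e2
    omega
  · refine main t (t + 1 / 2) h1 (by ring) ?_
    rintro ⟨k, hk0, hk1⟩
    have e1 : (-1 : ℝ) < k := by linarith
    have e2 : (k : ℝ) < 0 := by linarith
    have e1' : -1 < k := by exact_mod_cast e1
    have e2' : k < 0 := by exact_mod_cast e2
    omega

lemma IsInvariantRel.rel_sigma {r : Setoid Circle} (hi : IsInvariantRel 2 r) {x y : Circle}
    (h : r x y) : r (sigma 2 x) (sigma 2 y) := by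
  obtain ⟨g, hg, hx⟩ := exists_class r x
  exact (mem_class_iff (hi.forward g hg) ⟨x, hx, rfl⟩).1 ⟨y, (mem_class_iff hg hx).2 h, rfl⟩

lemma IsInvariantRel.exists_rel_of_rel_sigma {r : Setoid Circle} (hi : IsInvariantRel 2 r)
    {x v : Circle} (h : r (sigma 2 x) v) : ∃ y, r x y ∧ sigma 2 y = v := by
  obtain ⟨g, hg, hx⟩ := exists_class r x
  obtain ⟨y, hy, hyv⟩ := (mem_class_iff (hi.forward g hg) ⟨x, hx, rfl⟩).2 h
  exact ⟨y, (mem_class_iff hg hx).1 hy, hyv⟩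

/-- If the class of `x` contains `-x`, it is symmetric. Otherwise the class of `-x` has the same
image as that of `x`, so it contains `y` or `-y`; the first would join `x` to `-x`. -/
lemma IsInvariantRel.rel_neg {r : Setoid Circle} (hi : IsInvariantRel 2 r) {x y : Circle}
    (h : r x y) : r (-x) (-y) := by
  by_cases hx : r x (-x)
  · obtain ⟨g, hg, hxg⟩ := exists_class r x
    have hx' := (mem_class_iff hg hxg).2 hx
    refine (mem_class_iff hg hx').1 ?_
    exact hi.neg_mem hg hxg hx' ((mem_class_iff hg hxg).2 h)
  · have h' : r (sigma 2 (-x)) (sigma 2 y) := by rw [sigma_neg]; exact hi.rel_sigma h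
    obtain ⟨z, hz, hzy⟩ := hi.exists_rel_of_rel_sigma h'
    rw [eq_comm, sigma_eq_sigma] at hzy
    rcases hzy with rfl | rfl
    · exact absurd (r.trans h (r.symm hz)) hx
    · exact hz

lemma Adjacent.neg {r : Setoid Circle} (hi : IsInvariantRel 2 r) {x y : Circle}
    (h : Adjacent r x y) : Adjacent r (-x) (-y) := by
  refine ⟨hi.rel_neg h.1, fun c d hc hd hx => h.2 (-c) (-d) ?_ ?_ ?_⟩
  · simpa using hi.rel_neg hc
  · simpa using hi.rel_neg hd
  · simpa using hx.neg

lemma Adjacent.symm {r : Setoid Circle} {x y : Circle} (h : Adjacent r x y) : Adjacent r y x :=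
  ⟨r.symm h.1, fun c d hc hd hx => h.2 c d (r.trans h.1 hc) (r.trans h.1 hd) hx.swap_left⟩

/-- One of the two arcs cut off by a leaf is free of points of its class. -/
lemma Adjacent.arc_free {r : Setoid Circle} {a b : Circle} (h : Adjacent r a b) (hab : a ≠ b) :
    (∀ c, r a c → 0 < arc a c → arc a b ≤ arc a c) ∨
      ∀ c, r b c → 0 < arc b c → arc b a ≤ arc b c := by
  by_contra! hc
  obtain ⟨⟨c, hac, h1, h2⟩, d, hbd, h3, h4⟩ := hc
  refine h.2 c d hac (r.trans h.1 hbd) ?_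
  have hba : 0 < arc a b := arc_pos.2 hab.symm
  have hlt : arc a b < arc a d := by
    by_contra! hle
    rcases hle.lt_or_eq with hle | hle
    · rw [arc_base_of_lt hle, arc_swap hab] at h4
      linarith [arc_nonneg a d]
    · rw [arc_inj] at hle
      rw [hle, arc_self] at h3
      exact h3.false
  rw [cross_iff a, alternate_iff, arc_self]
  exact Or.inl ⟨h1, h2, hlt⟩

lemma adjacent_of_arc_free {r : Setoid Circle} {a b : Circle} (hr : r a b)
    (h : ∀ c, r a c → 0 < arc a c → arc a b ≤ arc a c) : Adjacent r a b := by
  refine ⟨hr, fun c d hc hd hx => ?_⟩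
  rw [cross_iff a, alternate_iff, arc_self] at hx
  have h1 := h c hc
  have h2 := h d hd
  have := arc_nonneg a b
  have := arc_nonneg a c
  have := arc_nonneg a d
  grind

/-- The lift is monotone and the class is its full preimage, so a point of the image class inside
the image of a free arc would pull back into that arc. For the same reason the image of a free arc
is at most one turn; a full turn means that the image leaf is degenerate. -/
lemma IsInvariantRel.adjacent_sigma {r : Setoid Circle} (hi : IsInvariantRel 2 r) {a b : Circle}
    (h : Adjacent r a b) : Adjacent r (sigma 2 a) (sigma 2 b) := by
  by_cases hab : a = b
  · subst hab
    exact ⟨r.refl _, fun c d _ _ => not_cross_self _ _ _⟩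
  have main : ∀ a b, r a b → a ≠ b → (∀ c, r a c → 0 < arc a c → arc a b ≤ arc a c) →
      Adjacent r (sigma 2 a) (sigma 2 b) := by
    intro a b hab hne hfree
    obtain ⟨g, hg, ha⟩ := exists_class r a
    obtain ⟨f, hf, hfs, hpre⟩ := hi.covering g hg
    obtain ⟨F, hF, hmono, hlift⟩ := hf.exists_lift
    obtain ⟨s, rfl⟩ := turn_surjective a
    set t := s + arc (turn s) b with ht
    have hst : s < t := by linarith [arc_pos.2 hne.symm]
    have hbt : turn t = b := by rw [ht, turn_add, mul_turn_arc]
    have hb := (mem_class_iff hg ha).2 hab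
    have hFs : turn (F s) = sigma 2 (turn s) := by rw [← hlift, hfs _ ha]
    have hFt : turn (F t) = sigma 2 b := by rw [← hlift, hbt, hfs _ hb]
    have hno : ∀ v, F s < v → v < F t → ¬ r (sigma 2 (turn s)) (turn v) := by
      intro v hv0 hv1 hrv
      obtain ⟨u, hu, rfl⟩ := intermediate_value_Icc hst.le hF.continuousOn ⟨hv0.le, hv1.le⟩
      have hu0 := hmono.lt_iff_lt.1 hv0
      have hu1 := hmono.lt_iff_lt.1 hv1
      have hug : turn u ∈ g := by
        rw [← hpre, Set.mem_preimage, hlift]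
        exact (mem_class_iff (hi.forward g hg) ⟨_, ha, rfl⟩).2 hrv
      have e : arc (turn s) (turn u) = u - s :=
        arc_eq_of_mul_turn (by linarith) (by linarith [arc_lt_one (turn s) b])
          (by rw [← turn_add]; congr 1; ring)
      have := hfree _ ((mem_class_iff hg ha).1 hug) (by rw [e]; linarith)
      linarith
    have hle : F t ≤ F s + 1 := by
      by_contra! hlt
      refine hno (F s + 1) (by linarith) hlt ?_
      rw [turn_add_one, hFs]
    rcases hle.lt_or_eq with hlt | heq
    · have earc : arc (sigma 2 (turn s)) (sigma 2 b) = F t - F s :=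
        arc_eq_of_mul_turn (by linarith [hmono hst]) (by linarith)
          (by rw [← hFs, ← hFt, ← turn_add]; congr 1; ring)
      refine adjacent_of_arc_free (hi.rel_sigma hab) fun c hc hc0 => ?_
      by_contra! hcl
      refine hno (F s + arc (sigma 2 (turn s)) c) (by linarith) (by linarith) ?_
      rw [turn_add, hFs, mul_turn_arc]
      exact hc
    · have : sigma 2 b = sigma 2 (turn s) := by rw [← hFs, ← hFt, heq, turn_add_one]
      rw [this]
      exact ⟨r.refl _, fun c d _ _ => not_cross_self _ _ _⟩
  rcases h.arc_free hab with h' | h'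
  · exact main a b h.1 hab h'
  · exact (main b a (r.symm h.1) (Ne.symm hab) h').symm

/-- A free arc at `a` lifts through the monotone covering, starting at any preimage of `a`. The
lifted arc is shorter than a turn because the lift gains at least one turn per turn, and a class
point inside it would map into the free arc. -/
lemma IsInvariantRel.exists_adjacent_preimage {r : Setoid Circle} (hi : IsInvariantRel 2 r)
    {a b : Circle} (h : Adjacent r a b) :
    ∃ x y, Adjacent r x y ∧ sigma 2 x = a ∧ sigma 2 y = b := by
  by_cases hab : a = b
  · subst hab
    obtain ⟨x, hx⟩ := sigma_surjective a
    exact ⟨x, x, ⟨r.refl _, fun c d _ _ => not_cross_self _ _ _⟩, hx, hx⟩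
  have main : ∀ a b, r a b → a ≠ b → (∀ c, r a c → 0 < arc a c → arc a b ≤ arc a c) →
      ∃ x y, Adjacent r x y ∧ sigma 2 x = a ∧ sigma 2 y = b := by
    intro a b hab hne hfree
    obtain ⟨x, rfl⟩ := sigma_surjective a
    obtain ⟨g, hg, hx⟩ := exists_class r x
    obtain ⟨f, hf, hfs, hpre⟩ := hi.covering g hg
    obtain ⟨F, hF, hmono, hlift⟩ := hf.exists_lift
    obtain ⟨s, rfl⟩ := turn_surjective x
    have hFs : turn (F s) = sigma 2 (turn s) := by rw [← hlift, hfs _ hx]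
    set β := F s + arc (sigma 2 (turn s)) b with hβ
    have hβ0 : F s < β := by linarith [arc_pos.2 hne.symm]
    have hβ1 : β < F (s + 1) := by
      have := lift_add_one_sub hmono hlift (by linarith : s < s + 1) (by rw [turn_add_one])
      linarith [arc_lt_one (sigma 2 (turn s)) b]
    have hβb : turn β = b := by rw [hβ, turn_add, hFs, mul_turn_arc]
    obtain ⟨t, ht, htβ⟩ := intermediate_value_Icc (by linarith : s ≤ s + 1) hF.continuousOn
      ⟨hβ0.le, hβ1.le⟩
    have hst : s < t := hmono.lt_iff_lt.1 (by rw [htβ]; exact hβ0)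
    have ht1 : t < s + 1 := hmono.lt_iff_lt.1 (by rw [htβ]; exact hβ1)
    have hsg := hi.forward g hg
    have hyg : turn t ∈ g := by
      rw [← hpre, Set.mem_preimage, hlift, htβ, hβb]
      exact (mem_class_iff hsg ⟨_, hx, rfl⟩).2 hab
    refine ⟨turn s, turn t, adjacent_of_arc_free ((mem_class_iff hg hx).1 hyg) fun c hc hc0 => ?_,
      rfl, by rw [← hfs _ hyg, hlift, htβ, hβb]⟩
    have e : arc (turn s) (turn t) = t - s :=
      arc_eq_of_mul_turn (by linarith) (by linarith) (by rw [← turn_add]; congr 1; ring)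
    by_contra! hcl
    rw [e] at hcl
    set u := s + arc (turn s) c with hu
    have huc : turn u = c := by rw [hu, turn_add, mul_turn_arc]
    have hcg := (mem_class_iff hg hx).2 hc
    have h1 : F s < F u := hmono (by linarith)
    have h2 : F u < β := by rw [← htβ]; exact hmono (by linarith)
    have e2 : arc (sigma 2 (turn s)) (sigma 2 c) = F u - F s := by
      refine arc_eq_of_mul_turn (by linarith)
        (by linarith [arc_lt_one (sigma 2 (turn s)) b]) ?_
      rw [← hFs, ← turn_add, add_sub_cancel, ← hlift, huc, hfs _ hcg]
    have := hfree (sigma 2 c) (hi.rel_sigma hc) (by rw [e2]; linarith)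
    linarith
  rcases h.arc_free hab with h' | h'
  · exact main a b h.1 hab h'
  · obtain ⟨x, y, hxy, hx, hy⟩ := main b a (r.symm h.1) (Ne.symm hab) h'
    exact ⟨y, x, hxy.symm, hy, hx⟩

/-- A chord whose image is non-degenerate is disjoint from its antipodal chord. -/
lemma disjoint_seg_neg {a b : Circle} (h : sigma 2 a ≠ sigma 2 b) :
    Disjoint (Chord.seg s(a, b)) (Chord.seg s(-a, -b)) := by
  rw [Set.disjoint_left]
  intro z hz hz'
  rw [seg_mk] at hz hz'
  have h1 := orient_eq_zero_of_mem_segment hz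
  have h2 := orient_eq_zero_of_mem_segment hz'
  have h3 : (b : ℂ).re * (a : ℂ).im - (b : ℂ).im * (a : ℂ).re = 0 := by
    simp only [orient, Circle.coe_neg, Complex.sub_re, Complex.sub_im, Complex.neg_re,
      Complex.neg_im] at h1 h2
    linarith
  have h4 : orient a (-a : Circle) b = 0 := by
    simp only [orient, Circle.coe_neg, Complex.sub_re, Complex.sub_im, Complex.neg_re,
      Complex.neg_im]
    linarith
  have hb := mem_segment_of_orient_eq_zero (neg_ne a).symm (norm_coe_le b) h4
  rcases coe_mem_segment hb with rfl | rfl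
  · exact h rfl
  · exact h (sigma_neg a).symm

/-- The sibling of a leaf is its antipode, which is a leaf by `Adjacent.neg` and is disjoint from it
by `disjoint_seg_neg`. -/
theorem isSiblingInvariant_leavesOf {r : Setoid Circle} (hr : IsLaminational r)
    (hi : IsInvariantRel 2 r) : IsSiblingInvariant 2 (leavesOf r) where
  isGeodesicLamination := isGeodesicLamination_leavesOf hr
  forward := by
    intro l hl
    induction l using Sym2.ind with
    | _ a b =>
      rw [mem_leavesOf_iff hr] at hl
      exact (mem_leavesOf_iff hr).2 (hi.adjacent_sigma hl)
  backward := by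
    intro l hl
    induction l using Sym2.ind with
    | _ a b =>
      rw [mem_leavesOf_iff hr] at hl
      obtain ⟨x, y, hxy, rfl, rfl⟩ := hi.exists_adjacent_preimage hl
      exact ⟨s(x, y), (mem_leavesOf_iff hr).2 hxy, rfl⟩
  siblings := by
    classical
    intro l hl hd
    induction l using Sym2.ind with
    | _ a b =>
      rw [mem_leavesOf_iff hr] at hl
      have hab : sigma 2 a ≠ sigma 2 b := by simpa [sigmaChord] using hd
      have hdis := disjoint_seg_neg hab
      have hne : s(a, b) ≠ s(-a, -b) := by
        intro h
        rw [← h, seg_mk, Set.disjoint_left] at hdis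
        exact hdis (left_mem_segment _ _ _) (left_mem_segment _ _ _)
      refine ⟨{s(a, b), s(-a, -b)}, Finset.card_pair hne, by simp, ?_, ?_, ?_⟩
      · simp only [Finset.mem_insert, Finset.mem_singleton]
        rintro m (rfl | rfl)
        · exact (mem_leavesOf_iff hr).2 hl
        · exact (mem_leavesOf_iff hr).2 (hl.neg hi)
      · simp only [Finset.mem_insert, Finset.mem_singleton]
        rintro m (rfl | rfl)
        · rfl
        · simp [sigmaChord, sigma_neg]
      · simp only [Finset.mem_insert, Finset.mem_singleton]
        rintro m (rfl | rfl) n (rfl | rfl) hmn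
        · exact absurd rfl hmn
        · exact hdis
        · exact hdis.symm
        · exact absurd rfl hmn

/-! ### Leaves near a critical set -/

lemma IsGeodesicLamination.not_cross {L : Set Chord} (hL : IsGeodesicLamination L)
    {a b c d : Circle} (hab : s(a, b) ∈ L) (hcd : s(c, d) ∈ L) : ¬ Cross a b c d := by
  intro h
  by_cases he : s(a, b) = s(c, d)
  · rcases Sym2.eq_iff.1 he with ⟨rfl, rfl⟩ | ⟨rfl, rfl⟩
    · exact not_cross_left _ _ _ h
    · exact not_cross_left _ _ _ h.swap_right
  · exact h.not_unlinked (hL.unlinked _ hab _ hcd he)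

lemma half_mem_openSegment (a b : ℂ) : (1 / 2 : ℂ) * (a + b) ∈ openSegment ℝ a b :=
  ⟨1 / 2, 1 / 2, by norm_num, by norm_num, by norm_num, by
    simp only [Complex.real_smul]; push_cast; ring⟩

lemma norm_half_lt_one {a b : Circle} (hab : a ≠ b) : ‖(1 / 2 : ℂ) * ((a : ℂ) + b)‖ < 1 :=
  norm_lt_one_of_mem_openSegment (norm_coe_le a) (norm_coe_le b)
    (fun h => hab (Circle.coe_injective h)) (half_mem_openSegment _ _)

/-- A leaf through the midpoint of a chord is that chord or crosses it. -/
lemma eq_or_cross_of_half_mem {a b c d : Circle} (hab : a ≠ b)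
    (h : (1 / 2 : ℂ) * ((a : ℂ) + b) ∈ Chord.seg s(c, d)) : s(c, d) = s(a, b) ∨ Cross a b c d := by
  by_contra! hc
  obtain ⟨x, hx, -⟩ := unlinked_of_not_cross (Ne.symm hc.1) hc.2 _ ⟨by
    rw [seg_mk]; exact openSegment_subset_segment _ _ _ (half_mem_openSegment _ _), h⟩
  have := norm_half_lt_one hab
  rw [← hx] at this
  exact absurd (Circle.norm_coe x) this.ne

/-- The midpoint of a limit chord lies in the closed solid, hence on some leaf. That leaf is the
limit chord itself, or it crosses it and then, crossing being open, crosses leaves close to the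
limit. -/
lemma IsGeodesicLamination.isClosed_pairs {L : Set Chord} (hL : IsGeodesicLamination L) :
    IsClosed {p : Circle × Circle | s(p.1, p.2) ∈ L} := by
  refine isClosed_of_closure_subset ?_
  rintro ⟨a, b⟩ hp
  by_cases hab : a = b
  · subst hab
    exact hL.points_mem a
  have hcont : Continuous fun p : Circle × Circle => (1 / 2 : ℂ) * ((p.1 : ℂ) + p.2) := by fun_prop
  have hz : (1 / 2 : ℂ) * ((a : ℂ) + b) ∈ solid L := by
    rw [← hL.isClosed_solid.closure_eq]
    refine map_mem_closure (f := fun p : Circle × Circle => (1 / 2 : ℂ) * ((p.1 : ℂ) + p.2))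
      hcont hp ?_
    rintro ⟨x, y⟩ hxy
    refine Set.mem_biUnion hxy ?_
    rw [seg_mk]
    exact openSegment_subset_segment _ _ _ (half_mem_openSegment _ _)
  obtain ⟨m, hm, hzm⟩ := Set.mem_iUnion₂.1 hz
  induction m using Sym2.ind with
  | _ c d =>
    rcases eq_or_cross_of_half_mem hab hzm with h | h
    · simpa [h] using hm
    · obtain ⟨⟨x, y⟩, hx, hxy⟩ := mem_closure_iff.1 hp _ (isOpen_cross c d) h
      exact absurd hx (hL.not_cross hxy hm)

/-- No leaf separates two vertices of a gap. -/
lemma IsGap.not_cross {L : Set Chord} {G : Set ℂ} (hG : IsGap L G) {a b c d : Circle}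
    (ha : (a : ℂ) ∈ G) (hb : (b : ℂ) ∈ G) (hcd : s(c, d) ∈ L) : ¬ Cross c d a b := by
  intro h
  obtain ⟨z, -, rfl⟩ := hG
  set C := connectedComponentIn (Metric.ball (0 : ℂ) 1 \ solid L) z
  have hne : c ≠ d := by rintro rfl; exact not_cross_self _ _ _ h
  have hcont : Continuous fun w : ℂ => orient c d w := by unfold orient; fun_prop
  -- The component misses the leaf `cd`, hence the whole line through it inside the disk; being
  -- connected it stays on one side, and so does its closure weakly.
  have hsub : C ⊆ {w | 0 < orient c d w} ∪ {w | orient c d w < 0} := by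
    intro w hw
    obtain ⟨hw1, hw2⟩ := connectedComponentIn_subset _ _ hw
    have : orient c d w ≠ 0 := by
      intro h0
      refine hw2 (Set.mem_biUnion hcd ?_)
      rw [seg_mk]
      exact mem_segment_of_orient_eq_zero hne (by simpa using (mem_ball_zero_iff.1 hw1).le) h0
    rcases lt_or_gt_of_ne this with h | h
    · exact Or.inr h
    · exact Or.inl h
  have hlt : orient c d a * orient c d b < 0 := h
  rcases IsPreconnected.subset_or_subset (isOpen_lt continuous_const hcont)
    (isOpen_lt hcont continuous_const)
    (Set.disjoint_left.2 fun w h1 h2 => lt_asymm (Set.mem_ofPred_eq ▸ h1) h2) hsub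
    isPreconnected_connectedComponentIn with h' | h'
  · have hcl := closure_minimal (h'.trans fun w hw => le_of_lt hw)
      (isClosed_le continuous_const hcont)
    have h1 : 0 ≤ orient c d a := hcl ha
    have h2 : 0 ≤ orient c d b := hcl hb
    nlinarith
  · have hcl := closure_minimal (h'.trans fun w hw => le_of_lt hw)
      (isClosed_le hcont continuous_const)
    have h1 : orient c d a ≤ 0 := hcl ha
    have h2 : orient c d b ≤ 0 := hcl hb
    nlinarith

/-- The edges of a gap are leaves. -/
lemma IsGap.edge_mem {L : Set Chord} (hL : IsGeodesicLamination L) {A : Set Circle}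
    (hG : IsGap L (hull A)) {a b : Circle} (ha : a ∈ A) (hb : b ∈ A) (hab : a ≠ b)
    (h : ∀ c ∈ A, ∀ d ∈ A, ¬ Cross a b c d) : s(a, b) ∈ L := by
  have hseg := half_mem_openSegment (a : ℂ) b
  have hfr := segment_subset_frontier ha hb hab h (openSegment_subset_segment _ _ _ hseg)
  have hball := norm_half_lt_one hab
  set w := (1 / 2 : ℂ) * ((a : ℂ) + b) with hw
  -- A midpoint off the solid would lie in the open component whose closure is the hull, so it would
  -- be interior to the hull instead of on an edge.
  have hsolid : w ∈ solid L := by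
    by_contra hns
    obtain ⟨z, hz, hGz⟩ := hG
    have hopen : IsOpen (Metric.ball (0 : ℂ) 1 \ solid L) :=
      Metric.isOpen_ball.sdiff hL.isClosed_solid
    set C := connectedComponentIn (Metric.ball (0 : ℂ) 1 \ solid L) z
    have hwF : w ∈ Metric.ball (0 : ℂ) 1 \ solid L := ⟨by simpa using hball, hns⟩
    have hwcl : w ∈ closure C := by
      rw [← hGz]
      exact segment_subset_hull ha hb (openSegment_subset_segment _ _ _ hseg)
    obtain ⟨v, hv1, hv2⟩ := mem_closure_iff.1 hwcl _ hopen.connectedComponentIn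
      (mem_connectedComponentIn hwF)
    have hwC : w ∈ C := by
      have e1 := connectedComponentIn_eq hv1
      have e2 := connectedComponentIn_eq hv2
      have : C = connectedComponentIn (Metric.ball (0 : ℂ) 1 \ solid L) w := e2.trans e1.symm
      rw [this]
      exact mem_connectedComponentIn hwF
    refine hfr.2 (mem_interior.2 ⟨C, ?_, hopen.connectedComponentIn, hwC⟩)
    rw [hGz]
    exact subset_closure
  obtain ⟨m, hm, hwm⟩ := Set.mem_iUnion₂.1 hsolid
  induction m using Sym2.ind with
  | _ c d =>
    rcases eq_or_cross_of_half_mem hab hwm with he | hx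
    · rwa [← he]
    · exact absurd hx.symm (hG.not_cross (coe_mem_hull ha) (coe_mem_hull hb) hm)

/-- The pairs of points joined by the leaves of a `σ_2`-invariant lamination that has the
hull of `g` as its critical set. -/
structure IsPulledBack (g : Set Circle) (M : Circle → Circle → Prop) : Prop where
  refl : ∀ a, M a a
  symm : ∀ {a b}, M a b → M b a
  not_cross : ∀ {a b c d}, M a b → M c d → ¬ Cross a b c d
  isClosed : IsClosed {p : Circle × Circle | M p.1 p.2}
  forward : ∀ {a b}, M a b → M (sigma 2 a) (sigma 2 b)
  preimage : ∀ {a b}, M a b → a ≠ b →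
    ∃ x y, sigma 2 x = a ∧ sigma 2 y = b ∧ M x y ∧ M (-x) (-y)
  edge : ∀ {a b}, a ∈ g → b ∈ g → (∀ c ∈ g, ∀ d ∈ g, ¬ Cross a b c d) → M a b
  not_cross_vertices : ∀ {a b x y}, a ∈ g → b ∈ g → M x y → ¬ Cross a b x y

/-- The uniqueness argument uses nothing else about the lamination. Whether the critical set is a
leaf or a gap matters only here. -/
lemma IsSiblingInvariant.isPulledBack {L : Set Chord} (hL : IsSiblingInvariant 2 L)
    {g : Set Circle} (hg : IsCriticalSet L (hull g)) :
    IsPulledBack g fun a b => s(a, b) ∈ L where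
  refl := hL.isGeodesicLamination.points_mem
  symm := fun h => by rwa [Sym2.eq_swap]
  not_cross := fun h1 h2 => hL.isGeodesicLamination.not_cross h1 h2
  isClosed := hL.isGeodesicLamination.isClosed_pairs
  forward := fun h => hL.forward _ h
  preimage := by
    intro a b hab hne
    obtain ⟨m, hm, hms⟩ := hL.backward _ hab
    obtain ⟨x, y, rfl, rfl, rfl⟩ : ∃ x y, m = s(x, y) ∧ sigma 2 x = a ∧ sigma 2 y = b := by
      induction m using Sym2.ind with
      | _ x y =>
        rcases Sym2.eq_iff.1 hms with ⟨h1, h2⟩ | ⟨h1, h2⟩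
        · exact ⟨x, y, rfl, h1, h2⟩
        · exact ⟨y, x, Sym2.eq_swap, h2, h1⟩
    refine ⟨x, y, rfl, rfl, hm, ?_⟩
    obtain ⟨S, hcard, hmS, hSL, hSs, hSd⟩ := hL.siblings _ hm (by rw [hms]; simpa using hne)
    obtain ⟨n, hnS, hn⟩ := Finset.exists_mem_ne (s := S) (by omega) s(x, y)
    have hd := hSd n hnS _ hmS hn
    have hn' := hSL n hnS
    have hns := (hSs n hnS).trans hms
    clear hn hSd hSs hSL hmS
    -- A sibling disjoint from `xy` shares no endpoint with it, so both of its endpoints are the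
    -- antipodes.
    have pair : ∀ {x' y'}, sigma 2 x' = sigma 2 x → sigma 2 y' = sigma 2 y → n = s(x', y') →
        s(-x, -y) ∈ L := by
      rintro x' y' h1 h2 rfl
      rw [seg_mk, seg_mk, Set.disjoint_left] at hd
      rcases sigma_eq_sigma.1 h1.symm with rfl | rfl
      · exact absurd (left_mem_segment _ _ _) (hd (left_mem_segment _ _ _))
      rcases sigma_eq_sigma.1 h2.symm with rfl | rfl
      · exact absurd (right_mem_segment _ _ _) (hd (right_mem_segment _ _ _))
      exact hn'
    induction n using Sym2.ind with
    | _ x' y' =>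
      rcases Sym2.eq_iff.1 hns with ⟨h1, h2⟩ | ⟨h1, h2⟩
      · exact pair h1 h2 rfl
      · exact pair h2 h1 Sym2.eq_swap
  edge := by
    intro a b ha hb hx
    by_cases hab : a = b
    · subst hab; exact hL.isGeodesicLamination.points_mem a
    rcases hg with ⟨l, hl, -, he⟩ | hgap
    · have hgl : g = {x | x ∈ l} := by rw [← basis_hull g, he, Chord.seg, basis_hull]
      rw [hgl] at ha hb
      rwa [← (Sym2.mem_and_mem_iff hab).1 ⟨ha, hb⟩]
    · exact hgap.1.edge_mem hL.isGeodesicLamination ha hb hab hx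
  not_cross_vertices := by
    intro a b x y ha hb hxy
    rcases hg with ⟨l, hl, -, he⟩ | hgap
    · have hgl : g = {x | x ∈ l} := by rw [← basis_hull g, he, Chord.seg, basis_hull]
      rw [hgl] at ha hb
      by_cases hab : a = b
      · subst hab; exact not_cross_self _ _ _
      · refine hL.isGeodesicLamination.not_cross ?_ hxy
        rwa [← (Sym2.mem_and_mem_iff hab).1 ⟨ha, hb⟩]
    · exact fun h => hgap.1.not_cross (coe_mem_hull ha) (coe_mem_hull hb) hxy h.symm

/-! ### Symmetric finite sets -/

/-- The arc of the complement of a finite symmetric set that contains a given point. -/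
lemma exists_side {g : Set Circle} (hfin : g.Finite) (hne : g.Nonempty)
    (hneg : ∀ x ∈ g, -x ∈ g) {z : Circle} (hz : z ∉ g) :
    ∃ p ∈ g, ∃ q ∈ g, 0 < arc p z ∧ arc p z < arc p q ∧ arc p q ≤ 1 / 2 ∧
      ∀ u ∈ g, u ≠ p → arc p q ≤ arc p u := by
  -- Here `p` is the last point of `g` before `z`, and `q` below is the first one after `z`. By
  -- symmetry `-p` is in `g`, which bounds the arc from `p` to `q` by a half turn.
  obtain ⟨p, hp, hpmin⟩ := Set.exists_min_image g (fun u => arc u z) hfin hne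
  obtain ⟨q, hq, hqmin⟩ := Set.exists_min_image g (fun u => arc z u) hfin hne
  have hzp : z ≠ p := fun h => hz (h ▸ hp)
  have hp0 : 0 < arc p z := arc_pos.2 hzp
  have hhalf : arc p z < 1 / 2 := by
    by_contra! hc
    have h1 := hpmin _ (hneg p hp)
    have h2 : arc (-p) z = arc p z - 1 / 2 := by
      rw [arc_base_of_le (p := p) (by rwa [arc_neg_self]), arc_neg_self]
    simp only [h2] at h1
    linarith
  have key : ∀ u ∈ g, u ≠ p → arc p z < arc p u := by
    intro u hu hup
    by_contra! hc
    have h1 := hpmin u hu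
    simp only [arc_base_of_le hc] at h1
    have h2 : 0 < arc p u := arc_pos.2 hup
    linarith
  have hqp : q ≠ p := by
    rintro rfl
    have h1 := hqmin _ (hneg q hq)
    simp only [arc_swap hzp.symm] at h1
    rw [arc_base_of_le (p := q) (z := z) (w := -q) (by rw [arc_neg_self]; exact hhalf.le),
      arc_neg_self] at h1
    linarith
  have hq1 := key q hq hqp
  have hle : ∀ u ∈ g, u ≠ p → arc p q ≤ arc p u := by
    intro u hu hup
    have h1 := hqmin u hu
    simp only [arc_base_of_le hq1.le, arc_base_of_le (key u hu hup).le] at h1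
    linarith
  refine ⟨p, hp, q, hq, hp0, hq1, ?_, hle⟩
  rw [← arc_neg_self p]
  exact hle _ (hneg p hp) (neg_ne p)

lemma not_cross_of_side {g : Set Circle} {p q : Circle} 
    (h : ∀ u ∈ g, u ≠ p → arc p q ≤ arc p u) : ∀ c ∈ g, ∀ d ∈ g, ¬ Cross p q c d := by
  intro c hc d hd hx
  rw [cross_iff p, alternate_iff, arc_self] at hx
  have h1 : 0 < arc p c → arc p q ≤ arc p c := fun h' => h c hc (arc_pos.1 h')
  have h2 : 0 < arc p d → arc p q ≤ arc p d := fun h' => h d hd (arc_pos.1 h')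
  have := arc_nonneg p q
  have := arc_nonneg p c
  have := arc_nonneg p d
  grind

/-- A finite symmetric set all of whose edges are leaves of `r` is a class of `r`. -/
lemma mem_classes_of_edges {r : Setoid Circle} (hi : IsInvariantRel 2 r) {g : Set Circle}
    (hfin : g.Finite) (hne : g.Nonempty) (hneg : ∀ x ∈ g, -x ∈ g)
    (hedge : ∀ a ∈ g, ∀ b ∈ g, (∀ c ∈ g, ∀ d ∈ g, ¬ Cross a b c d) → Adjacent r a b) :
    g ∈ r.classes := by
  obtain ⟨x, hx⟩ := hne
  obtain ⟨h, hh, hxh⟩ := exists_class r x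
  have hsub : g ⊆ h := by
    by_contra hc
    obtain ⟨y, hyg, hyh⟩ := Set.not_subset.1 hc
    -- A closest pair with `u` inside and `v` outside the class is consecutive in `g`, so it is an
    -- edge and hence equivalent.
    obtain ⟨⟨u, v⟩, ⟨⟨hug, huh⟩, hvg, hvh⟩, hmin⟩ := Set.exists_min_image
      ((g ∩ h) ×ˢ (g \ h)) (fun p => arc p.1 p.2)
      ((hfin.subset Set.inter_subset_left).prod (hfin.subset Set.sdiff_subset))
      ⟨(x, y), ⟨hx, hxh⟩, hyg, hyh⟩
    simp only at hug huh hvg hvh hmin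
    refine hvh ((mem_class_iff hh huh).2 (hedge u hug v hvg (not_cross_of_side ?_)).1)
    intro w hw hwu
    by_contra! hlt
    by_cases hwh : w ∈ h
    · have h1 := hmin (w, v) ⟨⟨hw, hwh⟩, hvg, hvh⟩
      simp only [arc_base_of_le hlt.le] at h1
      linarith [arc_pos.2 hwu]
    · have h1 := hmin (u, w) ⟨⟨hug, huh⟩, hw, hwh⟩
      simp only at h1
      linarith
  -- The class contains `p` and `-p`, so it is symmetric. An extra point `w` would come with `-w`,
  -- and this chord would cross the leaf `pq`.
  have hsup : h ⊆ g := by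
    intro w hwh
    by_contra hwg
    obtain ⟨p, hp, q, hq, h1, h2, h3, h4⟩ := exists_side hfin ⟨x, hx⟩ hneg hwg
    have hadj := hedge p hp q hq (not_cross_of_side h4)
    have hnw := hi.neg_mem hh (hsub hp) (hsub (hneg p hp)) hwh
    refine hadj.2 w (-w) ((mem_class_iff hh (hsub hp)).1 hwh)
      ((mem_class_iff hh (hsub hp)).1 hnw) ?_
    rw [cross_iff p, alternate_iff, arc_self, arc_neg_of_lt (by linarith)]
    exact Or.inl ⟨h1, h2, by linarith⟩
  rwa [hsub.antisymm hsup]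

/-- A generalized critical quadrilateral is the hull of a finite symmetric set. -/
lemma IsGeneralizedCriticalQuadrilateral.exists_hull {Q : Set ℂ}
    (hQ : IsGeneralizedCriticalQuadrilateral Q) :
    ∃ g : Set Circle, g.Finite ∧ g.Nonempty ∧ (∀ x ∈ g, -x ∈ g) ∧ Q = hull g := by
  rcases hQ with ⟨⟨A, hA, rfl⟩, l, hl⟩ | ⟨l, hl, rfl⟩
  · have hfin : A.Finite := Set.finite_of_ncard_ne_zero (by omega)
    refine ⟨A, hfin, Set.nonempty_of_ncard_ne_zero (by omega), ?_, rfl⟩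
    rw [sigmaSet, basis_hull, Chord.seg] at hl
    have hl' : sigma 2 '' A = {x | x ∈ l} := by rw [← basis_hull (sigma 2 '' A), hl, basis_hull]
    clear hl
    induction l using Sym2.ind with
    | _ u v =>
      intro x hx
      by_contra hnx
      obtain ⟨u', hu'⟩ := sigma_surjective u
      obtain ⟨v', hv'⟩ := sigma_surjective v
      -- The four points lie over the two endpoints of the image chord, so they are among `±u'`,
      -- `±v'`; leaving out `-x` would leave fewer than four.
      have hsub : A ⊆ {u', -u', v', -v'} \ {-x} := by
        intro y hy
        refine ⟨?_, fun h => hnx (h ▸ hy)⟩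
        have : sigma 2 y ∈ {x | x ∈ s(u, v)} := hl' ▸ ⟨y, hy, rfl⟩
        rcases Sym2.mem_iff.1 this with h | h
        · rw [← hu', eq_comm, sigma_eq_sigma] at h
          rcases h with rfl | rfl <;> simp
        · rw [← hv', eq_comm, sigma_eq_sigma] at h
          rcases h with rfl | rfl <;> simp
      have hmem : -x ∈ ({u', -u', v', -v'} : Set Circle) := by
        rcases (hsub hx).1 with h | h | h | h <;> rw [h] <;> simp
      have h4 : ({u', -u', v', -v'} : Set Circle).ncard ≤ 4 := by
        have e1 := Set.ncard_insert_le u' {-u', v', -v'}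
        have e2 := Set.ncard_insert_le (-u') {v', -v'}
        have e3 := Set.ncard_insert_le v' {-v'}
        rw [Set.ncard_singleton] at e3
        omega
      have h5 := Set.ncard_sdiff_singleton_lt_of_mem hmem (by simp)
      have h6 := Set.ncard_le_ncard hsub (by apply Set.Finite.sdiff; simp)
      omega
  · induction l using Sym2.ind with
    | _ a b =>
      obtain ⟨hne, hd⟩ := hl
      refine ⟨{x | x ∈ s(a, b)}, ?_, ⟨a, by simp⟩, ?_, rfl⟩
      · refine Set.Finite.subset (Set.toFinite {a, b}) fun x hx => ?_
        simpa using hx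
      · have hab : a ≠ b := by simpa using hne
        have hs : sigma 2 a = sigma 2 b := by simpa [sigmaChord] using hd
        rcases sigma_eq_sigma.1 hs with rfl | rfl
        · exact absurd rfl hab
        · intro x hx
          rcases Sym2.mem_iff.1 hx with rfl | rfl <;> simp

/-! ### Precritical classes -/

/-- A symmetric class of an invariant laminational relation. -/
structure IsCriticalClass (r : Setoid Circle) (g : Set Circle) : Prop where
  lam : IsLaminational r
  inv : IsInvariantRel 2 r
  mem : g ∈ r.classes
  nonempty : g.Nonempty
  neg : ∀ x ∈ g, -x ∈ g

/-- Some iterated image of the point lies in `g`. -/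
def Precritical (g : Set Circle) (z : Circle) : Prop := ∃ n : ℕ, (sigma 2)^[n] z ∈ g

/-- No class that is eventually mapped to `g` separates the two points. -/
def Unseparated (r : Setoid Circle) (g : Set Circle) (z w : Circle) : Prop :=
  ∀ u v, r u v → Precritical g u → ¬ Cross u v z w

lemma precritical_of_mem {g : Set Circle} {z : Circle} (h : z ∈ g) : Precritical g z := ⟨0, h⟩

lemma Precritical.of_sigma {g : Set Circle} {z : Circle} (h : Precritical g (sigma 2 z)) :
    Precritical g z := by
  obtain ⟨n, hn⟩ := h
  exact ⟨n + 1, by simpa [Function.iterate_succ_apply] using hn⟩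

lemma Precritical.map {g : Set Circle} {x : Circle} (h : Precritical g x) (hx : x ∉ g) :
    Precritical g (sigma 2 x) := by
  obtain ⟨n, hn⟩ := h
  cases n with
  | zero => exact absurd hn hx
  | succ n => exact ⟨n, hn⟩

section

variable {r : Setoid Circle} {g : Set Circle}

lemma IsInvariantRel.rel_iterate (hi : IsInvariantRel 2 r) {x y : Circle} (h : r x y) (n : ℕ) :
    r ((sigma 2)^[n] x) ((sigma 2)^[n] y) := by
  induction n generalizing x y with
  | zero => exact h
  | succ n ih => exact ih (hi.rel_sigma h)

lemma IsInvariantRel.exists_rel_of_rel_iterate (hi : IsInvariantRel 2 r) {x v : Circle} {n : ℕ}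
    (h : r ((sigma 2)^[n] x) v) : ∃ y, r x y ∧ (sigma 2)^[n] y = v := by
  induction n generalizing x with
  | zero => exact ⟨v, h, rfl⟩
  | succ n ih =>
    obtain ⟨y, hy, hyv⟩ := ih h
    obtain ⟨z, hz, hzy⟩ := hi.exists_rel_of_rel_sigma hy
    exact ⟨z, hz, by rw [Function.iterate_succ_apply, hzy, hyv]⟩

namespace IsCriticalClass

lemma mem_of_rel (hg : IsCriticalClass r g) {x y : Circle} (hx : x ∈ g) (h : r x y) : y ∈ g := (mem_class_iff hg.mem hx).2 h

lemma rel_of_mem (hg : IsCriticalClass r g) {x y : Circle} (hx : x ∈ g) (hy : y ∈ g) : r x y := (mem_class_iff hg.mem hx).1 hy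

lemma finite (hg : IsCriticalClass r g) : g.Finite := hg.lam.finite_classes g hg.mem

lemma precritical_of_rel (hg : IsCriticalClass r g) {x y : Circle} (h : r x y) (hx : Precritical g x) : Precritical g y := by
  obtain ⟨n, hn⟩ := hx
  exact ⟨n, hg.mem_of_rel hn (hg.inv.rel_iterate h n)⟩

/-- The critical class is not periodic. -/
lemma not_precritical_sigma (hg : IsCriticalClass r g) {z : Circle} (hz : z ∈ g) : ¬ Precritical g (sigma 2 z) := by
  rintro ⟨n, hn⟩
  rw [← Function.iterate_succ_apply] at hn
  -- A return would map the finite class `g` onto itself, hence injectively, while `σ_2` identifies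
  -- `z` and `-z`.
  have himage : (sigma 2)^[n + 1] '' g = g := by
    apply Set.Subset.antisymm
    · rintro _ ⟨y, hy, rfl⟩
      exact hg.mem_of_rel hn (hg.inv.rel_iterate (hg.rel_of_mem hz hy) _)
    · intro w hw
      obtain ⟨y, hy, hyw⟩ := hg.inv.exists_rel_of_rel_iterate (hg.rel_of_mem hn hw)
      exact ⟨y, hg.mem_of_rel hz hy, hyw⟩
  have hinj := Set.injOn_of_ncard_image_eq (by rw [himage]) hg.finite
  refine neg_ne z (hinj (hg.neg z hz) hz ?_)
  rw [Function.iterate_succ_apply, sigma_neg, ← Function.iterate_succ_apply]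

/-- An orbit meets the critical class at most once. -/
lemma iterate_mem_unique (hg : IsCriticalClass r g) {z : Circle} {m n : ℕ} (hm : (sigma 2)^[m] z ∈ g)
    (hn : (sigma 2)^[n] z ∈ g) : m = n := by
  by_contra hne
  wlog hlt : m < n generalizing m n
  · exact this hn hm (Ne.symm hne) (by omega)
  refine hg.not_precritical_sigma hm ⟨n - m - 1, ?_⟩
  rw [← Function.iterate_succ_apply, ← Function.iterate_add_apply]
  rwa [show (n - m - 1).succ + m = n by omega]

lemma not_precritical_of_periodic (hg : IsCriticalClass r g) {z : Circle} {n : ℕ} (hn : 0 < n)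
    (h : (sigma 2)^[n] z = z) : ¬ Precritical g z := by
  rintro ⟨m, hm⟩
  have : (sigma 2)^[m + n] z ∈ g := by rwa [Function.iterate_add_apply, h]
  have := hg.iterate_mem_unique hm this
  omega

lemma exists_side (hg : IsCriticalClass r g) {z : Circle} (hz : z ∉ g) :
    ∃ p ∈ g, ∃ q ∈ g, 0 < arc p z ∧ arc p z < arc p q ∧ arc p q ≤ 1 / 2 ∧
      ∀ u ∈ g, u ≠ p → arc p q ≤ arc p u :=
  GeoLam.exists_side hg.finite hg.nonempty hg.neg hz

/-- A class other than `g` lies in one complementary arc of `g`. -/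
lemma rel_side (hg : IsCriticalClass r g) {u v p q : Circle} (hp : p ∈ g) (hq : q ∈ g) (h0 : 0 < arc p u)
    (h1 : arc p u < arc p q) (hu : u ∉ g) (huv : r u v) : 0 < arc p v ∧ arc p v < arc p q := by
  have hv : v ∉ g := fun hv => hu (hg.mem_of_rel hv (r.symm huv))
  have hle := arc_le_of_not_cross h0 h1 (hg.lam.not_cross (hg.rel_of_mem hp hq) huv
    fun h => hu (hg.mem_of_rel hp h))
  refine ⟨arc_pos.2 fun h => hv (h ▸ hp), lt_of_le_of_ne hle fun h => hv ?_⟩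
  rw [arc_inj] at h
  exact h ▸ hq

end IsCriticalClass

/-! ### Doubling on half circles -/

lemma alternate_double {α β γ δ : ℝ} :
    Alternate (2 * α) (2 * β) (2 * γ) (2 * δ) ↔ Alternate α β γ δ := by
  rw [Alternate, Alternate]
  constructor <;> intro h <;> nlinarith

/-- On a closed half circle, `σ_2` preserves crossings of chords unless endpoints collide. -/
lemma Cross.map {p u v x y : Circle} (h : Cross u v x y)
    (h1 : |2 * arc p x - 2 * arc p u| < 1) (h2 : |2 * arc p x - 2 * arc p v| < 1)
    (h3 : |2 * arc p y - 2 * arc p u| < 1) (h4 : |2 * arc p y - 2 * arc p v| < 1) :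
    Cross (sigma 2 u) (sigma 2 v) (sigma 2 x) (sigma 2 y) := by
  rw [cross_iff p] at h
  have := (cross_lift_iff (sigma 2 p) h1 h2 h3 h4).2 (alternate_double.2 h)
  simpa only [sigma_mul_turn_arc] using this

/-! ### Unseparated points -/

namespace Unseparated

lemma symm {z w : Circle} (h : Unseparated r g z w) : Unseparated r g w z :=
  fun u v huv hu hx => h u v huv hu hx.swap_right

lemma arc_le {p q z w : Circle} (hg : IsCriticalClass r g) (h : Unseparated r g z w) (hp : p ∈ g)
    (hq : q ∈ g) (h0 : 0 < arc p z) (h1 : arc p z < arc p q) : arc p w ≤ arc p q :=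
  arc_le_of_not_cross h0 h1 (h p q (hg.rel_of_mem hp hq) (precritical_of_mem hp))

lemma neg {z w : Circle} (hg : IsCriticalClass r g) (h : Unseparated r g z w) :
    Unseparated r g (-z) (-w) := by
  intro u v huv hu hx
  refine h (-u) (-v) (hg.inv.rel_neg huv) ?_ (by simpa using hx.neg)
  by_cases hug : u ∈ g
  · exact precritical_of_mem (hg.neg u hug)
  · apply Precritical.of_sigma
    rw [sigma_neg]
    exact hu.map hug

/-- Antipodal points are separated, unless they lie in the critical class. -/
lemma mem_of_neg (hg : IsCriticalClass r g) {z : Circle} (h : Unseparated r g z (-z)) : z ∈ g := by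
  by_contra hz
  obtain ⟨p, hp, q, hq, h1, h2, h3, -⟩ := hg.exists_side hz
  have := h.arc_le hg hp hq h1 h2
  rw [arc_neg_of_lt (by linarith)] at this
  linarith

/-- Both points lie over one arc of `g`, where `σ_2` doubles lengths. A precritical chord separating
the images has an endpoint between them; this endpoint lifts into the open arc, off `g` because the
critical value is not precritical. The rest of its class lifts into the same arc, which gives a
precritical chord separating `z` and `w`. -/
lemma map_of_notMem (hg : IsCriticalClass r g) {z w : Circle} (h : Unseparated r g z w)
    (hz : z ∉ g) : Unseparated r g (sigma 2 z) (sigma 2 w) := by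
  intro u v huv hu hx
  obtain ⟨p, hp, q, hq, h1, h2, h3, -⟩ := hg.exists_side hz
  have hw := h.arc_le hg hp hq h1 h2
  have hw0 := arc_nonneg p w
  have main : ∀ {u v}, r u v → Precritical g u →
      Alternate (arc (sigma 2 p) u) (arc (sigma 2 p) v)
        (2 * arc p z) (2 * arc p w) →
      ((2 * arc p z < arc (sigma 2 p) u ∧ arc (sigma 2 p) u < 2 * arc p w) ∨
        (2 * arc p w < arc (sigma 2 p) u ∧ arc (sigma 2 p) u < 2 * arc p z)) →
      False := by
    intro u v huv hu halt hbtw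
    set μ := arc (sigma 2 p) u with hμ
    set u' := p * turn (μ / 2) with hu'
    have hμ0 : 0 < μ := by rcases hbtw with h | h <;> linarith
    have hμ1 : μ < 2 * arc p q := by rcases hbtw with h | h <;> linarith
    have hau' : arc p u' = μ / 2 := arc_eq_of_mul_turn (by linarith) (by linarith) rfl
    have hsu' : sigma 2 u' = u := by
      rw [hu', sigma_mul_turn, mul_div_cancel₀ _ two_ne_zero, hμ, mul_turn_arc]
    have hu'g : u' ∉ g := fun hmem => hg.not_precritical_sigma hmem (hsu' ▸ hu)
    rw [← hsu'] at huv hu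
    obtain ⟨v', huv', hv'⟩ := hg.inv.exists_rel_of_rel_sigma huv
    obtain ⟨hv0, hv1⟩ := hg.rel_side hp hq (by rw [hau']; linarith) (by rw [hau']; linarith)
      hu'g huv'
    have hav' : arc (sigma 2 p) v = 2 * arc p v' := by
      rw [← hv']; exact arc_sigma_of_lt (by linarith)
    rw [hav', show μ = 2 * arc p u' by rw [hau']; ring, alternate_double, ← cross_iff] at halt
    exact h u' v' huv' hu.of_sigma halt
  have halt : Alternate (arc (sigma 2 p) u) (arc (sigma 2 p) v)
      (2 * arc p z) (2 * arc p w) := by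
    have b1 := arc_nonneg (sigma 2 p) u
    have b2 := arc_lt_one (sigma 2 p) u
    have b3 := arc_nonneg (sigma 2 p) v
    have b4 := arc_lt_one (sigma 2 p) v
    -- Doubled lengths can be equal to `1`, so only the version with weak bounds applies.
    apply alternate_of_cross_lift (sigma 2 p)
    · rw [abs_le]; constructor <;> linarith
    · rw [abs_le]; constructor <;> linarith
    · rw [abs_le]; constructor <;> linarith
    · rw [abs_le]; constructor <;> linarith
    · simpa only [sigma_mul_turn_arc, mul_turn_arc] using hx
  have halt' := halt
  rw [alternate_iff] at halt'
  have hv := hg.precritical_of_rel huv hu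
  have m1 := main huv hu halt
  have m2 := main (r.symm huv) hv halt.swap_left
  grind

lemma map (hg : IsCriticalClass r g) {z w : Circle} (h : Unseparated r g z w) :
    Unseparated r g (sigma 2 z) (sigma 2 w) := by
  by_cases hz : z ∈ g
  · by_cases hw : w ∈ g
    -- Here the images share the class `σ_2(g)`, which is not precritical and so is not crossed by
    -- any precritical class.
    · intro u v huv hu hx
      refine hg.lam.not_cross huv (hg.inv.rel_sigma (hg.rel_of_mem hz hw)) ?_ hx
      exact fun hr => hg.not_precritical_sigma hz (hg.precritical_of_rel hr hu)
    · exact (map_of_notMem hg h.symm hw).symm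
  · exact map_of_notMem hg h hz

lemma iterate (hg : IsCriticalClass r g) {z w : Circle} (h : Unseparated r g z w) (n : ℕ) :
    Unseparated r g ((sigma 2)^[n] z) ((sigma 2)^[n] w) := by
  induction n generalizing z w with
  | zero => exact h
  | succ n ih => exact ih (h.map hg)

end Unseparated

/-! ### Leaves of pulled back laminations -/

/-- A class outside `g` lies in an open arc of `g` of length at most `1/2`, and a leaf crossing it
lies in the closed arc. The crossing therefore survives `σ_2`, until the class reaches `g`, which no
leaf crosses. -/
lemma IsPulledBack.unseparated (hg : IsCriticalClass r g) {M : Circle → Circle → Prop}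
    (hM : IsPulledBack g M) {x y : Circle} (h : M x y) : Unseparated r g x y := by
  rintro u v huv ⟨n, hn⟩
  induction n generalizing u v x y with
  | zero => exact hM.not_cross_vertices hn (hg.mem_of_rel hn huv) h
  | succ n ih =>
    by_cases hu : u ∈ g
    · exact hM.not_cross_vertices hu (hg.mem_of_rel hu huv) h
    intro hx
    obtain ⟨p, hp, q, hq, h1, h2, h3, -⟩ := hg.exists_side hu
    obtain ⟨h4, h5⟩ := hg.rel_side hp hq h1 h2 hu huv
    have hbd : arc p x ≤ arc p q ∧ arc p y ≤ arc p q := by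
      have hxc := hx
      rw [cross_iff p, alternate_iff] at hxc
      have c1 : 0 < arc p x → arc p x < arc p q → arc p y ≤ arc p q := fun a b =>
        arc_le_of_not_cross a b (hM.not_cross_vertices hp hq h)
      have c2 : 0 < arc p y → arc p y < arc p q → arc p x ≤ arc p q := fun a b =>
        arc_le_of_not_cross a b (hM.not_cross_vertices hp hq (hM.symm h))
      grind
    have b1 := arc_nonneg p x
    have b2 := arc_nonneg p y
    refine ih (hM.forward h) _ _ (hg.inv.rel_sigma huv) hn (hx.map (p := p) ?_ ?_ ?_ ?_) <;>
    · rw [abs_lt]; constructor <;> linarith [hbd.1, hbd.2]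

/-- Induction on the time needed to reach `g`. The image edge is a leaf, and a preimage leaf over it
together with its antipode is either `uv` with `(-u)(-v)`, or `u(-v)` with `(-u)v`. The second
choice would cross a chord between vertices of `g`. -/
lemma IsPulledBack.of_adjacent (hg : IsCriticalClass r g) {M : Circle → Circle → Prop}
    (hM : IsPulledBack g M) {u v : Circle} (h : Adjacent r u v) (hu : Precritical g u) : M u v := by
  obtain ⟨n, hn⟩ := hu
  induction n generalizing u v with
  | zero =>
    exact hM.edge hn (hg.mem_of_rel hn h.1) fun c hc d hd =>
      h.2 c d (hg.rel_of_mem hn hc) (hg.rel_of_mem hn hd)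
  | succ n ih =>
    by_cases hug : u ∈ g
    · exact hM.edge hug (hg.mem_of_rel hug h.1) fun c hc d hd =>
        h.2 c d (hg.rel_of_mem hug hc) (hg.rel_of_mem hug hd)
    by_cases huv : u = v
    · subst huv; exact hM.refl u
    obtain ⟨p, hp, q, hq, h1, h2, h3, -⟩ := hg.exists_side hug
    obtain ⟨h4, h5⟩ := hg.rel_side hp hq h1 h2 hug h.1
    have hne : sigma 2 u ≠ sigma 2 v := by
      intro he
      rcases sigma_eq_sigma.1 he with rfl | rfl
      · exact huv rfl
      · rw [arc_neg_of_lt (by linarith)] at h5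
        linarith
    obtain ⟨x, y, hx, hy, hxy, hxy'⟩ := hM.preimage (ih (hg.inv.adjacent_sigma h) hn) hne
    have hno : ¬ M u (-v) := by
      intro hm
      have := arc_le_of_not_cross h1 h2 (hM.not_cross_vertices hp hq hm)
      rw [arc_neg_of_lt (by linarith)] at this
      linarith
    rcases sigma_eq_sigma.1 hx with rfl | rfl <;> rcases sigma_eq_sigma.1 hy with rfl | rfl
    · exact hxy
    · exact absurd (by simpa using hxy) hno
    · exact absurd (by simpa using hxy') hno
    · exact hxy'

/-! ### Maximal unseparated sets -/

/-- The points `z` and `w` are strictly on opposite sides of `uv`; a point strictly opposite to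
neither must lie on the line. -/
lemma eq_or_eq_of_not_cross {u v z w a : Circle} (h : Cross u v z w) (h1 : ¬ Cross u v z a)
    (h2 : ¬ Cross u v w a) : a = u ∨ a = v := by
  have huv : u ≠ v := by rintro rfl; exact not_cross_self _ _ _ h
  by_contra! hc
  have h0 := orient_ne_zero huv hc.1 hc.2
  have h : orient u v z * orient u v w < 0 := h
  have h1 : 0 ≤ orient u v z * orient u v a := not_lt.1 h1
  have h2 : 0 ≤ orient u v w * orient u v a := not_lt.1 h2
  have h3 : 0 < orient u v a * orient u v a := mul_self_pos.2 h0
  nlinarith [mul_nonneg h1 h2]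

/-- Chords on different sides of a chord do not cross. -/
lemma not_cross_of_cross {u v z w a b c d : Circle} (h : Cross u v z w) (ha : ¬ Cross u v z a)
    (hb : ¬ Cross u v z b) (hc : ¬ Cross u v w c) (hd : ¬ Cross u v w d) : ¬ Cross a b c d := by
  intro hx
  rw [cross_iff u, alternate_iff] at *
  rw [arc_self] at *
  have := arc_nonneg u v
  have := arc_nonneg u z
  have := arc_nonneg u w
  have := arc_nonneg u a
  have := arc_nonneg u b
  have := arc_nonneg u c
  have := arc_nonneg u d
  grind

/-- Two distinct points that are not separated and do not lie in a common precritical class. -/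
structure Regular (r : Setoid Circle) (g : Set Circle) (x y : Circle) : Prop where
  ne : x ≠ y
  unseparated : Unseparated r g x y
  not_rel : ¬ (r x y ∧ Precritical g x)

/-- The set of points not separated from `x` and from `y`. -/
def cell (r : Setoid Circle) (g : Set Circle) (x y : Circle) : Set Circle :=
  {z | Unseparated r g z x ∧ Unseparated r g z y}

lemma unseparated_self (z : Circle) : Unseparated r g z z :=
  fun _ _ _ _ h => not_cross_self _ _ _ h.symm

namespace Regular

lemma symm (hg : IsCriticalClass r g) {x y : Circle} (h : Regular r g x y) : Regular r g y x :=
  ⟨h.ne.symm, h.unseparated.symm, fun h' =>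
    h.not_rel ⟨r.symm h'.1, hg.precritical_of_rel h'.1 h'.2⟩⟩

lemma left_mem {x y : Circle} (h : Regular r g x y) : x ∈ cell r g x y :=
  ⟨unseparated_self x, h.unseparated⟩

lemma right_mem {x y : Circle} (h : Regular r g x y) : y ∈ cell r g x y :=
  ⟨h.unseparated.symm, unseparated_self y⟩

/-- Points of a cell are not separated from each other. -/
lemma unseparated_of_mem (hg : IsCriticalClass r g) {x y z w : Circle} (h : Regular r g x y)
    (hz : z ∈ cell r g x y) (hw : w ∈ cell r g x y) : Unseparated r g z w := by
  intro u v huv hu hx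
  -- Neither `x` nor `y` is cut off from `z` or `w`, so both are endpoints of the separating chord
  -- and hence lie in a common precritical class.
  have h1 := eq_or_eq_of_not_cross hx (hz.1 u v huv hu) (hw.1 u v huv hu)
  have h2 := eq_or_eq_of_not_cross hx (hz.2 u v huv hu) (hw.2 u v huv hu)
  rcases h1 with rfl | rfl <;> rcases h2 with rfl | rfl
  · exact h.ne rfl
  · exact h.not_rel ⟨huv, hu⟩
  · exact h.not_rel ⟨r.symm huv, hg.precritical_of_rel huv hu⟩
  · exact h.ne rfl

lemma cell_eq (hg : IsCriticalClass r g) {x y x' y' : Circle} (h : Regular r g x y)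
    (h' : Regular r g x' y') (hx : x' ∈ cell r g x y) (hy : y' ∈ cell r g x y) :
    cell r g x y = cell r g x' y' := by
  apply Set.Subset.antisymm
  · exact fun z hz => ⟨h.unseparated_of_mem hg hz hx, h.unseparated_of_mem hg hz hy⟩
  · have hx' : x ∈ cell r g x' y' := ⟨hx.1.symm, hy.1.symm⟩
    have hy' : y ∈ cell r g x' y' := ⟨hx.2.symm, hy.2.symm⟩
    exact fun z hz => ⟨h'.unseparated_of_mem hg hz hx', h'.unseparated_of_mem hg hz hy'⟩

/-- Cells with crossing chords coincide. -/
lemma cell_eq_of_cross (hg : IsCriticalClass r g) {x y x' y' a b c d : Circle}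
    (h : Regular r g x y) (h' : Regular r g x' y') (ha : a ∈ cell r g x y)
    (hb : b ∈ cell r g x y) (hc : c ∈ cell r g x' y') (hd : d ∈ cell r g x' y')
    (hx : Cross a b c d) : cell r g x y = cell r g x' y' := by
  have key : ∀ z ∈ cell r g x y, ∀ w ∈ cell r g x' y', Unseparated r g z w := by
    intro z hz w hw u v huv hu hzw
    exact not_cross_of_cross hzw (h.unseparated_of_mem hg hz ha u v huv hu)
      (h.unseparated_of_mem hg hz hb u v huv hu) (h'.unseparated_of_mem hg hw hc u v huv hu)
      (h'.unseparated_of_mem hg hw hd u v huv hu) hx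
  refine h.cell_eq hg h' ⟨?_, ?_⟩ ⟨?_, ?_⟩
  · exact (key _ h.left_mem _ h'.left_mem).symm
  · exact (key _ h.right_mem _ h'.left_mem).symm
  · exact (key _ h.left_mem _ h'.right_mem).symm
  · exact (key _ h.right_mem _ h'.right_mem).symm

lemma not_mem_left_or (hg : IsCriticalClass r g) {x y : Circle} (h : Regular r g x y) :
    x ∉ g ∨ y ∉ g := by
  by_contra! hc
  exact h.not_rel ⟨hg.rel_of_mem hc.1 hc.2, precritical_of_mem hc.1⟩

/-- A cell lies in one closed complementary arc of the critical class. -/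
lemma exists_side (hg : IsCriticalClass r g) {x y : Circle} (h : Regular r g x y) :
    ∃ p ∈ g, ∃ q ∈ g, (∀ u ∈ g, u ≠ p → arc p q ≤ arc p u) ∧
      ∀ z ∈ cell r g x y, arc p z ≤ arc p q ∧ arc p z ≤ 1 / 2 := by
  rcases h.not_mem_left_or hg with hx | hx
  · obtain ⟨p, hp, q, hq, h1, h2, h3, h4⟩ := hg.exists_side hx
    have key : ∀ z ∈ cell r g x y, arc p z ≤ arc p q :=
      fun z hz => hz.1.symm.arc_le hg hp hq h1 h2
    exact ⟨p, hp, q, hq, h4, fun z hz => ⟨key z hz, (key z hz).trans h3⟩⟩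
  · obtain ⟨p, hp, q, hq, h1, h2, h3, h4⟩ := hg.exists_side hx
    have key : ∀ z ∈ cell r g x y, arc p z ≤ arc p q :=
      fun z hz => hz.2.symm.arc_le hg hp hq h1 h2
    exact ⟨p, hp, q, hq, h4, fun z hz => ⟨key z hz, (key z hz).trans h3⟩⟩

/-- Points with equal images are antipodal, and unseparated antipodal points lie in `g`. A
precritical class containing both images lifts inside the arc of `g` over which the two points lie,
so it would already join them. -/
lemma map (hg : IsCriticalClass r g) {x y : Circle} (h : Regular r g x y) :
    Regular r g (sigma 2 x) (sigma 2 y) := by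
  refine ⟨fun he => ?_, h.unseparated.map hg, fun ⟨hr, hpre⟩ => ?_⟩
  · rcases sigma_eq_sigma.1 he with rfl | rfl
    · exact h.ne rfl
    · have hx := h.unseparated.mem_of_neg hg
      exact h.not_rel ⟨hg.rel_of_mem hx (hg.neg x hx), precritical_of_mem hx⟩
  · have hx : x ∉ g := fun hx => hg.not_precritical_sigma hx hpre
    obtain ⟨p, hp, q, hq, h1, h2, h3, -⟩ := hg.exists_side hx
    obtain ⟨y', hy', hs⟩ := hg.inv.exists_rel_of_rel_sigma hr
    have hle := h.unseparated.arc_le hg hp hq h1 h2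
    rcases sigma_eq_sigma.1 hs with rfl | rfl
    · exact h.not_rel ⟨hy', hpre.of_sigma⟩
    · have := hg.rel_side hp hq h1 h2 hx hy'
      rw [arc_neg_of_lt (by linarith)] at hle
      linarith

lemma iterate (hg : IsCriticalClass r g) {x y : Circle} (h : Regular r g x y) (n : ℕ) :
    Regular r g ((sigma 2)^[n] x) ((sigma 2)^[n] y) := by
  induction n generalizing x y with
  | zero => exact h
  | succ n ih => exact ih (h.map hg)

end Regular

lemma iterate_mem_cell (hg : IsCriticalClass r g) {x y z : Circle} (h : z ∈ cell r g x y) (n : ℕ) :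
    (sigma 2)^[n] z ∈ cell r g ((sigma 2)^[n] x) ((sigma 2)^[n] y) :=
  ⟨h.1.iterate hg n, h.2.iterate hg n⟩

/-! ### Limits of precritical edges -/

/-- `u`, `v` are the extreme points of a precritical class inside the arc from `x` to `y`. -/
structure Spans (r : Setoid Circle) (g : Set Circle) (x y u v : Circle) : Prop where
  rel : r u v
  pre : Precritical g u
  left_le : ∀ w, r u w → arc x u ≤ arc x w
  le_right : ∀ w, r u w → arc x w ≤ arc x v
  right_le : arc x v ≤ arc x y

lemma Spans.adjacent {x y u v : Circle} (h : Spans r g x y u v) : Adjacent r u v := by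
  refine ⟨h.rel, fun c d hc hd hx => ?_⟩
  rw [cross_iff x, alternate_iff] at hx
  have h1 := h.left_le c hc
  have h2 := h.left_le d hd
  have h3 := h.le_right c hc
  have h4 := h.le_right d hd
  grind

/-- Distinct classes do not cross, so spans are nested or have disjoint interiors. -/
lemma Spans.nested (hg : IsCriticalClass r g) {x y u v u' v' : Circle} (h : Spans r g x y u v)
    (h' : Spans r g x y u' v') (h1 : arc x u ≤ arc x u') (h2 : arc x u' < arc x v) :
    arc x v' ≤ arc x v := by
  by_cases hr : r u u'
  · exact h.le_right v' (r.trans hr h'.rel)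
  by_contra! hlt
  have h1 : arc x u < arc x u' := lt_of_le_of_ne h1 fun he => hr (by rw [arc_inj] at he; rw [he])
  refine hg.lam.not_cross h.rel h'.rel hr ?_
  rw [cross_iff x, alternate_iff]
  exact Or.inl ⟨h1, h2, hlt⟩

/-- A point outside the cell is cut off from `x` or `y` by a precritical chord. This chord does not
separate `x` from `y`, so it straddles `z` within the arc, and the extreme points of its class give
the span. -/
lemma Regular.exists_spans (hg : IsCriticalClass r g) {x y z : Circle} (h : Regular r g x y)
    (h0 : 0 < arc x z) (h1 : arc x z < arc x y) (hz : z ∉ cell r g x y) :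
    ∃ u v, Spans r g x y u v ∧ arc x u < arc x z ∧ arc x z < arc x v := by
  obtain ⟨u, v, huv, hu, hlu, hlv, hle⟩ : ∃ u v, r u v ∧ Precritical g u ∧ arc x u < arc x z ∧
      arc x z < arc x v ∧ arc x v ≤ arc x y := by
    have key : ∃ u v, r u v ∧ Precritical g u ∧ (Cross u v z x ∨ Cross u v z y) := by
      by_contra! hc
      exact hz ⟨fun u v huv hu => (hc u v huv hu).1, fun u v huv hu => (hc u v huv hu).2⟩
    obtain ⟨u, v, huv, hu, hx⟩ := key
    have hxy := h.unseparated u v huv hu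
    rw [cross_iff x, alternate_iff, arc_self] at hxy
    rw [cross_iff x, cross_iff x, alternate_iff, alternate_iff, arc_self] at hx
    have b1 := arc_nonneg x u
    have b2 := arc_nonneg x v
    have : (arc x u < arc x z ∧ arc x z < arc x v ∧ arc x v ≤ arc x y) ∨
        (arc x v < arc x z ∧ arc x z < arc x u ∧ arc x u ≤ arc x y) := by grind
    rcases this with hh | hh
    · exact ⟨u, v, huv, hu, hh⟩
    · exact ⟨v, u, r.symm huv, hg.precritical_of_rel huv hu, hh⟩
  obtain ⟨k, hk, huk⟩ := exists_class r u
  have hkfin := hg.lam.finite_classes k hk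
  obtain ⟨u', hu', hmin⟩ := Set.exists_min_image k (fun w => arc x w) hkfin ⟨u, huk⟩
  obtain ⟨v', hv', hmax⟩ := Set.exists_max_image k (fun w => arc x w) hkfin ⟨u, huk⟩
  have hvk := (mem_class_iff hk huk).2 huv
  have huu' := (mem_class_iff hk huk).1 hu'
  have huv' := (mem_class_iff hk huk).1 hv'
  refine ⟨u', v', ⟨r.trans (r.symm huu') huv', hg.precritical_of_rel huu' hu, ?_, ?_, ?_⟩,
    (hmin u huk).trans_lt hlu, hlv.trans_le (hmax v hvk)⟩
  · exact fun w hw => hmin w ((mem_class_iff hk hu').2 hw)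
  · exact fun w hw => hmax w ((mem_class_iff hk hu').2 hw)
  -- A class reaching beyond `y` would separate `x` from `y`: through `u` if `u ≠ x`, and through
  -- `v` if `u = x`, since then `v = y` is excluded by regularity.
  · by_contra! hlt
    rcases (arc_nonneg x u).lt_or_eq with hpos | hzero
    · refine h.unseparated u v' huv' hu ?_
      rw [cross_iff x, alternate_iff, arc_self]
      exact Or.inr (Or.inr (Or.inr (Or.inr (Or.inr (Or.inl ⟨hpos, hlu.trans h1, hlt⟩)))))
    · have hux : u = x := arc_eq_zero.1 hzero.symm
      have hvy : arc x v < arc x y := lt_of_le_of_ne hle fun he => by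
        rw [arc_inj] at he
        rw [hux, he] at huv
        exact h.not_rel ⟨huv, hux ▸ hu⟩
      refine h.unseparated v v' (r.trans (r.symm huv) huv') (hg.precritical_of_rel huv hu) ?_
      rw [cross_iff x, alternate_iff, arc_self]
      exact Or.inr (Or.inr (Or.inr (Or.inr (Or.inr (Or.inl ⟨h0.trans hlv, hvy, hlt⟩)))))

/-- The points of the cell of `x, y` in the open arc from `x` to `y`. -/
def innerCell (r : Setoid Circle) (g : Set Circle) (x y : Circle) : Set Circle :=
  {z | z ∈ cell r g x y ∧ 0 < arc x z ∧ arc x z < arc x y}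

lemma arc_mul_turn (x : Circle) {t : ℝ} (h0 : 0 ≤ t) (h1 : t < 1) : arc x (x * turn t) = t :=
  arc_eq_of_mul_turn h0 h1 rfl

/-- The spans over the midpoint of the arc form a nested family. Its left ends come arbitrarily
close to `x` and its right ends to `y`, and by nesting a single span does both. -/
lemma Regular.exists_spans_of_innerCell_eq_empty (hg : IsCriticalClass r g) {x y : Circle}
    (h : Regular r g x y) (he : innerCell r g x y = ∅) {ε : ℝ} (hε : 0 < ε) :
    ∃ u v, Spans r g x y u v ∧ arc x u < ε ∧ arc x y - ε < arc x v := by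
  set β := arc x y with hβ
  have hβ0 : 0 < β := arc_pos.2 h.ne.symm
  have hβ1 : β < 1 := arc_lt_one x y
  have cover : ∀ t, 0 < t → t < β → ∃ u v, Spans r g x y u v ∧ arc x u < t ∧ t < arc x v := by
    intro t h0 h1
    have ht := arc_mul_turn x h0.le (h1.trans hβ1)
    obtain ⟨u, v, huv, h2, h3⟩ := h.exists_spans hg (z := x * turn t) (by rwa [ht])
      (by rwa [ht]) fun hz => by
        have : x * turn t ∈ innerCell r g x y := ⟨hz, by rwa [ht], by rwa [ht]⟩
        rw [he] at this
        exact this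
    rw [ht] at h2 h3
    exact ⟨u, v, huv, h2, h3⟩
  have left : ∃ u v, Spans r g x y u v ∧ arc x u < β / 2 ∧ β / 2 < arc x v ∧ arc x u < ε := by
    by_contra! hc
    set S := {t | ∃ u v, Spans r g x y u v ∧ arc x u < β / 2 ∧ β / 2 < arc x v ∧ t = arc x u}
      with hS
    obtain ⟨u0, v0, hs0, hu0, hv0⟩ := cover (β / 2) (by linarith) (by linarith)
    have hne : S.Nonempty := ⟨_, u0, v0, hs0, hu0, hv0, rfl⟩
    have hlow : ∀ t ∈ S, ε ≤ t := by
      rintro t ⟨u, v, hs, hu, hv, rfl⟩; exact hc u v hs hu hv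
    have hbdd : BddBelow S := ⟨ε, hlow⟩
    have h1 : ε ≤ sInf S := le_csInf hne hlow
    have h2 : sInf S ≤ arc x u0 := csInf_le hbdd ⟨u0, v0, hs0, hu0, hv0, rfl⟩
    -- If the infimum of the left ends were positive, a span would straddle it. By nesting this span
    -- swallows a member of the family, hence also the midpoint, although its left end is below the
    -- infimum.
    obtain ⟨u1, v1, hs1, hu1, hv1⟩ := cover (sInf S) (by linarith) (by linarith)
    obtain ⟨_, ⟨u, v, hs, hu, hv, rfl⟩, hlt⟩ := exists_lt_of_csInf_lt hne hv1
    have h3 : sInf S ≤ arc x u := csInf_le hbdd ⟨u, v, hs, hu, hv, rfl⟩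
    have h4 := hs1.nested hg hs (by linarith) hlt
    have h5 : sInf S ≤ arc x u1 := csInf_le hbdd ⟨u1, v1, hs1, by linarith, by linarith, rfl⟩
    linarith
  have right : ∃ u v, Spans r g x y u v ∧ arc x u < β / 2 ∧ β / 2 < arc x v ∧
      β - ε < arc x v := by
    by_contra! hc
    set S := {t | ∃ u v, Spans r g x y u v ∧ arc x u < β / 2 ∧ β / 2 < arc x v ∧ t = arc x v}
      with hS
    obtain ⟨u0, v0, hs0, hu0, hv0⟩ := cover (β / 2) (by linarith) (by linarith)
    have hne : S.Nonempty := ⟨_, u0, v0, hs0, hu0, hv0, rfl⟩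
    have hup : ∀ t ∈ S, t ≤ β - ε := by
      rintro t ⟨u, v, hs, hu, hv, rfl⟩; exact hc u v hs hu hv
    have hbdd : BddAbove S := ⟨β - ε, hup⟩
    have h1 : sSup S ≤ β - ε := csSup_le hne hup
    have h2 : arc x v0 ≤ sSup S := le_csSup hbdd ⟨u0, v0, hs0, hu0, hv0, rfl⟩
    obtain ⟨u1, v1, hs1, hu1, hv1⟩ := cover (sSup S) (by linarith) (by linarith)
    obtain ⟨_, ⟨u, v, hs, hu, hv, rfl⟩, hlt⟩ := exists_lt_of_lt_csSup hne hu1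
    have h3 : arc x v ≤ sSup S := le_csSup hbdd ⟨u, v, hs, hu, hv, rfl⟩
    have h4 : arc x u1 < arc x u := by
      by_contra! hle
      have := hs.nested hg hs1 hle hlt
      linarith
    have h5 : arc x v1 ≤ sSup S := le_csSup hbdd ⟨u1, v1, hs1, by linarith, by linarith, rfl⟩
    linarith
  obtain ⟨u1, v1, hs1, hu1, hv1, h1⟩ := left
  obtain ⟨u2, v2, hs2, hu2, hv2, h2⟩ := right
  rcases le_total (arc x u1) (arc x u2) with hle | hle
  · exact ⟨u1, v1, hs1, h1, h2.trans_le (hs1.nested hg hs2 hle (by linarith))⟩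
  · exact ⟨u2, v2, hs2, hle.trans_lt h1, h2⟩

/-- The sides of a cell are limits of edges of precritical classes. -/
lemma Regular.mem_closure_of_innerCell_eq_empty (hg : IsCriticalClass r g) {x y : Circle}
    (h : Regular r g x y) (he : innerCell r g x y = ∅) :
    (x, y) ∈ closure {p : Circle × Circle | Adjacent r p.1 p.2 ∧ Precritical g p.1} := by
  choose u v hs hu hv using fun n : ℕ =>
    h.exists_spans_of_innerCell_eq_empty hg he (Nat.one_div_pos_of_nat (n := n) (α := ℝ))
  have hz := tendsto_one_div_add_atTop_nhds_zero_nat (𝕜 := ℝ)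
  have hu' : Tendsto (fun n => arc x (u n)) atTop (𝓝 0) :=
    squeeze_zero (fun n => arc_nonneg _ _) (fun n => (hu n).le) hz
  have hv' : Tendsto (fun n => arc x (v n)) atTop (𝓝 (arc x y)) := by
    refine tendsto_of_tendsto_of_tendsto_of_le_of_le ?_ tendsto_const_nhds
      (fun n => (hv n).le) (fun n => (hs n).right_le)
    simpa using (tendsto_const_nhds (x := arc x y)).sub hz
  have key : ∀ {w : ℕ → Circle} {t : ℝ}, Tendsto (fun n => arc x (w n)) atTop (𝓝 t) →
      Tendsto w atTop (𝓝 (x * turn t)) := by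
    intro w t hw
    have := ((continuous_turn.tendsto t).comp hw).const_mul x
    refine this.congr fun n => ?_
    exact mul_turn_arc x (w n)
  have h1 := key hu'
  have h2 := key hv'
  rw [turn_zero, mul_one] at h1
  rw [mul_turn_arc] at h2
  exact mem_closure_of_tendsto (h1.prodMk_nhds h2)
    (Eventually.of_forall fun n => ⟨(hs n).adjacent, (hs n).pre⟩)

/-- Precritical edges are forced leaves, and a pulled back relation is closed. -/
lemma IsPulledBack.of_innerCell_eq_empty (hg : IsCriticalClass r g) {M : Circle → Circle → Prop}
    (hM : IsPulledBack g M) {x y : Circle} (h : Regular r g x y) (he : innerCell r g x y = ∅) :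
    M x y :=
  closure_minimal (fun _ hp => hM.of_adjacent hg hp.1 hp.2) hM.isClosed
    (h.mem_closure_of_innerCell_eq_empty hg he)

lemma Regular.rel_of_innerCell_eq_empty (hg : IsCriticalClass r g) {x y : Circle}
    (h : Regular r g x y) (he : innerCell r g x y = ∅) : r x y :=
  closure_minimal (t := {p : Circle × Circle | r p.1 p.2}) (fun _ hp => hp.1.1)
    hg.lam.isClosed_graph (h.mem_closure_of_innerCell_eq_empty hg he)

/-- Induction on the number of inner points: such a point `t` splits the chord into two with fewer
inner points. With none left, the chord is a limit of precritical edges, and the graph of `r` is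
closed. -/
lemma Unseparated.rel_of_finite (hg : IsCriticalClass r g) {x y : Circle}
    (h : Unseparated r g x y) (hfin : (innerCell r g x y).Finite) : r x y := by
  induction hn : (innerCell r g x y).ncard using Nat.strong_induction_on generalizing x y with
  | _ n ih =>
  by_contra hxy
  have hne : x ≠ y := by rintro rfl; exact hxy (r.refl x)
  have hreg : Regular r g x y := ⟨hne, h, fun h => hxy h.1⟩
  by_cases he : innerCell r g x y = ∅
  · exact hxy (hreg.rel_of_innerCell_eq_empty hg he)
  obtain ⟨t, ht, ht0, ht1⟩ := Set.nonempty_iff_ne_empty.2 he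
  have main : ∀ {a b}, Unseparated r g a b → (a ≠ b) → (¬ r a b → innerCell r g a b ⊆
      innerCell r g x y \ {t}) → r a b := by
    intro a b hab hne hsub
    by_contra hr
    have hss := hsub hr
    refine hr (ih _ ?_ hab (hfin.subset (hss.trans Set.sdiff_subset)) rfl)
    rw [← hn]
    exact (Set.ncard_le_ncard hss (hfin.subset Set.sdiff_subset)).trans_lt
      (Set.ncard_sdiff_singleton_lt_of_mem ⟨ht, ht0, ht1⟩ hfin)
  have htx : t ≠ x := arc_pos.1 ht0
  have hty : t ≠ y := by rintro rfl; exact ht1.false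
  have h1 : r x t := main ht.1.symm htx.symm fun hr z ⟨hz, hz0, hz1⟩ => by
    have hreg' : Regular r g x t := ⟨htx.symm, ht.1.symm, fun h => hr h.1⟩
    refine ⟨⟨⟨hz.1, ?_⟩, hz0, hz1.trans ht1⟩, ?_⟩
    · exact hreg'.unseparated_of_mem hg hz ⟨h.symm, ht.2.symm⟩
    · rintro rfl; exact hz1.false
  have h2 : r t y := main ht.2 hty fun hr z ⟨hz, hz0, hz1⟩ => by
    have hreg' : Regular r g t y := ⟨hty, ht.2, fun h => hr h.1⟩
    have hle : arc x t ≤ arc x z := by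
      by_contra! hlt
      rw [arc_base_of_lt hlt, arc_base_of_le ht1.le] at hz1
      linarith [arc_nonneg x z, arc_lt_one x y]
    rw [arc_base_of_le hle] at hz0 hz1
    rw [arc_base_of_le ht1.le] at hz1
    refine ⟨⟨⟨?_, hz.2⟩, by linarith, by linarith⟩, ?_⟩
    · exact hreg'.unseparated_of_mem hg hz ⟨ht.1.symm, h⟩
    · rintro rfl; linarith
  exact hxy (r.trans h1 h2)

/-! ### Colliding orbits -/

/-- Just before two orbits merge the points are antipodal, and unseparated antipodal points lie in
`g`. -/
lemma Unseparated.exists_collision (hg : IsCriticalClass r g) {x t : Circle}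
    (h : Unseparated r g x t) (hne : t ≠ x) {n : ℕ} (hn : (sigma 2)^[n] t = (sigma 2)^[n] x) :
    ∃ m, (sigma 2)^[m] x ∈ g ∧ (sigma 2)^[m] t = -(sigma 2)^[m] x := by
  induction n generalizing x t with
  | zero => exact absurd hn hne
  | succ n ih =>
    by_cases he : sigma 2 t = sigma 2 x
    · rcases sigma_eq_sigma.1 he.symm with rfl | rfl
      · exact absurd rfl hne
      · exact ⟨0, h.mem_of_neg hg, rfl⟩
    · obtain ⟨m, h1, h2⟩ := ih (h.map hg) he hn
      exact ⟨m + 1, h1, h2⟩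

lemma finite_iterate_preimage (n : ℕ) (w : Circle) : {t | (sigma 2)^[n] t = w}.Finite := by
  induction n with
  | zero => simp
  | succ n ih =>
    refine Set.Finite.preimage' ih fun b _ => ?_
    obtain ⟨u, rfl⟩ := sigma_surjective b
    refine (Set.toFinite {u, -u}).subset fun t ht => ?_
    rcases sigma_eq_sigma.1 (Eq.symm ht) with rfl | rfl <;> simp

/-- The orbit of `x` visits `g` at most once. A colliding point must be antipodal to it at that
time, which leaves finitely many preimages. -/
lemma finite_collisions (hg : IsCriticalClass r g) (x : Circle) :
    {t | t ≠ x ∧ Unseparated r g x t ∧ ∃ n, (sigma 2)^[n] t = (sigma 2)^[n] x}.Finite := by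
  by_cases hx : Precritical g x
  · obtain ⟨m, hm⟩ := hx
    refine (finite_iterate_preimage m (-(sigma 2)^[m] x)).subset ?_
    rintro t ⟨hne, h, n, hn⟩
    obtain ⟨k, hk, hkt⟩ := h.exists_collision hg hne hn
    obtain rfl := hg.iterate_mem_unique hm hk
    exact hkt
  · convert Set.finite_empty
    refine Set.eq_empty_of_forall_notMem ?_
    rintro t ⟨hne, h, n, hn⟩
    obtain ⟨k, hk, -⟩ := h.exists_collision hg hne hn
    exact hx ⟨k, hk⟩

/-- If there are finitely many inner points, `x` and `y` are equivalent, so they are not precritical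
and nothing collides with them. Otherwise only finitely many inner points have to be avoided. -/
lemma Regular.exists_mem_innerCell (hg : IsCriticalClass r g) {x y : Circle}
    (h : Regular r g x y) (hne : (innerCell r g x y).Nonempty) :
    ∃ t ∈ innerCell r g x y, ∀ n, (sigma 2)^[n] t ≠ (sigma 2)^[n] x ∧
      (sigma 2)^[n] t ≠ (sigma 2)^[n] y := by
  by_cases hfin : (innerCell r g x y).Finite
  · have hr := h.unseparated.rel_of_finite hg hfin
    have hx : ¬ Precritical g x := fun hx => h.not_rel ⟨hr, hx⟩
    have hy : ¬ Precritical g y := fun hy => hx (hg.precritical_of_rel (r.symm hr) hy)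
    obtain ⟨t, ht⟩ := hne
    refine ⟨t, ht, fun n => ⟨fun hn => ?_, fun hn => ?_⟩⟩
    · obtain ⟨m, hm, -⟩ := ht.1.1.symm.exists_collision hg (arc_pos.1 ht.2.1) hn
      exact hx ⟨m, hm⟩
    · obtain ⟨m, hm, -⟩ := ht.1.2.symm.exists_collision hg
        (fun he => by have := ht.2.2; rw [he] at this; exact this.false) hn
      exact hy ⟨m, hm⟩
  · obtain ⟨t, ht, hbad⟩ := (Set.Infinite.sdiff (Set.not_finite.1 hfin)
      ((finite_collisions hg x).union (finite_collisions hg y))).nonempty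
    refine ⟨t, ht, fun n => ⟨fun hn => hbad (Or.inl ?_), fun hn => hbad (Or.inr ?_)⟩⟩
    · exact ⟨arc_pos.1 ht.2.1, ht.1.1.symm, n, hn⟩
    · exact ⟨fun he => by have := ht.2.2; rw [he] at this; exact this.false, ht.1.2.symm, n, hn⟩

/-! ### Diagonals of cells -/

/-- The points `t`, `t'` of the cell of `x, y` stay on different sides of the chord `xy` under
iteration of `σ_2`. -/
structure IsDiagonal (r : Setoid Circle) (g : Set Circle) (x y t t' : Circle) : Prop where
  regular : Regular r g x y
  mem : t ∈ cell r g x y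
  mem' : t' ∈ cell r g x y
  cross : ∀ n, Cross ((sigma 2)^[n] x) ((sigma 2)^[n] y) ((sigma 2)^[n] t) ((sigma 2)^[n] t')

/-- Within a closed half circle a doubled difference reaches a full turn only for the two antipodal
ends, which have the same image. -/
lemma abs_lt_of_sigma_ne {p a b : Circle} (ha : arc p a ≤ 1 / 2) (hb : arc p b ≤ 1 / 2)
    (h : sigma 2 a ≠ sigma 2 b) : |2 * arc p a - 2 * arc p b| < 1 := by
  have h1 := arc_nonneg p a
  have h2 := arc_nonneg p b
  refine lt_of_le_of_ne (abs_le.2 ⟨by linarith, by linarith⟩) fun he => h ?_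
  rw [← sigma_mul_turn_arc p a, ← sigma_mul_turn_arc p b]
  congr 1
  rw [turn_eq_turn]
  rcases eq_or_eq_neg_of_abs_eq he with he | he
  · exact ⟨1, by push_cast; linarith⟩
  · exact ⟨-1, by push_cast; linarith⟩

/-- Every iterate of the cell lies in a closed half circle, where crossings persist unless endpoints
collide; the two inner points are chosen never to collide with `x` or `y`. -/
lemma Regular.exists_isDiagonal (hg : IsCriticalClass r g) {x y : Circle} (h : Regular r g x y)
    (h1 : (innerCell r g x y).Nonempty) (h2 : (innerCell r g y x).Nonempty) :
    ∃ t t', IsDiagonal r g x y t t' := by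
  obtain ⟨t, ht, hmt⟩ := h.exists_mem_innerCell hg h1
  obtain ⟨t', ht', hmt'⟩ := (h.symm hg).exists_mem_innerCell hg h2
  refine ⟨t, t', h, ht.1, ⟨ht'.1.2, ht'.1.1⟩, fun n => ?_⟩
  have hx0 : Cross x y t t' := by
    rw [cross_iff x, alternate_iff, arc_self]
    refine Or.inl ⟨ht.2.1, ht.2.2, ?_⟩
    have h3 := ht'.2.2
    have h4 := ht'.2.1
    by_contra! hle
    rcases hle.lt_or_eq with hlt | heq
    · rw [arc_base_of_lt hlt, arc_swap h.ne] at h3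
      linarith [arc_nonneg x t']
    · rw [arc_inj] at heq
      rw [heq, arc_self] at h4
      exact h4.false
  induction n with
  | zero => exact hx0
  | succ n ih =>
    obtain ⟨p, hp, q, hq, -, hside⟩ := (h.iterate hg n).exists_side hg
    have m1 := (hside _ (iterate_mem_cell hg h.left_mem n)).2
    have m2 := (hside _ (iterate_mem_cell hg h.right_mem n)).2
    have m3 := (hside _ (iterate_mem_cell hg ht.1 n)).2
    have m4 := (hside _ (iterate_mem_cell hg (x := x) (y := y) ⟨ht'.1.2, ht'.1.1⟩ n)).2
    have e := Function.iterate_succ_apply' (sigma 2) n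
    simp only [e]
    refine ih.map (p := p) ?_ ?_ ?_ ?_ <;> apply abs_lt_of_sigma_ne <;> try assumption
    · rw [← e, ← e]; exact (hmt _).1
    · rw [← e, ← e]; exact (hmt _).2
    · rw [← e, ← e]; exact (hmt' _).2
    · rw [← e, ← e]; exact (hmt' _).1

lemma IsDiagonal.iterate (hg : IsCriticalClass r g) {x y t t' : Circle}
    (h : IsDiagonal r g x y t t') (n : ℕ) :
    IsDiagonal r g ((sigma 2)^[n] x) ((sigma 2)^[n] y) ((sigma 2)^[n] t) ((sigma 2)^[n] t') where
  regular := h.regular.iterate hg n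
  mem := iterate_mem_cell hg h.mem n
  mem' := iterate_mem_cell hg h.mem' n
  cross := fun m => by simpa only [← Function.iterate_add_apply] using h.cross (m + n)

end

/-! ### Lengths of chords -/

/-- The length, in turns, of the shorter arc between two points. -/
def chordLen (a b : Circle) : ℝ := min (arc a b) (arc b a)

lemma chordLen_comm (a b : Circle) : chordLen a b = chordLen b a := min_comm _ _

lemma chordLen_eq (p a b : Circle) :
    chordLen a b = min |arc p a - arc p b| (1 - |arc p a - arc p b|) := by
  rcases lt_trichotomy (arc p a) (arc p b) with h | h | h
  · rw [chordLen, arc_base_of_le h.le, arc_base_of_lt h, abs_of_neg (by linarith)]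
    congr 1 <;> ring
  · rw [arc_inj] at h
    subst h
    simp [chordLen, arc_self]
  · rw [chordLen, arc_base_of_le h.le, arc_base_of_lt h, abs_of_pos (by linarith), min_comm]
    congr 1; ring

lemma chordLen_le_abs (p a b : Circle) : chordLen a b ≤ |arc p a - arc p b| := by
  rw [chordLen_eq p]; exact min_le_left _ _

lemma chordLen_pos {a b : Circle} (h : a ≠ b) : 0 < chordLen a b :=
  lt_min (arc_pos.2 h.symm) (arc_pos.2 h)

/-- Lengths evolve by a tent map: short chords double, and long ones give short images. -/
lemma chordLen_sigma (a b : Circle) :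
    chordLen (sigma 2 a) (sigma 2 b) = min (2 * chordLen a b) (1 - 2 * chordLen a b) := by
  by_cases hab : a = b
  · subst hab; simp [chordLen, arc_self]
  rw [chordLen, chordLen, arc_swap hab]
  rcases lt_or_ge (arc a b) (1 / 2) with h | h
  · have h1 : 1 / 2 ≤ arc b a := by rw [arc_swap hab]; linarith
    rw [arc_sigma_of_lt h, arc_sigma_of_le h1, arc_swap hab, min_eq_left (a := arc a b) (by linarith)]
    congr 1; ring
  · rw [min_eq_right (a := arc a b) (by linarith)]
    have e1 := arc_sigma_of_le h
    rcases h.lt_or_eq with h | h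
    · have h1 : arc b a < 1 / 2 := by rw [arc_swap hab]; linarith
      rw [e1, arc_sigma_of_lt h1, arc_swap hab, min_comm]
      congr 1; ring
    · have h1 : 1 / 2 ≤ arc b a := by rw [arc_swap hab]; linarith
      rw [e1, arc_sigma_of_le h1, arc_swap hab, ← h]
      norm_num

/-- A triangle with a side longer than `d` that crosses neither a chord of length `d` nor its
antipode lies in the strip between them, and has a short side. -/
lemma chordLen_le_of_strip {a b p q w : Circle} (hd : 1 / 3 < chordLen a b)
    (hlt : chordLen a b < chordLen p q)
    (h1 : ¬ Cross a b p q) (h2 : ¬ Cross a b p w) (h3 : ¬ Cross a b q w)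
    (h4 : ¬ Cross (-a) (-b) p q) (h5 : ¬ Cross (-a) (-b) p w) (h6 : ¬ Cross (-a) (-b) q w) :
    chordLen p w ≤ 1 / 2 - chordLen a b ∨ chordLen q w ≤ 1 / 2 - chordLen a b := by
  wlog hab : arc a b ≤ arc b a generalizing a b
  · have key := this (a := b) (b := a) (by rwa [chordLen_comm]) (by rwa [chordLen_comm])
      (fun h => h1 h.swap_left) (fun h => h2 h.swap_left) (fun h => h3 h.swap_left)
      (fun h => h4 h.swap_left) (fun h => h5 h.swap_left) (fun h => h6 h.swap_left) (by linarith)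
    rwa [chordLen_comm b a] at key
  have hne : a ≠ b := by
    rintro rfl
    rw [chordLen, arc_self] at hd
    norm_num at hd
  have hcd : chordLen a b = arc a b := min_eq_left hab
  have hd2 : arc a b ≤ 1 / 2 := by rw [arc_swap hne] at hab; linarith
  rw [hcd] at hd hlt ⊢
  rcases hd2.lt_or_eq with hd2 | hd2
  swap
  · rw [chordLen_eq a p q] at hlt
    have := min_le_left |arc a p - arc a q| (1 - |arc a p - arc a q|)
    have := min_le_right |arc a p - arc a q| (1 - |arc a p - arc a q|)
    linarith
  have eb : arc a (-b) = arc a b + 1 / 2 := arc_neg_of_lt hd2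
  rw [cross_iff a, alternate_iff, arc_self] at h1 h2 h3
  rw [cross_iff a, alternate_iff, arc_neg_self, eb] at h4 h5 h6
  rw [chordLen_eq a p q] at hlt
  rw [chordLen_eq a p w, chordLen_eq a q w]
  have hp0 := arc_nonneg a p
  have hp1 := arc_lt_one a p
  have hq0 := arc_nonneg a q
  have hq1 := arc_lt_one a q
  have hw0 := arc_nonneg a w
  have hw1 := arc_lt_one a w
  generalize arc a p = π' at *
  generalize arc a q = κ at *
  generalize arc a w = ω at *
  generalize arc a b = d at *
  clear eb hcd hab hne
  have hl1 : d < |π' - κ| := hlt.trans_le (min_le_left _ _)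
  have hl2 : |π' - κ| < 1 - d := by linarith [hlt.trans_le (min_le_right _ _)]
  rw [lt_abs] at hl1
  rw [abs_lt] at hl2
  -- An endpoint strictly inside an arc cut off by the chord or its antipode would trap the long
  -- side `pq` in that arc, whose length is only `d`.
  have P1 : ¬ (0 < π' ∧ π' < d) := by grind
  have P2 : ¬ (1 / 2 < π' ∧ π' < d + 1 / 2) := by grind
  have K1 : ¬ (0 < κ ∧ κ < d) := by grind
  have K2 : ¬ (1 / 2 < κ ∧ κ < d + 1 / 2) := by grind
  have W1 : ¬ (0 < ω ∧ ω < d) := by grind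
  have W2 : ¬ (1 / 2 < ω ∧ ω < d + 1 / 2) := by grind
  have key : ∀ ξ : ℝ, |ξ - ω| ≤ 1 / 2 - d ∨ 1 - |ξ - ω| ≤ 1 / 2 - d →
      min |ξ - ω| (1 - |ξ - ω|) ≤ 1 / 2 - d := fun ξ h => min_le_iff.2 h
  -- The vertices lie in the two end arcs of the strip, each of length `1/2 - d`. As `d > 1/3`, the
  -- ends of `pq` are in different arcs, and `w` shares an arc with one of them.
  have zone : ∀ ξ : ℝ, 0 ≤ ξ → ξ < 1 → ¬ (0 < ξ ∧ ξ < d) → ¬ (1 / 2 < ξ ∧ ξ < d + 1 / 2) →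
      (d ≤ ξ ∧ ξ ≤ 1 / 2) ∨ ξ = 0 ∨ d + 1 / 2 ≤ ξ := by
    intro ξ a b c e; grind
  have near : ∀ ξ : ℝ, ξ < 1 → ((d ≤ ξ ∧ ξ ≤ 1 / 2) ∧ (d ≤ ω ∧ ω ≤ 1 / 2)) ∨
      ((ξ = 0 ∨ d + 1 / 2 ≤ ξ) ∧ (ω = 0 ∨ d + 1 / 2 ≤ ω)) →
      |ξ - ω| ≤ 1 / 2 - d ∨ 1 - |ξ - ω| ≤ 1 / 2 - d := by
    intro ξ hξ h
    rcases h with ⟨⟨a1, a2⟩, b1, b2⟩ | ⟨rfl | a, rfl | b⟩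
    · left; rw [abs_le]; constructor <;> linarith
    · left; simp; linarith
    · right; rw [zero_sub, abs_neg, abs_of_nonneg (by linarith)]; linarith
    · right; rw [sub_zero, abs_of_nonneg (by linarith)]; linarith
    · left; rw [abs_le]; constructor <;> linarith
  have zp := zone π' hp0 hp1 P1 P2
  have zq := zone κ hq0 hq1 K1 K2
  have zw := zone ω hw0 hw1 W1 W2
  have np := near π' hp1
  have nq := near κ hq1
  have kp := key π'
  have kq := key κ
  clear key zone near h1 h2 h3 h4 h5 h6 P1 P2 K1 K2 W1 W2 hlt
  rcases zp with zp | zp <;> rcases zq with zq | zq <;> rcases zw with zw | zw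
  · exact Or.inl (kp (np (Or.inl ⟨zp, zw⟩)))
  · exfalso; rcases hl1 with h | h <;> linarith
  · exact Or.inl (kp (np (Or.inl ⟨zp, zw⟩)))
  · exact Or.inr (kq (nq (Or.inr ⟨zq, zw⟩)))
  · exact Or.inr (kq (nq (Or.inl ⟨zq, zw⟩)))
  · exact Or.inl (kp (np (Or.inr ⟨zp, zw⟩)))
  · exfalso
    rcases zp with rfl | zp <;> rcases zq with rfl | zq <;> rcases hl1 with h | h <;> linarith
  · exact Or.inl (kp (np (Or.inr ⟨zp, zw⟩)))

section

variable {r : Setoid Circle} {g : Set Circle}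

/-! ### Cells do not wander -/

lemma Regular.neg (hg : IsCriticalClass r g) {x y : Circle} (h : Regular r g x y) :
    Regular r g (-x) (-y) := by
  refine ⟨fun he => h.ne (neg_injective he), h.unseparated.neg hg, fun ⟨hr, hpre⟩ => ?_⟩
  refine h.not_rel ⟨by simpa using hg.inv.rel_neg hr, ?_⟩
  by_cases hx : -x ∈ g
  · exact precritical_of_mem (by simpa using hg.neg _ hx)
  · have := hpre.map hx
    rw [sigma_neg] at this
    exact this.of_sigma

/-- The points `a` and `b` are weakly on opposite sides of `uv`, so in the coordinate `arc p` an
endpoint of `uv` lies between them. -/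
lemma exists_between_of_cross {u v z w a b : Circle} (p : Circle) (h : Cross u v z w)
    (ha : ¬ Cross u v z a) (hb : ¬ Cross u v w b) :
    |arc p a - arc p u| ≤ |arc p a - arc p b| ∨ |arc p a - arc p v| ≤ |arc p a - arc p b| := by
  rw [cross_iff p, alternate_iff] at *
  have : (arc p a ≤ arc p u ∧ arc p u ≤ arc p b) ∨ (arc p b ≤ arc p u ∧ arc p u ≤ arc p a) ∨
      (arc p a ≤ arc p v ∧ arc p v ≤ arc p b) ∨ (arc p b ≤ arc p v ∧ arc p v ≤ arc p a) := by
    grind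
  rcases this with h | h | h | h
  · left; rw [abs_of_nonpos (by linarith), abs_of_nonpos (by linarith)]; linarith
  · left; rw [abs_of_nonneg (by linarith), abs_of_nonneg (by linarith)]; linarith
  · right; rw [abs_of_nonpos (by linarith), abs_of_nonpos (by linarith)]; linarith
  · right; rw [abs_of_nonneg (by linarith), abs_of_nonneg (by linarith)]; linarith

/-- Cells that contain nearby large triangles coincide. -/
lemma Regular.cell_eq_of_close (hg : IsCriticalClass r g) {x y t x' y' t' : Circle} {δ : ℝ}
    (h : Regular r g x y) (h' : Regular r g x' y') (ht : t ∈ cell r g x y)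
    (ht' : t' ∈ cell r g x' y') (hx : |arc 1 x - arc 1 x'| < δ) (hy : |arc 1 y - arc 1 y'| < δ)
    (htt : |arc 1 t - arc 1 t'| < δ) (hxy : 2 * δ ≤ chordLen x y) (hxt : 2 * δ ≤ chordLen x t)
    (hyt : 2 * δ ≤ chordLen y t) : cell r g x y = cell r g x' y' := by
  have key : ∀ z ∈ cell r g x y, ∀ w ∈ cell r g x' y', Unseparated r g z w := by
    intro z hz w hw u v huv hu hzw
    have k : ∀ a ∈ cell r g x y, ∀ a' ∈ cell r g x' y', |arc 1 a - arc 1 a'| < δ →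
        |arc 1 a - arc 1 u| < δ ∨ |arc 1 a - arc 1 v| < δ := by
      intro a ha a' ha' haa
      rcases exists_between_of_cross 1 hzw (h.unseparated_of_mem hg hz ha u v huv hu)
        (h'.unseparated_of_mem hg hw ha' u v huv hu) with h | h
      · exact Or.inl (h.trans_lt haa)
      · exact Or.inr (h.trans_lt haa)
    have far : ∀ {a b c : Circle}, 2 * δ ≤ chordLen a b → |arc 1 a - arc 1 c| < δ →
        |arc 1 b - arc 1 c| < δ → False := by
      intro a b c hab h1 h2
      have h3 := hab.trans (chordLen_le_abs 1 a b)
      have h4 := abs_sub_le (arc 1 a) (arc 1 c) (arc 1 b)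
      rw [abs_sub_comm (arc 1 c)] at h4
      linarith
    have kx := k x h.left_mem x' h'.left_mem hx
    have ky := k y h.right_mem y' h'.right_mem hy
    have kt := k t ht t' ht' htt
    -- Each of the three vertices is near one of the two endpoints of the separating chord. Two of
    -- them share an endpoint and would be closer than `2 * δ`.
    rcases kx with kx | kx <;> rcases ky with ky | ky <;> rcases kt with kt | kt
    · exact far hxy kx ky
    · exact far hxy kx ky
    · exact far hxt kx kt
    · exact far hyt ky kt
    · exact far hyt ky kt
    · exact far hxt kx kt
    · exact far hxy kx ky
    · exact far hxy kx ky
  refine h.cell_eq hg h' ⟨?_, ?_⟩ ⟨?_, ?_⟩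
  · exact (key _ h.left_mem _ h'.left_mem).symm
  · exact (key _ h.right_mem _ h'.left_mem).symm
  · exact (key _ h.left_mem _ h'.right_mem).symm
  · exact (key _ h.right_mem _ h'.right_mem).symm

/-- Among infinitely many indices, two have images in a common box of small side. -/
lemma exists_close {ι κ : Type*} [Finite κ] {S : Set ι} (hS : S.Infinite) (f : ι → κ → Circle)
    {δ : ℝ} (hδ : 0 < δ) :
    ∃ m ∈ S, ∃ n ∈ S, m ≠ n ∧ ∀ k, |arc 1 (f m k) - arc 1 (f n k)| < δ := by
  obtain ⟨N, hN⟩ := exists_nat_gt (1 / δ)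
  have hN0 : (0 : ℝ) < N := lt_trans (by positivity) hN
  have hfin : (Set.univ : Set (κ → Fin N)).Finite := Set.finite_univ
  have hb : ∀ z : Circle, ⌊N * arc 1 z⌋₊ < N := fun z => by
    rw [Nat.floor_lt (by have := arc_nonneg 1 z; positivity)]
    nlinarith [arc_lt_one 1 z]
  obtain ⟨m, hm, n, hn, hne, he⟩ := hS.exists_ne_map_eq_of_mapsTo (t := Set.univ)
    (f := fun i => fun k : κ => (⟨⌊N * arc 1 (f i k)⌋₊, hb _⟩ : Fin N))
    (fun _ _ => Set.mem_univ _) hfin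
  refine ⟨m, hm, n, hn, hne, fun k => ?_⟩
  have hk := congrArg Fin.val (congrFun he k)
  simp only at hk
  have h1 := Nat.floor_le (a := N * arc 1 (f m k)) (by have := arc_nonneg 1 (f m k); positivity)
  have h2 := Nat.lt_floor_add_one (N * arc 1 (f m k))
  have h3 := Nat.floor_le (a := N * arc 1 (f n k)) (by have := arc_nonneg 1 (f n k); positivity)
  have h4 := Nat.lt_floor_add_one (N * arc 1 (f n k))
  rw [hk] at h1 h2
  have h5 : 1 < N * δ := by
    rw [div_lt_iff₀ hδ] at hN; exact hN
  rw [abs_lt]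
  constructor <;> nlinarith

/-- The shortest side of a triangle. -/
def minSide (x y t : Circle) : ℝ := min (chordLen x y) (min (chordLen x t) (chordLen y t))

lemma minSide_pos {x y t : Circle} (h1 : x ≠ y) (h2 : x ≠ t) (h3 : y ≠ t) : 0 < minSide x y t :=
  lt_min (chordLen_pos h1) (lt_min (chordLen_pos h2) (chordLen_pos h3))

/-- If the shortest side shrinks, it is the image of a long side. -/
lemma exists_long_side {x y t : Circle}
    (h : minSide (sigma 2 x) (sigma 2 y) (sigma 2 t) < minSide x y t)
    (h0 : 0 < minSide x y t) : ∃ a b c : Circle, (a = x ∨ a = y ∨ a = t) ∧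
      (b = x ∨ b = y ∨ b = t) ∧ (c = x ∨ c = y ∨ c = t) ∧
      1 - 2 * chordLen a b = minSide (sigma 2 x) (sigma 2 y) (sigma 2 t) ∧
      minSide x y t ≤ chordLen a b ∧ minSide x y t ≤ chordLen a c ∧
      minSide x y t ≤ chordLen b c := by
  have e1 : minSide x y t ≤ chordLen x y := min_le_left _ _
  have e2 : minSide x y t ≤ chordLen x t := (min_le_right _ _).trans (min_le_left _ _)
  have e3 : minSide x y t ≤ chordLen y t := (min_le_right _ _).trans (min_le_right _ _)
  have key : ∀ a b, minSide x y t ≤ chordLen a b →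
      minSide (sigma 2 x) (sigma 2 y) (sigma 2 t) = chordLen (sigma 2 a) (sigma 2 b) →
      1 - 2 * chordLen a b = minSide (sigma 2 x) (sigma 2 y) (sigma 2 t) := by
    intro a b hab he
    rw [chordLen_sigma] at he
    rcases min_choice (2 * chordLen a b) (1 - 2 * chordLen a b) with hm | hm
    · rw [hm] at he; linarith
    · rw [hm] at he; exact he.symm
  have hc : minSide (sigma 2 x) (sigma 2 y) (sigma 2 t) = chordLen (sigma 2 x) (sigma 2 y) ∨
      minSide (sigma 2 x) (sigma 2 y) (sigma 2 t) = chordLen (sigma 2 x) (sigma 2 t) ∨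
      minSide (sigma 2 x) (sigma 2 y) (sigma 2 t) = chordLen (sigma 2 y) (sigma 2 t) := by
    unfold minSide
    rcases min_choice (chordLen (sigma 2 x) (sigma 2 y))
      (min (chordLen (sigma 2 x) (sigma 2 t)) (chordLen (sigma 2 y) (sigma 2 t))) with hm | hm
    · exact Or.inl hm
    · rw [hm]; exact Or.inr (min_choice _ _)
  rcases hc with hc | hc | hc
  · exact ⟨x, y, t, by simp, by simp, by simp, key _ _ e1 hc, e1, e2, e3⟩
  · exact ⟨x, t, y, by simp, by simp, by simp, key _ _ e2 hc, e2, e1, by rwa [chordLen_comm]⟩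
  · exact ⟨y, t, x, by simp, by simp, by simp, key _ _ e3 hc, e3, by rwa [chordLen_comm],
      by rwa [chordLen_comm]⟩

/-- If all iterated cells were distinct, they would cross neither each other nor each other's
antipodes, and the shortest sides of the triangles would tend to zero. At two successive record
times `i < j`, a long side `ab` at time `i` and a longer side `pq` at time `j` produce the next
records. The strip between `ab` and its antipode forces a side at time `j` of length at most half
the record set after time `i`, which contradicts the choice of `j`. -/
lemma IsDiagonal.exists_cell_eq (hg : IsCriticalClass r g) {x y t t' : Circle}
    (h : IsDiagonal r g x y t t') : ∃ m n : ℕ, m < n ∧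
      cell r g ((sigma 2)^[m] x) ((sigma 2)^[m] y) =
        cell r g ((sigma 2)^[n] x) ((sigma 2)^[n] y) := by
  by_contra! hW
  have hW' : ∀ m n : ℕ, m ≠ n → cell r g ((sigma 2)^[m] x) ((sigma 2)^[m] y) ≠
      cell r g ((sigma 2)^[n] x) ((sigma 2)^[n] y) := by
    intro m n hmn
    rcases lt_or_gt_of_ne hmn with hlt | hlt
    · exact hW m n hlt
    · exact (hW n m hlt).symm
  have hreg := fun n => h.regular.iterate hg n
  have nocross : ∀ {i j : ℕ}, i ≠ j → ∀ {a b c d},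
      a ∈ cell r g ((sigma 2)^[i] x) ((sigma 2)^[i] y) →
      b ∈ cell r g ((sigma 2)^[i] x) ((sigma 2)^[i] y) →
      c ∈ cell r g ((sigma 2)^[j] x) ((sigma 2)^[j] y) →
      d ∈ cell r g ((sigma 2)^[j] x) ((sigma 2)^[j] y) → ¬ Cross a b c d ∧ ¬ Cross (-a) (-b) c d := by
    intro i j hij a b c d ha hb hc hd
    refine ⟨fun hx => hW' i j hij ((hreg i).cell_eq_of_cross hg (hreg j) ha hb hc hd hx),
      fun hx => ?_⟩
    -- If the antipode of one cell crosses the other, the two coincide; since `σ_2` forgets the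
    -- sign, the original cells coincide one step later.
    have hcell := ((hreg i).neg hg).cell_eq_of_cross hg (hreg j)
      ⟨ha.1.neg hg, ha.2.neg hg⟩ ⟨hb.1.neg hg, hb.2.neg hg⟩ hc hd hx
    have m1 := ((hreg i).neg hg).left_mem
    have m2 := ((hreg i).neg hg).right_mem
    rw [hcell] at m1 m2
    have m1' := iterate_mem_cell hg m1 1
    have m2' := iterate_mem_cell hg m2 1
    simp only [Function.iterate_one, sigma_neg, ← Function.iterate_succ_apply' (sigma 2)]
      at m1' m2'
    exact hW' (j + 1) (i + 1) (by omega)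
      ((hreg (j + 1)).cell_eq hg (hreg (i + 1)) m1' m2')
  have mem : ∀ n a, (a = (sigma 2)^[n] x ∨ a = (sigma 2)^[n] y ∨ a = (sigma 2)^[n] t) →
      a ∈ cell r g ((sigma 2)^[n] x) ((sigma 2)^[n] y) := by
    rintro n a (rfl | rfl | rfl)
    · exact (hreg n).left_mem
    · exact (hreg n).right_mem
    · exact iterate_mem_cell hg h.mem n
  set s : ℕ → ℝ := fun n => minSide ((sigma 2)^[n] x) ((sigma 2)^[n] y) ((sigma 2)^[n] t) with hs
  have hs0 : ∀ n, 0 < s n := fun n => by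
    have hx := h.cross n
    refine minSide_pos (hreg n).ne ?_ ?_
    · intro he; rw [← he] at hx; exact not_cross_left _ _ _ hx
    · intro he; rw [← he] at hx; exact not_cross_left _ _ _ hx.swap_left
  -- Otherwise two triangles with sides bounded below would be so close that their cells coincide.
  have hsmall : ∀ ε > 0, ∃ n, s n < ε := by
    intro ε hε
    by_contra! hc
    obtain ⟨m, -, n, -, hne, hk⟩ := exists_close (S := (Set.univ : Set ℕ)) Set.infinite_univ
      (fun n => ![(sigma 2)^[n] x, (sigma 2)^[n] y, (sigma 2)^[n] t]) (δ := ε / 2) (by linarith)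
    have e1 : s m ≤ chordLen ((sigma 2)^[m] x) ((sigma 2)^[m] y) := min_le_left _ _
    have e2 : s m ≤ chordLen ((sigma 2)^[m] x) ((sigma 2)^[m] t) :=
      (min_le_right _ _).trans (min_le_left _ _)
    have e3 : s m ≤ chordLen ((sigma 2)^[m] y) ((sigma 2)^[m] t) :=
      (min_le_right _ _).trans (min_le_right _ _)
    have hm := hc m
    exact hW' m n hne ((hreg m).cell_eq_of_close hg (hreg n) (iterate_mem_cell hg h.mem m)
      (iterate_mem_cell hg h.mem n) (hk 0) (hk 1) (hk 2) (by linarith) (by linarith)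
      (by linarith))
  classical
  have record : ∀ ε > 0, ε ≤ s 0 → ∃ j, s (j + 1) < ε ∧ ∀ i ≤ j, ε ≤ s i := by
    intro ε hε hε0
    have hex := hsmall ε hε
    have h1 := Nat.find_spec hex
    have h2 : ∀ i < Nat.find hex, ε ≤ s i := fun i hi => not_lt.1 (Nat.find_min hex hi)
    obtain ⟨j, hj⟩ : ∃ j, Nat.find hex = j + 1 := by
      refine Nat.exists_eq_succ_of_ne_zero fun h0 => ?_
      rw [h0] at h1
      linarith
    rw [hj] at h1 h2
    exact ⟨j, h1, fun i hi => h2 i (by omega)⟩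
  obtain ⟨i, hi1, hi2⟩ := record (s 0) (hs0 0) le_rfl
  obtain ⟨j, hj1, hj2⟩ := record (s (i + 1)) (hs0 _) hi1.le
  have hij : i < j := by
    by_contra! hle
    linarith [hi2 j hle, hi2 0 (by omega), hj2 j le_rfl, hj2 0 (by omega),
      hi2 (j + 1 - 1) (by omega), show s (i + 1) ≤ s (j + 1) by
        rcases hle.lt_or_eq with hlt | heq
        · linarith [hi2 (j + 1) (by omega)]
        · rw [heq]]
  have long : ∀ k, s (k + 1) < s k → ∃ a b c, a ∈ cell r g ((sigma 2)^[k] x) ((sigma 2)^[k] y) ∧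
      b ∈ cell r g ((sigma 2)^[k] x) ((sigma 2)^[k] y) ∧
      c ∈ cell r g ((sigma 2)^[k] x) ((sigma 2)^[k] y) ∧ 1 - 2 * chordLen a b = s (k + 1) ∧
      s k ≤ chordLen a b ∧ s k ≤ chordLen a c ∧ s k ≤ chordLen b c := by
    intro k hk
    have e : s (k + 1) = minSide (sigma 2 ((sigma 2)^[k] x)) (sigma 2 ((sigma 2)^[k] y))
        (sigma 2 ((sigma 2)^[k] t)) := by
      simp only [hs, Function.iterate_succ_apply']
    rw [e] at hk ⊢
    obtain ⟨a, b, c, ha, hb, hc, h1, h2, h3, h4⟩ := exists_long_side hk (hs0 k)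
    exact ⟨a, b, c, mem k a ha, mem k b hb, mem k c hc, h1, h2, h3, h4⟩
  obtain ⟨a, b, -, ha, hb, -, hab, hab', -, -⟩ := long i (hi1.trans_le (hi2 i le_rfl))
  obtain ⟨p, q, w, hp, hq, hw, hpq, -, hpw, hqw⟩ := long j (hj1.trans_le (hj2 j le_rfl))
  have hij' : i ≠ j := hij.ne
  have h7 := hi1.trans_le (hi2 i le_rfl)
  have h8 := hj2 j le_rfl
  -- The bound `1/3 < chordLen a b` comes from `1 - 2 * chordLen a b = s (i + 1) < s i ≤ chordLen a
  -- b`.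
  rcases chordLen_le_of_strip (a := a) (b := b) (p := p) (q := q) (w := w) (by linarith)
    (by linarith) (nocross hij' ha hb hp hq).1 (nocross hij' ha hb hp hw).1
    (nocross hij' ha hb hq hw).1 (nocross hij' ha hb hp hq).2 (nocross hij' ha hb hp hw).2
    (nocross hij' ha hb hq hw).2 with hh | hh
  · linarith [hs0 (i + 1)]
  · linarith [hs0 (i + 1)]

end

/-! ### Order on cells -/

/-- On a closed half circle, `σ_2` weakly preserves the cyclic order. -/
lemma arc_sigma_le_arc_sigma {p x y z w : Circle} (hx : arc p x ≤ 1 / 2) (hy : arc p y ≤ 1 / 2)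
    (hz : arc p z ≤ 1 / 2) (hw : arc p w ≤ 1 / 2) (hne : sigma 2 x ≠ sigma 2 y)
    (h1 : arc x z ≤ arc x w) (h2 : arc x w ≤ arc x y) :
    arc (sigma 2 x) (sigma 2 z) ≤ arc (sigma 2 x) (sigma 2 w) := by
  have hxy := abs_lt.1 (abs_lt_of_sigma_ne hx hy hne)
  rcases lt_or_ge (arc x w) (1 / 2) with hw' | hw'
  · rw [arc_sigma_of_lt (h1.trans_lt hw'), arc_sigma_of_lt hw']; linarith
  rcases lt_or_ge (arc x z) (1 / 2) with hz' | hz'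
  swap
  · rw [arc_sigma_of_le hz', arc_sigma_of_le hw']; linarith
  rw [arc_sigma_of_lt hz', arc_sigma_of_le hw']
  have b1 := arc_nonneg p x
  have b2 := arc_nonneg p y
  have b3 := arc_nonneg p z
  have b4 := arc_nonneg p w
  have key : ∀ b, (arc p x ≤ arc p b ∧ arc x b = arc p b - arc p x) ∨
      (arc p b < arc p x ∧ arc x b = arc p b - arc p x + 1) := fun b =>
    (le_or_gt (arc p x) (arc p b)).imp (fun h => ⟨h, arc_base_of_le h⟩)
      fun h => ⟨h, arc_base_of_lt h⟩
  rcases key y with ⟨c1, e1⟩ | ⟨c1, e1⟩ <;> rcases key z with ⟨c2, e2⟩ | ⟨c2, e2⟩ <;>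
    rcases key w with ⟨c3, e3⟩ | ⟨c3, e3⟩ <;> linarith

lemma chordLen_iterate {a b : Circle} {n : ℕ} (h : chordLen a b * 2 ^ n ≤ 1 / 2) :
    chordLen ((sigma 2)^[n] a) ((sigma 2)^[n] b) = chordLen a b * 2 ^ n := by
  have h0 : 0 ≤ chordLen a b := le_min (arc_nonneg _ _) (arc_nonneg _ _)
  induction n with
  | zero => simp
  | succ n ih =>
    rw [pow_succ] at h ⊢
    have h1 : chordLen a b * 2 ^ n ≤ 1 / 4 := by linarith
    rw [Function.iterate_succ_apply', Function.iterate_succ_apply', chordLen_sigma,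
      ih (by linarith), min_eq_left (by linarith)]
    ring

section

variable {r : Setoid Circle} {g : Set Circle}

/-- All iterates of a cell lie in closed half circles, so the cyclic order is weakly preserved at
each step. -/
lemma Regular.arc_iterate_le (hg : IsCriticalClass r g) {x y z w : Circle} (h : Regular r g x y)
    (hz : z ∈ cell r g x y) (hw : w ∈ cell r g x y) (h1 : arc x z ≤ arc x w)
    (h2 : arc x w ≤ arc x y) (n : ℕ) :
    arc ((sigma 2)^[n] x) ((sigma 2)^[n] z) ≤ arc ((sigma 2)^[n] x) ((sigma 2)^[n] w) ∧
      arc ((sigma 2)^[n] x) ((sigma 2)^[n] w) ≤ arc ((sigma 2)^[n] x) ((sigma 2)^[n] y) := by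
  induction n generalizing x y z w with
  | zero => exact ⟨h1, h2⟩
  | succ n ih =>
    obtain ⟨p, -, q, -, -, hs⟩ := h.exists_side hg
    have m1 := (hs x h.left_mem).2
    have m2 := (hs y h.right_mem).2
    have hne := (h.map hg).ne
    exact ih (h.map hg) (iterate_mem_cell hg hz 1) (iterate_mem_cell hg hw 1)
      (arc_sigma_le_arc_sigma m1 m2 (hs z hz).2 (hs w hw).2 hne h1 h2)
      (arc_sigma_le_arc_sigma m1 m2 (hs w hw).2 m2 hne h2 le_rfl)

lemma cell_comm (x y : Circle) : cell r g x y = cell r g y x :=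
  Set.ext fun _ => and_comm

lemma Regular.cell_iterate_eq (hg : IsCriticalClass r g) {x y : Circle} (h : Regular r g x y)
    {K : ℕ} (hK : cell r g x y = cell r g ((sigma 2)^[K] x) ((sigma 2)^[K] y)) (i : ℕ) :
    cell r g x y = cell r g ((sigma 2)^[K * i] x) ((sigma 2)^[K * i] y) := by
  induction i with
  | zero => simp
  | succ i ih =>
    have h1 := iterate_mem_cell hg (hK ▸ (h.iterate hg K).left_mem) (K * i)
    have h2 := iterate_mem_cell hg (hK ▸ (h.iterate hg K).right_mem) (K * i)
    rw [← Function.iterate_add_apply] at h1 h2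
    rw [ih, mul_add, mul_one]
    exact (h.iterate hg _).cell_eq hg (h.iterate hg _) h1 h2

/-- Expansion: a point of a cell whose orbit under the return map is monotone is fixed. -/
lemma iterate_eq_of_monotone (hg : IsCriticalClass r g) {p z : Circle} {K : ℕ} (hK : 0 < K)
    (hz : Unseparated r g z ((sigma 2)^[K] z))
    (hm : Monotone (fun i => arc p ((sigma 2)^[K * i] z)) ∨
      Antitone (fun i => arc p ((sigma 2)^[K * i] z))) : (sigma 2)^[K] z = z := by
  obtain ⟨l, hl⟩ : ∃ l, Tendsto (fun i => arc p ((sigma 2)^[K * i] z)) atTop (𝓝 l) := by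
    rcases hm with hm | hm
    · exact ⟨_, tendsto_atTop_ciSup hm ⟨1, by rintro _ ⟨i, rfl⟩; exact (arc_lt_one _ _).le⟩⟩
    · exact ⟨_, tendsto_atTop_ciInf hm ⟨0, by rintro _ ⟨i, rfl⟩; exact arc_nonneg _ _⟩⟩
  set c : ℕ → ℝ := fun i => chordLen ((sigma 2)^[K * i] z) ((sigma 2)^[K * (i + 1)] z) with hc
  have hc0 : ∀ i, 0 ≤ c i := fun i => le_min (arc_nonneg _ _) (arc_nonneg _ _)
  -- A monotone bounded orbit converges, so consecutive distances tend to zero. Short distances are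
  -- multiplied by `2 ^ K`, so they must eventually vanish.
  have hlim : Tendsto c atTop (𝓝 0) := by
    have h1 := (hl.sub (hl.comp (tendsto_add_atTop_nat 1))).abs
    rw [sub_self, abs_zero] at h1
    exact squeeze_zero hc0 (fun i => chordLen_le_abs p _ _) h1
  obtain ⟨N, hN⟩ := eventually_atTop.1
    (hlim.eventually (gt_mem_nhds (show (0 : ℝ) < 1 / 2 / 2 ^ K by positivity)))
  have hstep : ∀ i ≥ N, c i ≤ c (i + 1) := by
    intro i hi
    have h1 := hN i hi
    rw [lt_div_iff₀ (by positivity)] at h1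
    have h2 := chordLen_iterate h1.le
    rw [← Function.iterate_add_apply, ← Function.iterate_add_apply] at h2
    have e : c (i + 1) = c i * 2 ^ K := by
      rw [← h2]
      simp only [hc]
      rw [show K * (i + 1) = K + K * i by ring, show K * (i + 1 + 1) = K + (K + K * i) by ring]
    rw [e]
    exact le_mul_of_one_le_right (hc0 i) (one_le_pow₀ (by norm_num))
  have hge : ∀ i, c N ≤ c (N + i) := by
    intro i
    induction i with
    | zero => exact le_rfl
    | succ i ih => exact ih.trans (hstep _ (by omega))
  have hcN : c N ≤ 0 := ge_of_tendsto hlim (eventually_atTop.2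
    ⟨N, fun i hi => by obtain ⟨k, rfl⟩ := Nat.exists_eq_add_of_le hi; exact hge k⟩)
  have heq : (sigma 2)^[K * N] z = (sigma 2)^[K * (N + 1)] z := by
    by_contra hne
    linarith [chordLen_pos hne]
  by_contra hne
  rw [mul_add, mul_one, Function.iterate_add_apply] at heq
  -- The orbits of `z` and of its return merge, so the orbit of `z` meets `g` at the two times `m`
  -- and `m + K`, which is impossible.
  obtain ⟨m, h1, h2⟩ := hz.exists_collision hg hne heq.symm
  rw [← Function.iterate_add_apply] at h2
  have := hg.iterate_mem_unique h1 (n := m + K) (by rw [h2]; exact hg.neg _ h1)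
  omega

lemma arc_add {p a b : Circle} (h : arc p a + arc a b < 1) : arc p b = arc p a + arc a b := by
  rcases le_or_gt (arc p a) (arc p b) with h1 | h1
  · rw [arc_base_of_le h1]; ring
  · rw [arc_base_of_lt h1] at h
    linarith [arc_nonneg p b]

/-- With both ends fixed, the return map is monotone on the cell points between them, so orbits are
monotone and expansion applies. -/
lemma Regular.iterate_eq_of_fixed (hg : IsCriticalClass r g) {x y : Circle} (h : Regular r g x y)
    {K : ℕ} (hK : 0 < K) (hx : (sigma 2)^[K] x = x) (hy : (sigma 2)^[K] y = y) {z : Circle}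
    (hz : z ∈ cell r g x y) (hle : arc x z ≤ arc x y) : (sigma 2)^[K] z = z := by
  have hz' := iterate_mem_cell hg hz K
  rw [hx, hy] at hz'
  have hle' := (h.arc_iterate_le hg hz hz le_rfl hle K).2
  rw [hx, hy] at hle'
  have hx' : ∀ i, (sigma 2)^[K * i] x = x := fun i => by
    rw [Function.iterate_mul]; exact Function.iterate_fixed hx i
  refine iterate_eq_of_monotone hg (p := x) hK (h.unseparated_of_mem hg hz hz') ?_
  rcases le_total (arc x z) (arc x ((sigma 2)^[K] z)) with h1 | h1
  · refine Or.inl (monotone_nat_of_le_succ fun i => ?_)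
    have := (h.arc_iterate_le hg hz hz' h1 hle' (K * i)).1
    rwa [hx', ← Function.iterate_add_apply] at this
  · refine Or.inr (antitone_nat_of_succ_le fun i => ?_)
    have := (h.arc_iterate_le hg hz' hz h1 hle (K * i)).1
    rwa [hx', ← Function.iterate_add_apply] at this

lemma arc_le_or_arc_le {x y : Circle} (h : x ≠ y) (z : Circle) :
    arc x z ≤ arc x y ∨ arc y z ≤ arc y x := by
  refine (le_or_gt (arc x z) (arc x y)).imp_right fun h1 => ?_
  rw [arc_base_of_le h1.le, arc_swap h]
  linarith [arc_lt_one x z]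

/-- If the return map moves a chord inside itself, it fixes all points of the cell. -/
lemma Regular.iterate_eq_of_nested (hg : IsCriticalClass r g) {x y : Circle} (h : Regular r g x y)
    {K : ℕ} (hK : 0 < K) (hcell : cell r g x y = cell r g ((sigma 2)^[K] x) ((sigma 2)^[K] y))
    (h1 : arc x ((sigma 2)^[K] x) ≤ arc x ((sigma 2)^[K] y))
    (h2 : arc x ((sigma 2)^[K] y) ≤ arc x y) {z : Circle} (hz : z ∈ cell r g x y) :
    (sigma 2)^[K] z = z := by
  have hmem : ∀ z ∈ cell r g x y, (sigma 2)^[K] z ∈ cell r g x y := fun z hz => by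
    have := iterate_mem_cell hg hz K
    rwa [← hcell] at this
  have hun : ∀ z ∈ cell r g x y, Unseparated r g z ((sigma 2)^[K] z) := fun z hz =>
    h.unseparated_of_mem hg hz (hmem z hz)
  have hord := fun i => h.arc_iterate_le hg (hmem x h.left_mem) (hmem y h.right_mem) h1 h2 (K * i)
  simp only [← Function.iterate_add_apply] at hord
  -- Successive returns of the chord are nested: left ends increase and right ends decrease, so both
  -- ends have monotone orbits and are fixed.
  have hstep : ∀ i, arc x ((sigma 2)^[K * i] x) ≤ arc x ((sigma 2)^[K * i] y) →
      arc x ((sigma 2)^[K * i] x) ≤ arc x ((sigma 2)^[K * (i + 1)] x) ∧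
      arc x ((sigma 2)^[K * (i + 1)] x) ≤ arc x ((sigma 2)^[K * (i + 1)] y) ∧
      arc x ((sigma 2)^[K * (i + 1)] y) ≤ arc x ((sigma 2)^[K * i] y) := by
    intro i hle
    have ho := hord i
    rw [show K * i + K = K * (i + 1) by ring] at ho
    have e0 := arc_base_of_le hle
    have hlt := arc_lt_one x ((sigma 2)^[K * i] y)
    have e1 := arc_add (p := x) (a := (sigma 2)^[K * i] x) (b := (sigma 2)^[K * (i + 1)] x)
      (by linarith)
    have e2 := arc_add (p := x) (a := (sigma 2)^[K * i] x) (b := (sigma 2)^[K * (i + 1)] y)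
      (by linarith)
    have := arc_nonneg ((sigma 2)^[K * i] x) ((sigma 2)^[K * (i + 1)] x)
    exact ⟨by linarith, by linarith, by linarith⟩
  have hnest : ∀ i, arc x ((sigma 2)^[K * i] x) ≤ arc x ((sigma 2)^[K * i] y) := by
    intro i
    induction i with
    | zero => simp [arc_self, arc_nonneg]
    | succ i ih => exact (hstep i ih).2.1
  have hx := iterate_eq_of_monotone hg (p := x) hK (hun x h.left_mem)
    (Or.inl (monotone_nat_of_le_succ fun i => (hstep i (hnest i)).1))
  have hy := iterate_eq_of_monotone hg (p := x) hK (hun y h.right_mem)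
    (Or.inr (antitone_nat_of_succ_le fun i => (hstep i (hnest i)).2.2))
  rcases arc_le_or_arc_le h.ne z with hle | hle
  · exact h.iterate_eq_of_fixed hg hK hx hy hz hle
  · exact (h.symm hg).iterate_eq_of_fixed hg hK hy hx (cell_comm x y ▸ hz) hle

/-! ### Cells with a leaf as a diagonal are periodic -/

/-- The folding branch of the tent map takes a length below `1/3` to one above `1/3`. If the lengths
stayed below `1/3`, they would double forever. -/
lemma exists_long_iterate {x y : Circle} (h : ∀ n, (sigma 2)^[n] x ≠ (sigma 2)^[n] y) (N : ℕ) :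
    ∃ n ≥ N, 1 / 3 ≤ chordLen ((sigma 2)^[n] x) ((sigma 2)^[n] y) := by
  by_contra! hc
  set c : ℕ → ℝ := fun n => chordLen ((sigma 2)^[n] x) ((sigma 2)^[n] y) with hcdef
  have hs : ∀ n, c (n + 1) = min (2 * c n) (1 - 2 * c n) := fun n => by
    simp only [hcdef, Function.iterate_succ_apply']
    exact chordLen_sigma _ _
  have hd : ∀ n ≥ N, c (n + 1) = 2 * c n := by
    intro n hn
    have h1 := hc n hn
    have h2 := hc (n + 1) (by omega)
    change c n < 1 / 3 at h1
    change c (n + 1) < 1 / 3 at h2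
    rw [hs n] at h2 ⊢
    rcases min_choice (2 * c n) (1 - 2 * c n) with hm | hm
    · exact hm
    · rw [hm] at h2; linarith
  have hpow : ∀ k, c (N + k) = 2 ^ k * c N := by
    intro k
    induction k with
    | zero => simp
    | succ k ih => rw [← add_assoc, hd _ (by omega), ih]; ring
  have h0 : 0 < c N := chordLen_pos (h N)
  obtain ⟨k, hk⟩ := pow_unbounded_of_one_lt (1 / c N) (one_lt_two (α := ℝ))
  rw [div_lt_iff₀ h0, ← hpow] at hk
  have : c (N + k) < 1 / 3 := hc _ (by omega)
  linarith

lemma IsPulledBack.iterate {M : Circle → Circle → Prop} (hM : IsPulledBack g M) {x y : Circle}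
    (h : M x y) (n : ℕ) : M ((sigma 2)^[n] x) ((sigma 2)^[n] y) := by
  induction n generalizing x y with
  | zero => exact h
  | succ n ih => exact ih (hM.forward h)

/-- Long disjoint chords with nearby endpoints are nested. -/
lemma nested_of_close {x y x' y' : Circle} (hlen : 1 / 3 ≤ chordLen x y)
    (hx : |arc 1 x - arc 1 x'| < 1 / 6) (hy : |arc 1 y - arc 1 y'| < 1 / 6)
    (hc : ¬ Cross x y x' y') : (arc x x' ≤ arc x y' ∧ arc x y' ≤ arc x y) ∨
      (arc y y' ≤ arc y x' ∧ arc y x' ≤ arc y x) := by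
  have hne : x ≠ y := by
    rintro rfl
    rw [chordLen, arc_self, min_self] at hlen
    norm_num at hlen
  have main : ∀ {x y x' y' : Circle}, x ≠ y → 1 / 3 ≤ chordLen x y →
      |arc 1 x - arc 1 x'| < 1 / 6 → |arc 1 y - arc 1 y'| < 1 / 6 →
      arc x x' ≤ arc x y → arc x y' ≤ arc x y → arc x x' ≤ arc x y' := by
    intro x y x' y' hne hlen hx hy h1 h2
    have l1 : 1 / 3 ≤ arc x y := hlen.trans (min_le_left _ _)
    have l2 : 1 / 3 ≤ arc y x := hlen.trans (min_le_right _ _)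
    rw [arc_swap hne] at l2
    have cx := (chordLen_le_abs 1 x x').trans_lt hx
    have cy := (chordLen_le_abs 1 y y').trans_lt hy
    rw [chordLen_eq x, min_lt_iff, arc_self, zero_sub, abs_neg, abs_of_nonneg (arc_nonneg _ _)] at cx
    rw [chordLen_eq x, min_lt_iff, abs_of_nonneg (by linarith)] at cy
    have := arc_nonneg x y'
    rcases cx with cx | cx <;> rcases cy with cy | cy <;> linarith
  have hcc := hc
  rw [cross_iff x, alternate_iff, arc_self] at hcc
  have b1 := arc_nonneg x x'
  have b2 := arc_nonneg x y'
  have hside : (arc x x' ≤ arc x y ∧ arc x y' ≤ arc x y) ∨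
      ((arc x x' = 0 ∨ arc x y ≤ arc x x') ∧ (arc x y' = 0 ∨ arc x y ≤ arc x y')) := by grind
  rcases hside with ⟨h1, h2⟩ | ⟨h1, h2⟩
  · exact Or.inl ⟨main hne hlen hx hy h1 h2, h2⟩
  · have conv : ∀ b, arc x b = 0 ∨ arc x y ≤ arc x b → arc y b ≤ arc y x := by
      rintro b (hb | hb)
      · rw [arc_eq_zero] at hb; rw [hb]
      · rw [arc_base_of_le hb, arc_swap hne]
        linarith [arc_lt_one x b]
    rw [chordLen_comm] at hlen
    exact Or.inr ⟨main hne.symm hlen hy hx (conv _ h2) (conv _ h1), conv _ h1⟩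

/-- The cell is eventually periodic and the leaf is long infinitely often. Two long iterates that
are close and bound the same cell do not cross, so they are nested, and the return map fixes every
point of the cell. -/
lemma IsDiagonal.exists_periodic (hg : IsCriticalClass r g) {M : Circle → Circle → Prop}
    (hM : IsPulledBack g M) {x y t t' : Circle} (h : IsDiagonal r g x y t t') (hxy : M x y) :
    ∃ n K, 0 < K ∧ ∀ z ∈ cell r g ((sigma 2)^[n] x) ((sigma 2)^[n] y), (sigma 2)^[K] z = z := by
  obtain ⟨m, n, hmn, hcell⟩ := h.exists_cell_eq hg
  have hper : ∀ j ≥ m, ∀ i, cell r g ((sigma 2)^[j] x) ((sigma 2)^[j] y) =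
      cell r g ((sigma 2)^[j + (n - m) * i] x) ((sigma 2)^[j + (n - m) * i] y) := by
    intro j hj i
    have hreg := h.regular.iterate hg
    have h1 := iterate_mem_cell hg (hcell ▸ (hreg n).left_mem) (j - m)
    have h2 := iterate_mem_cell hg (hcell ▸ (hreg n).right_mem) (j - m)
    simp only [← Function.iterate_add_apply] at h1 h2
    rw [show j - m + m = j by omega, show j - m + n = (n - m) + j by omega] at h1 h2
    have := (hreg j).cell_iterate_eq hg (K := n - m) (by
      rw [← Function.iterate_add_apply, ← Function.iterate_add_apply]
      exact (hreg j).cell_eq hg (hreg _) h1 h2) i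
    rwa [← Function.iterate_add_apply, ← Function.iterate_add_apply, add_comm _ j] at this
  set S : Set ℕ := {j | m ≤ j ∧ 1 / 3 ≤ chordLen ((sigma 2)^[j] x) ((sigma 2)^[j] y)} with hS
  have hSinf : S.Infinite := by
    rw [Set.infinite_iff_exists_gt]
    intro a
    obtain ⟨j, hj, hlen⟩ := exists_long_iterate (fun n => (h.regular.iterate hg n).ne) (max m (a + 1))
    exact ⟨j, ⟨(le_max_left _ _).trans hj, hlen⟩, (le_max_right _ _).trans hj⟩
  have : Infinite S := hSinf.to_subtype
  -- Times in one residue class modulo the period `n - m` belong to the same cell; `exists_close`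
  -- then picks two of them with nearby endpoints.
  obtain ⟨c, hc⟩ := Finite.exists_infinite_fiber
    (fun j : S => (⟨j % (n - m), Nat.mod_lt _ (by omega)⟩ : Fin (n - m)))
  obtain ⟨⟨j, hj⟩, hjc, ⟨k, hk⟩, hkc, hne, hclose⟩ := exists_close (Set.infinite_coe_iff.1 hc)
    (fun j : S => ![(sigma 2)^[(j : ℕ)] x, (sigma 2)^[(j : ℕ)] y]) (δ := 1 / 6) (by norm_num)
  have hmod : j % (n - m) = k % (n - m) := by
    rw [Set.mem_preimage, Set.mem_singleton_iff] at hjc hkc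
    exact congrArg Fin.val (hjc.trans hkc.symm)
  have hjk : j ≠ k := fun he => hne (Subtype.ext he)
  have h1 := hclose 0
  have h2 := hclose 1
  simp only [Matrix.cons_val_zero, Matrix.cons_val_one] at h1 h2
  clear hclose hjc hkc hne hc this
  wlog hlt : j < k generalizing j k
  · exact this k hk j hj hmod.symm hjk.symm (by rwa [abs_sub_comm]) (by rwa [abs_sub_comm])
      (by omega)
  obtain ⟨i, hi⟩ := (Nat.modEq_iff_dvd' hlt.le).1 hmod
  have hcell' := hper j hj.1 i
  have e : ∀ z, (sigma 2)^[k - j] ((sigma 2)^[j] z) = (sigma 2)^[k] z := fun z => by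
    rw [← Function.iterate_add_apply, Nat.sub_add_cancel hlt.le]
  rw [← hi, show j + (k - j) = k by omega, ← e, ← e] at hcell'
  have hreg := h.regular.iterate hg j
  refine ⟨j, k - j, by omega, fun z hz => ?_⟩
  have hnc := hM.not_cross (hM.iterate hxy j) (hM.iterate hxy k)
  rcases nested_of_close hj.2 h1 h2 hnc with ⟨o1, o2⟩ | ⟨o1, o2⟩
  · rw [← e x, ← e y] at o1
    rw [← e y] at o2
    exact hreg.iterate_eq_of_nested hg (by omega) hcell' o1 o2 hz
  · rw [← e x, ← e y] at o1
    rw [← e x] at o2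
    rw [cell_comm] at hz
    rw [cell_comm, cell_comm ((sigma 2)^[k - j] _)] at hcell'
    exact (hreg.symm hg).iterate_eq_of_nested hg (by omega) hcell' o1 o2 hz

/-! ### Holes of a class -/

/-- `w` follows `z` in the cyclic order of their common class. -/
structure Next (r : Setoid Circle) (z w : Circle) : Prop where
  rel : r z w
  ne : w ≠ z
  le : ∀ u, r z u → u ≠ z → arc z w ≤ arc z u

lemma Next.eq {z w w' : Circle} (h : Next r z w) (h' : Next r z w') : w = w' :=
  (arc_inj (p := z)).1 (le_antisymm (h.le w' h'.rel h'.ne) (h'.le w h.rel h.ne))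

lemma IsCriticalClass.exists_next (hg : IsCriticalClass r g) {z u : Circle} (h : r z u)
    (hne : u ≠ z) : ∃ w, Next r z w := by
  obtain ⟨k, hk, hzk⟩ := exists_class r z
  obtain ⟨w, ⟨hw, hwz⟩, hmin⟩ := Set.exists_min_image (k \ {z}) (fun w => arc z w)
    ((hg.lam.finite_classes k hk).subset Set.sdiff_subset) ⟨u, (mem_class_iff hk hzk).2 h, hne⟩
  exact ⟨w, (mem_class_iff hk hzk).1 hw, hwz,
    fun v hv hvz => hmin v ⟨(mem_class_iff hk hzk).2 hv, hvz⟩⟩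

/-- A class other than `g` lies in an open half circle, so `σ_2` is injective on it and keeps its
cyclic order. -/
lemma IsCriticalClass.exists_half (hg : IsCriticalClass r g) {z : Circle} (hz : z ∉ g) :
    ∃ p ∈ g, ∀ u, r z u → 0 < arc p u ∧ arc p u < 1 / 2 := by
  obtain ⟨p, hp, q, hq, h1, h2, h3, -⟩ := hg.exists_side hz
  refine ⟨p, hp, fun u hu => ?_⟩
  have := hg.rel_side hp hq h1 h2 hz hu
  exact ⟨this.1, this.2.trans_le h3⟩

lemma Next.sigma (hg : IsCriticalClass r g) {z w : Circle} (hz : z ∉ g) (h : Next r z w) :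
    Next r (sigma 2 z) (sigma 2 w) := by
  obtain ⟨p, hp, hhalf⟩ := hg.exists_half hz
  have inj : ∀ u, r z u → u ≠ z → GeoLam.sigma 2 u ≠ GeoLam.sigma 2 z := by
    intro u hu hne he
    rcases sigma_eq_sigma.1 he.symm with rfl | rfl
    · exact hne rfl
    · have h1 := hhalf _ hu
      rw [arc_neg_of_lt (hhalf z (r.refl z)).2] at h1
      linarith [arc_nonneg p z]
  refine ⟨hg.inv.rel_sigma h.rel, inj w h.rel h.ne, fun u' hu' hne => ?_⟩
  obtain ⟨u, hu, rfl⟩ := hg.inv.exists_rel_of_rel_sigma hu'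
  have huz : u ≠ z := fun he => hne (by rw [he])
  exact arc_sigma_le_arc_sigma (hhalf z (r.refl z)).2.le (hhalf u hu).2.le (hhalf w h.rel).2.le
    (hhalf u hu).2.le (inj u hu huz).symm (h.le u hu huz) le_rfl

lemma Next.iterate (hg : IsCriticalClass r g) {z w : Circle} (hz : ¬ Precritical g z)
    (h : Next r z w) (n : ℕ) : Next r ((GeoLam.sigma 2)^[n] z) ((GeoLam.sigma 2)^[n] w) := by
  induction n with
  | zero => exact h
  | succ n ih =>
    rw [Function.iterate_succ_apply', Function.iterate_succ_apply']
    exact ih.sigma hg fun hm => hz ⟨n, hm⟩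

/-- The image of a long hole contains the critical value. -/
lemma Next.mem_of_long (hg : IsCriticalClass r g) {z w c : Circle} (hz : z ∉ g)
    (h : Next r z w) (hlong : 1 / 2 ≤ arc z w) (hc : c ∈ g) :
    0 < arc (GeoLam.sigma 2 z) (GeoLam.sigma 2 c) ∧
      arc (GeoLam.sigma 2 z) (GeoLam.sigma 2 c) < arc (GeoLam.sigma 2 z) (GeoLam.sigma 2 w) := by
  obtain ⟨p, hp, hhalf⟩ := hg.exists_half hz
  have hnr : ∀ c ∈ g, ¬ r (GeoLam.sigma 2 z) (GeoLam.sigma 2 c) := by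
    intro c hc hr
    obtain ⟨u, hu, hs⟩ := hg.inv.exists_rel_of_rel_sigma hr
    refine hz (hg.mem_of_rel ?_ (r.symm hu))
    rcases sigma_eq_sigma.1 hs.symm with rfl | rfl
    · exact hc
    · exact hg.neg _ hc
  have z1 := hhalf z (r.refl z)
  have w1 := hhalf w h.rel
  have hlt : arc p w < arc p z := by
    by_contra! hle
    rw [arc_base_of_le hle] at hlong
    linarith
  have ez := arc_sigma_of_lt z1.2
  have ew := arc_sigma_of_lt w1.2
  have e1 : arc (GeoLam.sigma 2 z) (GeoLam.sigma 2 p) = 1 - 2 * arc p z := by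
    rw [arc_base_of_lt (p := GeoLam.sigma 2 p) (by rw [arc_self, ez]; linarith), arc_self, ez]
    ring
  have e2 : arc (GeoLam.sigma 2 z) (GeoLam.sigma 2 w) = 1 - 2 * arc p z + 2 * arc p w := by
    rw [arc_base_of_lt (p := GeoLam.sigma 2 p) (by rw [ew, ez]; linarith), ew, ez]
    ring
  have hle := arc_le_of_not_cross (p := GeoLam.sigma 2 z) (q := GeoLam.sigma 2 w)
    (z := GeoLam.sigma 2 p) (w := GeoLam.sigma 2 c) (by linarith) (by linarith)
    (hg.lam.not_cross (hg.inv.rel_sigma h.rel) (hg.inv.rel_sigma (hg.rel_of_mem hp hc))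
      (hnr p hp))
  refine ⟨arc_pos.2 fun he => hnr c hc (by rw [he]), lt_of_le_of_ne hle fun he => hnr c hc ?_⟩
  rw [(arc_inj (p := GeoLam.sigma 2 z)).1 he]
  exact hg.inv.rel_sigma h.rel

lemma eq_of_iterate_eq {a b : Circle} {K j : ℕ} (hK : 0 < K) (ha : (sigma 2)^[K] a = a)
    (hb : (sigma 2)^[K] b = b) (h : (sigma 2)^[j] a = (sigma 2)^[j] b) : a = b := by
  have key : ∀ c, (sigma 2)^[K] c = c → (sigma 2)^[K * j - j] ((sigma 2)^[j] c) = c := by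
    intro c hc
    rw [← Function.iterate_add_apply, Nat.sub_add_cancel (Nat.le_mul_of_pos_left j hK),
      Function.iterate_mul]
    exact Function.iterate_fixed hc j
  rw [← key a ha, h, key b hb]

/-- `σ_2` permutes the points of a periodic class with at least three points transitively. -/
lemma IsCriticalClass.exists_iterate_eq (hg : IsCriticalClass r g) {x u v z : Circle} {K : ℕ}
    (hK : 0 < K) (hper : ∀ z, r x z → (sigma 2)^[K] z = z) (hu : r x u) (hv : r x v) (hux : u ≠ x)
    (hvx : v ≠ x) (huv : u ≠ v) (hz : r x z) : ∃ n, (sigma 2)^[n] x = z := by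
  -- The union of the finitely many classes in the cycle; all its points are fixed by the `K`-th
  -- iterate.
  set T : Set Circle := {z | ∃ j, r ((sigma 2)^[j] x) z} with hT
  have hTr : ∀ {z w}, z ∈ T → r z w → w ∈ T := fun ⟨j, hj⟩ h => ⟨j, r.trans hj h⟩
  have hTit : ∀ {z}, z ∈ T → ∀ n, (sigma 2)^[n] z ∈ T := fun {z} ⟨j, hj⟩ n =>
    ⟨n + j, by rw [Function.iterate_add_apply]; exact hg.inv.rel_iterate hj n⟩
  have hTper : ∀ {z}, z ∈ T → (sigma 2)^[K] z = z := by
    rintro z ⟨j, hj⟩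
    obtain ⟨w, hw, rfl⟩ := hg.inv.exists_rel_of_rel_iterate hj
    rw [← Function.iterate_add_apply, add_comm, Function.iterate_add_apply, hper w hw]
  have hTpre : ∀ {z}, z ∈ T → ¬ Precritical g z := fun hz =>
    hg.not_precritical_of_periodic hK (hTper hz)
  have hTg : ∀ {z}, z ∈ T → z ∉ g := fun hz h => hTpre hz (precritical_of_mem h)
  have hTfin : T.Finite := by
    obtain ⟨k, hk, hxk⟩ := exists_class r x
    refine ((Set.finite_Iio K).image2 (fun j u => (sigma 2)^[j] u)
      (hg.lam.finite_classes k hk)).subset ?_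
    rintro z ⟨j, hj⟩
    obtain ⟨w, hw, rfl⟩ := hg.inv.exists_rel_of_rel_iterate hj
    exact ⟨j % K, Nat.mod_lt _ hK, w, (mem_class_iff hk hxk).2 hw,
      Function.IsPeriodicPt.iterate_mod_apply (hper w hw) j⟩
  have hT3 : ∀ {z}, z ∈ T → ∀ c d, ∃ w, r z w ∧ w ≠ c ∧ w ≠ d := by
    rintro z ⟨j, hj⟩ c d
    have inj : ∀ {a b}, r x a → r x b → a ≠ b → (sigma 2)^[j] a ≠ (sigma 2)^[j] b :=
      fun ha hb hne he => hne (eq_of_iterate_eq hK (hper _ ha) (hper _ hb) he)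
    have h1 := inj hu (r.refl x) hux
    have h2 := inj hv (r.refl x) hvx
    have h3 := inj hu hv huv
    have r1 := r.symm hj
    have r2 := r.trans r1 (hg.inv.rel_iterate hu j)
    have r3 := r.trans r1 (hg.inv.rel_iterate hv j)
    by_contra! hc
    have key : ∀ w, r z w → w = c ∨ w = d := fun w hw => or_iff_not_imp_left.2 (hc w hw)
    rcases key _ r1 with c1 | c1 <;> rcases key _ r2 with c2 | c2 <;>
      rcases key _ r3 with c3 | c3 <;>
      first
      | exact h1 (c2.trans c1.symm)
      | exact h2 (c3.trans c1.symm)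
      | exact h3 (c2.trans c3.symm)
  have hnext : ∀ z ∈ T, ∃ w, Next r z w := fun z hz => by
    obtain ⟨w, hw, hne, -⟩ := hT3 hz z z
    exact hg.exists_next hw hne
  choose! nx hnx using hnext
  obtain ⟨a, haT, hamin⟩ := Set.exists_min_image T (fun z => arc z (nx z)) hTfin
    ⟨x, 0, r.refl x⟩
  have back : ∀ {z}, z ∈ T → ∀ m, (sigma 2)^[K * m - m] ((sigma 2)^[m] z) = z := by
    intro z hz m
    rw [← Function.iterate_add_apply, Nat.sub_add_cancel (Nat.le_mul_of_pos_left m hK),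
      Function.iterate_mul]
    exact Function.iterate_fixed (hTper hz) m
  have orb : ∀ {z}, z ∈ T → ∀ m, (∃ n, (sigma 2)^[n] a = (sigma 2)^[m] z) →
      ∃ n, (sigma 2)^[n] a = z := by
    rintro z hz m ⟨n, hn⟩
    exact ⟨K * m - m + n, by rw [Function.iterate_add_apply, hn, back hz]⟩
  suffices hA : ∀ b ∈ T, ∃ n, (sigma 2)^[n] a = b by
    obtain ⟨i, hi⟩ := hA x ⟨0, r.refl x⟩
    obtain ⟨j, hj⟩ := hA z ⟨0, hz⟩
    refine ⟨j + (K * i - i), ?_⟩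
    rw [Function.iterate_add_apply, ← hi, back haT, hj]
  -- Compare the shortest hole of all, at `a`, with the shortest hole at a point `b` outside the
  -- orbit of `a`.
  by_contra! hcon
  obtain ⟨b, ⟨hbT, hbO⟩, hbmin⟩ := Set.exists_min_image
    (T ∩ {b | ∀ n, (sigma 2)^[n] a ≠ b}) (fun z => arc z (nx z))
    (hTfin.subset Set.inter_subset_left) hcon
  obtain ⟨c, hc⟩ := hg.nonempty
  -- A hole shorter than `1/2` doubles under `σ_2`. So a hole no longer than its predecessor comes
  -- from a long one, and it contains the critical value.
  have pred : ∀ {z}, z ∈ T → arc z (nx z) ≤ arc ((sigma 2)^[K - 1] z) (nx ((sigma 2)^[K - 1] z)) →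
      0 < arc z (sigma 2 c) ∧ arc z (sigma 2 c) < arc z (nx z) := by
    intro z hz hle
    set z' := (sigma 2)^[K - 1] z with hz'
    have hs : sigma 2 z' = z := by
      rw [hz', ← Function.iterate_succ_apply' (sigma 2), show (K - 1).succ = K by omega, hTper hz]
    have hzT : z' ∈ T := hTit hz _
    have hN := hnx z' hzT
    have hsN := hN.sigma hg (hTg hzT)
    rw [hs] at hsN
    have he := (hnx z hz).eq hsN
    have hlong : 1 / 2 ≤ arc z' (nx z') := by
      by_contra! hlt
      have h1 := arc_sigma_of_lt hlt
      rw [hs, ← he] at h1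
      have := arc_pos.2 hN.ne
      linarith
    have := hN.mem_of_long hg (hTg hzT) hlong hc
    rwa [hs, ← he] at this
  have ha := pred haT (hamin _ (hTit haT _))
  have hb := pred hbT (hbmin _ ⟨hTit hbT _, fun n hn => by
    obtain ⟨m, hm⟩ := orb hbT (K - 1) ⟨n, hn⟩
    exact hbO m hm⟩)
  have hab := hamin b hbT
  set v := sigma 2 c with hv
  set e := nx a with he
  set f := nx b with hf
  have hNa : Next r a e := hnx a haT
  have hNb : Next r b f := hnx b hbT
  have hne : a ≠ b := fun h => hbO 0 h
  have hrab : ¬ r a b := by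
    intro hr
    have h1 := hNa.le b hr hne.symm
    have h2 := hNb.le a (r.symm hr) hne
    have h3 := arc_base_of_lt (p := a) (z := b) (w := v) (by linarith)
    rw [arc_swap hne] at h2
    linarith
  -- The holes at `a` and `b` share the critical value and that at `a` is no longer, so the whole
  -- class of `a` lies inside the hole at `b`.
  have hside : ∀ w, r a w → 0 < arc b w ∧ arc b w < arc b f := by
    have hnb : ∀ w, r a w → w ≠ b ∧ w ≠ f := fun w hw =>
      ⟨fun h => hrab (h ▸ hw), fun h => hrab (r.trans (h ▸ hw) (r.symm hNb.rel))⟩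
    have hpos : ∀ w, r a w → 0 < arc b w := fun w hw => arc_pos.2 (hnb w hw).1
    have hal : arc b a < arc b f := by
      by_contra! hle
      have hle' : arc b f < arc b a := lt_of_le_of_ne hle fun h =>
        (hnb a (r.refl a)).2 (arc_inj.1 h).symm
      have hel : arc b f ≤ arc b e := by
        by_contra! hlt
        have h1 := arc_le_of_not_cross (hpos e hNa.rel) hlt
          (hg.lam.not_cross hNb.rel (r.symm hNa.rel) fun h =>
            hrab (r.symm (r.trans h (r.symm hNa.rel))))
        linarith
      have h1 := arc_base_of_lt (p := b) (z := a) (w := v) (by linarith)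
      rcases le_or_gt (arc b a) (arc b e) with h2 | h2
      · have h3 := arc_base_of_le h2
        linarith [arc_lt_one b e]
      · have h3 := arc_base_of_lt h2
        linarith [arc_lt_one b a]
    intro w hw
    refine ⟨hpos w hw, lt_of_le_of_ne ?_ fun h => (hnb w hw).2 (arc_inj.1 h)⟩
    exact arc_le_of_not_cross (hpos a (r.refl a)) hal
      (hg.lam.not_cross hNb.rel hw fun h => hrab (r.symm h))
  obtain ⟨k, hk, hak⟩ := exists_class r a
  obtain ⟨w, hwk, hmax⟩ := Set.exists_max_image k (fun w => arc b w)
    (hg.lam.finite_classes k hk) ⟨a, hak⟩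
  have hw := (mem_class_iff hk hak).1 hwk
  -- Except at the last point `w` seen from `b`, the holes of this class are shorter than the hole
  -- at `b`. By the choice of `b` these points are in the orbit of `a`.
  have hOu : ∀ u, r a u → u ≠ w → ∃ n, (sigma 2)^[n] a = u := by
    intro u hu huw
    by_contra! hO
    have hle := hbmin u ⟨hTr haT hu, hO⟩
    have h1 := (hnx u (hTr haT hu)).le w (r.trans (r.symm hu) hw) huw.symm
    have h2 := arc_base_of_le (hmax u ((mem_class_iff hk hak).2 hu))
    linarith [hside u hu, hside w hw]
  -- Some iterate carries a point of this class to `b`. That point is not in the orbit of `a`, so it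
  -- is `w`.
  have hwO : ∀ n, (sigma 2)^[n] a ≠ w := by
    have hwT := hTr haT hw
    obtain ⟨i, hi⟩ := haT
    obtain ⟨j, hj⟩ := hbT
    have hrel : r ((sigma 2)^[j + (K * i - i)] a) b := by
      have h1 := hg.inv.rel_iterate hi (j + (K * i - i))
      rw [Function.iterate_add_apply, back ⟨0, r.refl x⟩] at h1
      exact r.trans (r.symm h1) hj
    obtain ⟨b', hb', hbb⟩ := hg.inv.exists_rel_of_rel_iterate hrel
    have : b' = w := by
      by_contra hne
      obtain ⟨n, hn⟩ := hOu b' hb' hne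
      exact hbO (j + (K * i - i) + n) (by rw [Function.iterate_add_apply, hn, hbb])
    rintro n hn
    exact hbO (j + (K * i - i) + n) (by rw [Function.iterate_add_apply, hn, ← this, hbb])
  have hwT := hTr haT hw
  have hNw := hnx w hwT
  obtain ⟨u', hu', hu1, hu2⟩ := hT3 hwT w (nx w)
  obtain ⟨i, hi⟩ := hOu (nx w) (r.trans hw hNw.rel) hNw.ne
  obtain ⟨j, hj⟩ := hOu u' (r.trans hw hu') hu1
  set n := j + (K * i - i) with hn
  have hmap : (sigma 2)^[n] (nx w) = u' := by
    rw [hn, Function.iterate_add_apply, ← hi, back haT, hj]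
  -- This iterate carries `nx w` to another point `u'` of the class, and it fixes `w`, the only
  -- point of the class outside the orbit. As it preserves successors, `u' = nx w`, a contradiction.
  have hfix : (sigma 2)^[n] w = w := by
    by_contra hne
    have h1 := hg.inv.rel_iterate hNw.rel n
    rw [hmap] at h1
    obtain ⟨m, hm⟩ := hOu ((sigma 2)^[n] w)
      (r.trans hw (r.trans hu' (r.symm h1))) hne
    obtain ⟨m', hm'⟩ := orb hwT n ⟨m, hm⟩
    exact hwO m' hm'
  have := hNw.iterate hg (hTpre hwT) n
  rw [hmap, hfix] at this
  exact hu2 (this.eq hNw)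

/-! ### Leaves are not diagonals of cells -/

/-- Two fixed points too close to each other would have their distance multiplied by `2 ^ K`. -/
lemma finite_setOf_iterate_eq {K : ℕ} (hK : 0 < K) : {z | (sigma 2)^[K] z = z}.Finite := by
  by_contra hinf
  obtain ⟨z, hz, w, hw, hne, hclose⟩ := exists_close (κ := Unit) hinf (fun z _ => z)
    (δ := 1 / 2 / 2 ^ K) (by positivity)
  have h1 := (chordLen_le_abs 1 z w).trans_lt (hclose ())
  rw [lt_div_iff₀ (by positivity)] at h1
  have h2 := chordLen_iterate h1.le
  rw [hz, hw] at h2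
  have h3 : (1 : ℝ) < 2 ^ K := one_lt_pow₀ (by norm_num) hK.ne'
  nlinarith [chordLen_pos hne]

/-- An iterate that moves one point of a class to the next moves all points to the next. -/
lemma Next.iterate_of_rel (hg : IsCriticalClass r g) {x z : Circle} {n : ℕ}
    (hpre : ∀ z, r x z → ¬ Precritical g z) (hx : Next r x ((GeoLam.sigma 2)^[n] x)) (hz : r x z) :
    Next r z ((GeoLam.sigma 2)^[n] z) := by
  obtain ⟨k, hk, hxk⟩ := exists_class r x
  have hfin := hg.lam.finite_classes k hk
  have hmem : ∀ {z}, z ∈ k ↔ r x z := fun {z} => mem_class_iff hk hxk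
  by_contra hbad
  -- At the first failure `w` after `x`, the preceding class point `u` does move to its successor
  -- `w`. Iterating the relation "`w` follows `u`" shows that `w` moves to its successor as well.
  obtain ⟨w, ⟨hwk, hw⟩, hmin⟩ := Set.exists_min_image
    {w | w ∈ k ∧ ¬ Next r w ((GeoLam.sigma 2)^[n] w)} (fun w => arc x w)
    (hfin.subset fun w hw => hw.1) ⟨z, hmem.2 hz, hbad⟩
  have hwx : w ≠ x := by rintro rfl; exact hw hx
  obtain ⟨u, ⟨huk, hu⟩, hmax⟩ := Set.exists_max_image {u | u ∈ k ∧ arc x u < arc x w}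
    (fun u => arc x u) (hfin.subset fun u hu => hu.1)
    ⟨x, hxk, by rw [arc_self]; exact arc_pos.2 hwx⟩
  have hxu := hmem.1 huk
  have huw : Next r u w := by
    refine ⟨r.trans (r.symm hxu) (hmem.1 hwk), fun h => by rw [h] at hu; exact hu.false,
      fun v hv hvu => ?_⟩
    rw [arc_base_of_le hu.le]
    have hvk := hmem.2 (r.trans hxu hv)
    rcases le_or_gt (arc x u) (arc x v) with hle | hlt
    · rw [arc_base_of_le hle]
      by_contra! hlt
      have h1 := hmax v ⟨hvk, by linarith⟩
      exact hvu (arc_inj.1 (le_antisymm h1 hle))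
    · rw [arc_base_of_lt hlt]
      linarith [arc_nonneg x v, arc_lt_one x w]
  have hun : Next r u ((GeoLam.sigma 2)^[n] u) := by
    by_contra h
    linarith [hmin u ⟨huk, h⟩]
  have h1 := huw.iterate hg (hpre u hxu) n
  rw [← huw.eq hun] at h1
  exact hw h1

/-- The periodic cell is a class with points on both sides of the chord. By transitivity an iterate
moves `x` to its successor, hence rotates the class by one step; since there are class points on
both sides, the image of the chord crosses it. -/
lemma IsDiagonal.not_leaf (hg : IsCriticalClass r g) {M : Circle → Circle → Prop}
    (hM : IsPulledBack g M) {x y t t' : Circle} (h : IsDiagonal r g x y t t') : ¬ M x y := by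
  intro hxy
  obtain ⟨n₀, K, hK, hfix⟩ := h.exists_periodic hg hM hxy
  replace hxy := hM.iterate hxy n₀
  replace h := h.iterate hg n₀
  generalize (sigma 2)^[n₀] x = x at *
  generalize (sigma 2)^[n₀] y = y at *
  generalize (sigma 2)^[n₀] t = t at *
  generalize (sigma 2)^[n₀] t' = t' at *
  have hreg := h.regular
  have hpx := hg.not_precritical_of_periodic hK (hfix x hreg.left_mem)
  have hrel : ∀ z ∈ cell r g x y, r x z := fun z hz => by
    refine hz.1.symm.rel_of_finite hg ((finite_setOf_iterate_eq hK).subset fun w hw => ?_)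
    by_cases hzx : z = x
    · subst hzx
      have := hw.2.2
      rw [arc_self] at this
      exact absurd this (not_lt.2 (arc_nonneg _ _))
    have hreg' : Regular r g x z := ⟨fun h => hzx h.symm, hz.1.symm, fun h => hpx h.2⟩
    exact hfix w (hreg.cell_eq hg hreg' hreg.left_mem hz ▸ hw.1)
  have hryx := hrel y hreg.right_mem
  have hmem : ∀ z, r x z → z ∈ cell r g x y := by
    intro z hz
    have key : ∀ w, r x w → Unseparated r g z w := fun w hw u v huv hu =>
      hg.lam.not_cross huv (r.trans (r.symm hz) hw) fun h =>
        hpx (hg.precritical_of_rel (r.trans h (r.symm hz)) hu)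
    exact ⟨key x (r.refl x), key y hryx⟩
  have hper : ∀ z, r x z → (sigma 2)^[K] z = z := fun z hz => hfix z (hmem z hz)
  obtain ⟨s, s', hs, hs', hs0, hsy, hsy'⟩ : ∃ s s', r x s ∧ r x s' ∧ 0 < arc x s ∧
      arc x s < arc x y ∧ arc x y < arc x s' := by
    have hx := h.cross 0
    simp only [Function.iterate_zero, id_eq] at hx
    rw [cross_iff x, alternate_iff, arc_self] at hx
    have b1 := arc_nonneg x t
    have b2 := arc_nonneg x t'
    have b3 := arc_nonneg x y
    have : (0 < arc x t ∧ arc x t < arc x y ∧ arc x y < arc x t') ∨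
        (0 < arc x t' ∧ arc x t' < arc x y ∧ arc x y < arc x t) := by grind
    rcases this with hh | hh
    · exact ⟨t, t', hrel t h.mem, hrel t' h.mem', hh⟩
    · exact ⟨t', t, hrel t' h.mem', hrel t h.mem, hh⟩
  have hsx : s ≠ x := arc_pos.1 hs0
  obtain ⟨w, hw⟩ := hg.exists_next hs hsx
  obtain ⟨n, rfl⟩ := hg.exists_iterate_eq hK hper hs hryx hsx hreg.ne.symm
    (by rintro rfl; exact hsy.false) hw.rel
  have hy := hw.iterate_of_rel hg
    (fun z hz => hg.not_precritical_of_periodic hK (hper z hz)) hryx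
  refine hM.not_cross hxy (hM.iterate hxy n) ?_
  rw [cross_iff x, alternate_iff, arc_self]
  have h1 := hw.le s hs hsx
  have h2 := hy.le s' (r.trans (r.symm hryx) hs') (by rintro rfl; exact hsy'.false)
  rw [arc_base_of_le hsy'.le] at h2
  have h3 := arc_add (p := x) (a := y) (b := (sigma 2)^[n] y) (by linarith [arc_lt_one x s'])
  have h4 := arc_pos.2 hy.ne
  exact Or.inl ⟨arc_pos.2 hw.ne, by linarith, by linarith⟩

/-- The critical class determines the lamination. -/
lemma IsPulledBack.mono (hg : IsCriticalClass r g) {M M' : Circle → Circle → Prop}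
    (hM : IsPulledBack g M) (hM' : IsPulledBack g M') {x y : Circle} (h : M x y) : M' x y := by
  by_cases hxy : x = y
  · subst hxy; exact hM'.refl x
  have hun := hM.unseparated hg h
  by_cases hr : r x y ∧ Precritical g x
  -- Inside a precritical class, being unseparated means being an edge of that class.
  · refine hM'.of_adjacent hg ⟨hr.1, fun c d hc hd hx => ?_⟩ hr.2
    exact hun c d (r.trans (r.symm hc) hd) (hg.precritical_of_rel hc hr.2) hx.symm
  have hreg : Regular r g x y := ⟨hxy, hun, hr⟩
  by_cases h1 : (innerCell r g x y).Nonempty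
  · by_cases h2 : (innerCell r g y x).Nonempty
    · obtain ⟨t, t', hd⟩ := hreg.exists_isDiagonal hg h1 h2
      exact absurd h (hd.not_leaf hg hM)
    · exact hM'.symm (hM'.of_innerCell_eq_empty hg (hreg.symm hg)
        (Set.not_nonempty_iff_eq_empty.1 h2))
  · exact hM'.of_innerCell_eq_empty hg hreg (Set.not_nonempty_iff_eq_empty.1 h1)

end

end GeoLam

/-! ### The theorem. -/

theorem mainTheorem3 (L : Set GeoLam.Chord) (hL : GeoLam.IsInvariantQLamination 2 L)
    (Q : Set ℂ) (hQ : GeoLam.IsGeneralizedCriticalQuadrilateral Q)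
    (hLQ : GeoLam.IsCriticalSet L Q) :
    GeoLam.IsSiblingInvariant 2 L ∧
      ∀ L' : Set GeoLam.Chord, GeoLam.IsSiblingInvariant 2 L' → GeoLam.IsCriticalSet L' Q →
        L' = L := by
  obtain ⟨r, hr, hi, rfl⟩ := hL
  have hsib := GeoLam.isSiblingInvariant_leavesOf hr hi
  refine ⟨hsib, fun L' hL' hLQ' => ?_⟩
  obtain ⟨g, hfin, hne, hneg, rfl⟩ := hQ.exists_hull
  have hM := hsib.isPulledBack hLQ
  have hM' := hL'.isPulledBack hLQ'
  -- The edges of `Q` are leaves of the q-lamination because `Q` is one of its critical sets; this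
  -- makes the vertex set a full class.
  have hg : GeoLam.IsCriticalClass r g := ⟨hr, hi,
    GeoLam.mem_classes_of_edges hi hfin hne hneg fun a ha b hb hab =>
      (GeoLam.mem_leavesOf_iff hr).1 (hM.edge ha hb hab), hne, hneg⟩
  ext l
  induction l using Sym2.ind with
  | _ a b => exact ⟨hM'.mono hg hM, hM.mono hg hM'⟩

end
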